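/- Let $d\ge 1$ and $\rho\in(0,\infty)$; all functions are real-valued. Let $H^1(\mathbb{R}^d)$ be the usual Sobolev space with distributional gradient $\nabla$, and put, with $0\log 0=0$, $$\mathcal H(g^2)=\rho\int_{\mathbb{R}^d}g^2(x)\log g^2(x)\,dx,\qquad \chi(\rho)=\inf_{g\in H^1(\mathbb{R}^d),\ \|g\|_2=1}\big\{\|\nabla g\|_2^2-\mathcal H(g^2)\big\}.$$ Further, for measurable $\psi\colon\mathbb{R}^d\to\mathbb{R}$, let $$\mathcal L(\psi)=\sup_{g\in L^2(\mathbb{R}^d)}\big\{\langle g^2,\psi\rangle-\mathcal H(g^2)\big\},\qquad \lambda(\psi)=\sup_{g\in H^1(\mathbb{R}^d),\ \|g\|_2=1}\big\{\langle\psi,g^2\rangle-\|\nabla g\|_2^2\big\},$$ where the integrals are $[-\infty,\infty]$-valued, $\langle\psi,g^2\rangle=\int\psi g^2$, and both suprema are over those $g$ for which the expression in braces is well defined in $[-\infty,\infty]$. Let $$g_\rho(x)=\Big(\frac\rho\pi\Big)^{d/4}e^{-\frac\rho2|x|^2},\qquad \psi_\rho(x)=\rho+\rho\,\frac d2\log\frac\rho\pi-\rho^2|x|^2,\qquad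 x\in\mathbb{R}^d.$$ Then: 1. For every $g\in H^1(\mathbb{R}^d)$, $\mathcal H(g^2)\in[-\infty,\infty)$ is well defined. The infimum $\chi(\rho)$ is attained, and $g\in H^1(\mathbb{R}^d)$ with $\|g\|_2=1$ is a minimiser if and only if there is $a\in\mathbb{R}^d$ such that $g=g_\rho(\cdot-a)$ almost everywhere or $g=-g_\rho(\cdot-a)$ almost everywhere. 2. $\chi(\rho)=\rho d\big(1-\tfrac12\log\tfrac\rho\pi\big)$. 3. For every measurable $\psi\colon\mathbb{R}^d\to\mathbb{R}$, $\mathcal L(\psi)=\frac\rho e\int_{\mathbb{R}^d}e^{\frac1\rho\psi(x)}\,dx$, as an identity in $[0,\infty]$. 4. $\chi(\rho)=\inf_{\psi\in\mathcal C(\mathbb{R}^d)}\big\{\mathcal L(\psi)-\lambda(\psi)\big\}$, where $\mathcal C(\mathbb{R}^d)$ is the set of continuous functions $\mathbb{R}^d\to\mathbb{R}$ and $\mathcal L(\psi)-\lambda(\psi)$ is read as $+\infty$ if $\mathcal L(\psi)=+\infty$. This infimum is attained, and $\psi\in\mathcal C(\mathbb{R}^d)$ is a minimiser if and only if $\psi=\psi_\rho(\cdot-a)$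 for some $a\in\mathbb{R}^d$. -/

import Mathlib

open MeasureTheory
open scoped ENNReal

noncomputable section

namespace LogSobolevVar

/-- The space `ℝ^d` with its Euclidean norm. -/
abbrev E (d : ℕ) : Type := EuclideanSpace ℝ (Fin d)

/-! ### Integrals with values in `[-∞, ∞]` -/

/-- The Lebesgue integral of `f` exists in the extended sense: at least one of
`∫ f⁺` and `∫ f⁻` is finite. -/
def HasExtIntegral {d : ℕ} (f : E d → ℝ) : Prop :=
  (∫⁻ x, ENNReal.ofReal (f x)) ≠ ⊤ ∨ (∫⁻ x, ENNReal.ofReal (-f x)) ≠ ⊤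

/-- The integral `∫ f = ∫ f⁺ - ∫ f⁻ ∈ [-∞, ∞]`; meaningful if `HasExtIntegral f`. -/
def extIntegral {d : ℕ} (f : E d → ℝ) : EReal :=
  ((∫⁻ x, ENNReal.ofReal (f x) : ℝ≥0∞) : EReal) -
    ((∫⁻ x, ENNReal.ofReal (-f x) : ℝ≥0∞) : EReal)

/-! ### The Sobolev space `H¹(ℝ^d)` -/

/-- `G` is a square-integrable distributional gradient of `g`. -/
def IsWeakGradient {d : ℕ} (g : E d → ℝ) (G : E d → E d) : Prop :=
  MemLp G 2 volume ∧
    ∀ φ : E d → ℝ, ContDiff ℝ (⊤ : ℕ∞) φ → HasCompactSupport φ → ∀ v : E d,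
      ∫ x, g x * fderiv ℝ φ x v = -∫ x, inner ℝ (G x) v * φ x

/-- `g ∈ H¹(ℝ^d)` (real-valued). -/
def MemH1 {d : ℕ} (g : E d → ℝ) : Prop :=
  MemLp g 2 volume ∧ ∃ G : E d → E d, IsWeakGradient g G

open Classical in
/-- The distributional gradient of `g ∈ H¹(ℝ^d)` (unique up to a null set); zero if there is no
square-integrable one. -/
def weakGradient {d : ℕ} (g : E d → ℝ) : E d → E d :=
  if h : ∃ G : E d → E d, IsWeakGradient g G then h.choose else 0

/-- `‖∇g‖₂²`, for `g ∈ H¹(ℝ^d)`. -/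
def gradNormSq {d : ℕ} (g : E d → ℝ) : ℝ :=
  ∫ x, ‖weakGradient g x‖ ^ 2

/-- The set of all `g ∈ H¹(ℝ^d)` with `‖g‖₂ = 1`. -/
def unitH1 (d : ℕ) : Set (E d → ℝ) :=
  {g | MemH1 g ∧ eLpNorm g 2 volume = 1}

/-! ### The functionals -/

/-- The integrand `ρ g² log g²` (with `0 log 0 = 0`). -/
def entropyIntegrand {d : ℕ} (ρ : ℝ) (g : E d → ℝ) : E d → ℝ :=
  fun x => ρ * (g x ^ 2 * Real.log (g x ^ 2))

/-- `ℋ(g²) = ρ ∫ g² log g²`. -/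
def entropy {d : ℕ} (ρ : ℝ) (g : E d → ℝ) : EReal :=
  extIntegral (entropyIntegrand ρ g)

/-- `‖∇g‖₂² - ℋ(g²)`. -/
def energy {d : ℕ} (ρ : ℝ) (g : E d → ℝ) : EReal :=
  (gradNormSq g : EReal) - entropy ρ g

/-- `χ(ρ) = inf {‖∇g‖₂² - ℋ(g²) : g ∈ H¹(ℝ^d), ‖g‖₂ = 1}`. -/
def chi (d : ℕ) (ρ : ℝ) : EReal :=
  ⨅ g ∈ unitH1 d, energy ρ g

/-- `⟨ψ, g²⟩ = ∫ ψ g²`. -/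
def pairing {d : ℕ} (ψ g : E d → ℝ) : EReal :=
  extIntegral fun x => ψ x * g x ^ 2

/-- The Legendre transform `ℒ(ψ) = sup {⟨g², ψ⟩ - ℋ(g²) : g ∈ L²(ℝ^d)}`. The supremum is over those
`g` for which the expression has a meaning in `[-∞, ∞]`: both integrals are required to exist,
and a difference of two equal infinities is `⊥` in `EReal`, so that it does not count. -/
def legendre {d : ℕ} (ρ : ℝ) (ψ : E d → ℝ) : EReal :=
  ⨆ g ∈ {g : E d → ℝ | MemLp g 2 volume ∧ HasExtIntegral (fun x => ψ x * g x ^ 2) ∧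
      HasExtIntegral (entropyIntegrand ρ g)},
    pairing ψ g - entropy ρ g

/-- The top of the spectrum of `Δ + ψ`,
`λ(ψ) = sup {⟨ψ, g²⟩ - ‖∇g‖₂² : g ∈ H¹(ℝ^d), ‖g‖₂ = 1}`, over those `g` for which `⟨ψ, g²⟩` exists
in `[-∞, ∞]`. -/
def specTop {d : ℕ} (ψ : E d → ℝ) : EReal :=
  ⨆ g ∈ {g : E d → ℝ | g ∈ unitH1 d ∧ HasExtIntegral (fun x => ψ x * g x ^ 2)},
    pairing ψ g - (gradNormSq g : EReal)

open Classical in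
/-- `ℒ(ψ) - λ(ψ)`, read as `+∞` whenever `ℒ(ψ) = +∞` (also if `λ(ψ) = +∞`, where `EReal`
subtraction would return `⊥`). -/
def dualFunctional {d : ℕ} (ρ : ℝ) (ψ : E d → ℝ) : EReal :=
  if legendre ρ ψ = ⊤ then ⊤ else legendre ρ ψ - specTop ψ

/-- `g_ρ(x) = (ρ/π)^{d/4} exp(-ρ|x|²/2)`. -/
def gaussian (d : ℕ) (ρ : ℝ) : E d → ℝ :=
  fun x => (ρ / Real.pi) ^ ((d : ℝ) / 4) * Real.exp (-(ρ / 2) * ‖x‖ ^ 2)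

/-- `ψ_ρ(x) = ρ + ρ (d/2) log(ρ/π) - ρ²|x|²`. -/
def parabola (d : ℕ) (ρ : ℝ) : E d → ℝ :=
  fun x => ρ + ρ * ((d : ℝ) / 2) * Real.log (ρ / Real.pi) - ρ ^ 2 * ‖x‖ ^ 2

end LogSobolevVar

end

/-! Everything rests on the sharp logarithmic Sobolev inequality in parametric form, `logSobolev`:
if ∫ g² = 1, then ∫ g² log g² ≤ 2τ‖∇g‖² - d - (d/2) log(2πτ). For τ = 1/(2ρ), the variance of the
density g_ρ², multiplication by ρ turns it into the lower bound `chiValue` for the energy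
(`mul_sharpBound`), and g_ρ attains it.

The inequality is obtained from the heat flow f_r = f * K_r started at f = g². By de Bruijn's
identity the entropy decreases at half the Fisher information of f_r. For every l, the score of f_r
at x is the mean, under the posterior law f(z) K_r(x - z) dz / f_r(x), of l times the score of f at
z plus 1 - l times the score of K_r at x - z. Jensen's inequality (the Blachman-Stam argument)
therefore bounds the Fisher information by `fisherBound`, which can be integrated in closed form for
l = τ/(τ + r). At large times convexity bounds the entropy of f_r by that of K_r, and the diverging
logarithms cancel. Since f_r log f_r need not be integrable a priori, s log s is replaced by s log(δ
+ s), which is still convex and whose second derivative is at most 1/s.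

Stability comes from what Jensen's inequality discards, a posterior variance. The Cauchy-Schwarz
inequality against ⟨u, x - z⟩ bounds it below by the square of `varianceDefect`, which vanishes
exactly when the posterior variance of ⟨u, x - z⟩ is rτ/(τ + r) for a unit vector u. If the deficits
of a sequence tend to zero while its densities converge in L¹, the defect of the limit vanishes for
almost every r. Then log f_r has second derivative -1/(τ + r) along every line, so f_r is Gaussian,
and r → 0 identifies the limit (`ae_eq_heatKernel_of_deficit_tendsto_zero`). Constant sequences give
the minimisers of the energy up to a choice of sign at each point, which `ae_eq_gaussian_of_sq`
makes global.

For the duality, Young's inequality for s² log s² is used with the remainder ρ(|s| - h)², where h is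
`dualProfile`. Integrated, it yields the Legendre transform; together with the logarithmic Sobolev
inequality it splits the dual gap of a trial function into two nonnegative terms
(`pairing_eq_bot_or_le`). If ψ is a dual minimiser, both terms tend to zero along a maximising
sequence for λ(ψ). As it is not known that λ(ψ) is attained, the equality case would not suffice
here; stability shows that h(ψ)² is Gaussian, and taking logarithms shows that ψ is a translated
parabola. -/

noncomputable section

open Filter Topology Set

namespace LogSobolevVar

variable {d : ℕ}

/-! ### Convolution with bounded kernels -/

/-- The convolution `∫ f(z) k(x - z) dz`. -/
def conv (f k : E d → ℝ) (x : E d) : ℝ := ∫ z, f z * k (x - z)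

theorem conv_eq_convolution (f k : E d → ℝ) :
    conv f k = MeasureTheory.convolution f k (ContinuousLinearMap.mul ℝ ℝ) volume := rfl

theorem integrable_mul_kernel {f k : E d → ℝ} (hf : Integrable f) (hk : Continuous k) {C : ℝ}
    (hC : ∀ y, |k y| ≤ C) (x : E d) : Integrable (fun z => f z * k (x - z)) :=
  hf.mul_bdd (c := C) (by fun_prop) (Eventually.of_forall fun z => hC _)

theorem abs_conv_le {f k : E d → ℝ} (hf : Integrable f) {C : ℝ}
    (hC : ∀ y, |k y| ≤ C) (x : E d) : |conv f k x| ≤ C * ∫ z, |f z| := by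
  rw [conv, ← Real.norm_eq_abs, ← integral_const_mul]
  refine norm_integral_le_of_norm_le (hf.abs.const_mul C) (Eventually.of_forall fun z => ?_)
  rw [norm_mul, mul_comm]
  exact mul_le_mul_of_nonneg_right (hC _) (abs_nonneg _)

theorem continuous_conv {f k : E d → ℝ} (hf : Integrable f) (hk : Continuous k) {C : ℝ}
    (hC : ∀ y, |k y| ≤ C) : Continuous (conv f k) := by
  refine continuous_of_dominated (bound := fun z => |f z| * C) (fun x => ?_) (fun x => ?_)
    (hf.abs.mul_const C) (Eventually.of_forall fun z => ?_)
  · exact (integrable_mul_kernel hf hk hC x).aestronglyMeasurable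
  · refine Eventually.of_forall fun z => ?_
    rw [norm_mul]
    exact mul_le_mul_of_nonneg_left (hC _) (abs_nonneg _)
  · fun_prop

theorem integrable_conv {f k : E d → ℝ} (hf : Integrable f) (hk : Integrable k) :
    Integrable (conv f k) := by
  rw [conv_eq_convolution]
  exact hf.integrable_convolution _ hk

theorem integral_conv {f k : E d → ℝ} (hf : Integrable f) (hk : Integrable k) :
    ∫ x, conv f k x = (∫ x, f x) * ∫ x, k x := by
  rw [conv_eq_convolution, integral_convolution _ hf hk]
  simp

/-- `HasLineDerivAt` speaks of time 0 only. Moving the base point along the line gives the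
derivative at every time, as needed for differentiation under the integral and for the differential
equations along lines. -/
theorem hasDerivAt_of_hasLineDerivAt {k k' : E d → ℝ} {u : E d}
    (h : ∀ y, HasLineDerivAt ℝ k (k' y) y u) (y : E d) (t : ℝ) :
    HasDerivAt (fun t : ℝ => k (y + t • u)) (k' (y + t • u)) t := by
  have h1 := h (y + t • u)
  rw [HasLineDerivAt] at h1
  have h2 : HasDerivAt (fun s : ℝ => s - t) 1 t := by
    simpa using (hasDerivAt_id t).sub_const t
  have h3 : HasDerivAt (fun s : ℝ => k (y + t • u + s • u)) (k' (y + t • u)) (t - t) := by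
    simpa using h1
  have h4 := HasDerivAt.comp (h := fun s : ℝ => s - t) t h3 h2
  rw [mul_one] at h4
  refine h4.congr_of_eventuallyEq (Eventually.of_forall fun s => ?_)
  simp only [Function.comp]
  congr 1
  rw [sub_smul]
  abel

theorem hasLineDerivAt_conv {f k k' : E d → ℝ} {u : E d} (hf : Integrable f) (hk : Continuous k)
    {C C' : ℝ} (hC : ∀ y, |k y| ≤ C) (hk' : Continuous k') (hC' : ∀ y, |k' y| ≤ C')
    (h : ∀ y, HasLineDerivAt ℝ k (k' y) y u) (x : E d) :
    HasLineDerivAt ℝ (conv f k) (conv f k' x) x u := by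
  rw [HasLineDerivAt]
  have := (hasDerivAt_integral_of_dominated_loc_of_deriv_le (μ := (volume : Measure (E d)))
    (F := fun (t : ℝ) z => f z * k (x + t • u - z))
    (F' := fun (t : ℝ) z => f z * k' (x + t • u - z)) (x₀ := (0 : ℝ)) (s := univ)
    (bound := fun z => |f z| * C') univ_mem
    (Eventually.of_forall fun t => (integrable_mul_kernel hf hk hC _).aestronglyMeasurable)
    (integrable_mul_kernel hf hk hC _)
    (integrable_mul_kernel hf hk' hC' _).aestronglyMeasurable
    (Eventually.of_forall fun z t _ => by
      rw [norm_mul]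
      exact mul_le_mul_of_nonneg_left (hC' _) (abs_nonneg _))
    (hf.abs.mul_const C')
    (Eventually.of_forall fun z t _ => by
      refine HasDerivAt.const_mul _ ?_
      have := hasDerivAt_of_hasLineDerivAt h (x - z) t
      simpa only [sub_add_eq_add_sub] using this)).2
  simpa only [zero_smul, add_zero] using! this

theorem hasDerivAt_conv_param {f : E d → ℝ} {k k' : ℝ → E d → ℝ} {r : ℝ} {s : Set ℝ}
    (hs : s ∈ 𝓝 r) (hf : Integrable f) (hk : ∀ r ∈ s, Continuous (k r))
    {C C' : ℝ} (hC : ∀ r ∈ s, ∀ y, |k r y| ≤ C) (hk' : ∀ r ∈ s, Continuous (k' r))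
    (hC' : ∀ r ∈ s, ∀ y, |k' r y| ≤ C')
    (h : ∀ r ∈ s, ∀ y, HasDerivAt (fun r => k r y) (k' r y) r) (x : E d) :
    HasDerivAt (fun r => conv f (k r) x) (conv f (k' r) x) r := by
  have hr := mem_of_mem_nhds hs
  exact (hasDerivAt_integral_of_dominated_loc_of_deriv_le (μ := (volume : Measure (E d)))
    (F := fun (t : ℝ) z => f z * k t (x - z))
    (F' := fun (t : ℝ) z => f z * k' t (x - z)) (x₀ := r) (s := s)
    (bound := fun z => |f z| * C') hs
    (by filter_upwards [hs] with t ht using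
      (integrable_mul_kernel hf (hk t ht) (hC t ht) _).aestronglyMeasurable)
    (integrable_mul_kernel hf (hk r hr) (hC r hr) _)
    (integrable_mul_kernel hf (hk' r hr) (hC' r hr) _).aestronglyMeasurable
    (Eventually.of_forall fun z t ht => by
      rw [norm_mul]
      exact mul_le_mul_of_nonneg_left (hC' t ht _) (abs_nonneg _))
    (hf.abs.mul_const C')
    (Eventually.of_forall fun z t ht => (h t ht _).const_mul _)).2

/-! ### The heat kernel -/

/-- The centred Gaussian density of variance `r` per coordinate. -/
def heatKernel (d : ℕ) (r : ℝ) (y : E d) : ℝ :=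
  (2 * Real.pi * r) ^ (-(d : ℝ) / 2) * Real.exp (-‖y‖ ^ 2 / (2 * r))

/-- `⟨u, y⟩` times the heat kernel. -/
def heatKernel₁ (r : ℝ) (u : E d) (y : E d) : ℝ := inner ℝ u y * heatKernel d r y

/-- `⟨u, y⟩²` times the heat kernel. -/
def heatKernel₂ (r : ℝ) (u : E d) (y : E d) : ℝ := inner ℝ u y ^ 2 * heatKernel d r y

theorem heatKernel_pos {r : ℝ} (hr : 0 < r) (y : E d) : 0 < heatKernel d r y := by
  unfold heatKernel; positivity

theorem continuous_heatKernel (r : ℝ) : Continuous (heatKernel d r) := by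
  unfold heatKernel; fun_prop

theorem continuous_heatKernel₁ (r : ℝ) (u : E d) : Continuous (heatKernel₁ r u) := by
  have := continuous_heatKernel (d := d) r
  unfold heatKernel₁; fun_prop

theorem continuous_heatKernel₂ (r : ℝ) (u : E d) : Continuous (heatKernel₂ r u) := by
  have := continuous_heatKernel (d := d) r
  unfold heatKernel₂; fun_prop

/-! ### Gaussian domination, uniform for times in a compact interval. -/

theorem integrable_exp_neg_mul_sq_norm {b : ℝ} (hb : 0 < b) :
    Integrable (fun y : E d => Real.exp (-b * ‖y‖ ^ 2)) := by
  have h := (GaussianFourier.integrable_cexp_neg_mul_sq_norm_add (V := E d) (b := (b : ℂ))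
    (by simpa using hb) 0 0).re
  refine h.congr (Eventually.of_forall fun y => ?_)
  simp only [zero_mul, add_zero]
  rw [show (-(b : ℂ) * (‖y‖ : ℂ) ^ 2) = ((-b * ‖y‖ ^ 2 : ℝ) : ℂ) by push_cast; ring]
  exact Complex.exp_ofReal_re _

theorem one_add_mul_exp_le {c t : ℝ} (hc : 0 < c) (ht : 0 ≤ t) :
    (1 + t) * Real.exp (-c * t) ≤ (1 + 1 / c) := by
  have h1 : Real.exp (-c * t) ≤ 1 := Real.exp_le_one_iff.2 (by nlinarith)
  have h2 : c * t * Real.exp (-c * t) ≤ 1 := by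
    have := Real.add_one_le_exp (c * t)
    have h3 : Real.exp (c * t) * Real.exp (-c * t) = 1 := by
      rw [← Real.exp_add]; simp
    nlinarith [Real.exp_pos (-c * t)]
  have h3 : t * Real.exp (-c * t) ≤ 1 / c := by
    rw [le_div_iff₀ hc]; linarith
  linarith

/-- Gaussian domination, uniformly for `r` in a compact interval. -/
theorem one_add_sq_mul_heatKernel_le {a b : ℝ} (ha : 0 < a) {r : ℝ} (har : a ≤ r)
    (hrb : r ≤ b) (y : E d) :
    (1 + ‖y‖ ^ 2) * heatKernel d r y ≤
      ((2 * Real.pi * a) ^ (-(d : ℝ) / 2) * (1 + 4 * b)) * Real.exp (-(1 / (4 * b)) * ‖y‖ ^ 2) := by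
  have hr : 0 < r := ha.trans_le har
  have hb : 0 < b := hr.trans_le hrb
  have h1 : (2 * Real.pi * r) ^ (-(d : ℝ) / 2) ≤ (2 * Real.pi * a) ^ (-(d : ℝ) / 2) := by
    apply Real.rpow_le_rpow_of_nonpos (by positivity)
    · have := Real.pi_pos; gcongr
    · have : (0 : ℝ) ≤ d := Nat.cast_nonneg d
      linarith
  -- The exponential is split into two equal factors at the largest time b: one absorbs 1 + ‖y‖²,
  -- the other remains as the integrable envelope.
  have h2 : Real.exp (-‖y‖ ^ 2 / (2 * r)) ≤
      Real.exp (-(1 / (4 * b)) * ‖y‖ ^ 2) * Real.exp (-(1 / (4 * b)) * ‖y‖ ^ 2) := by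
    rw [← Real.exp_add]
    apply Real.exp_le_exp.2
    have : ‖y‖ ^ 2 / (2 * b) ≤ ‖y‖ ^ 2 / (2 * r) := by gcongr
    have h3 : ‖y‖ ^ 2 / (2 * b) = (1 / (4 * b)) * ‖y‖ ^ 2 + (1 / (4 * b)) * ‖y‖ ^ 2 := by
      field_simp; ring
    rw [neg_div]; linarith
  have h3 := one_add_mul_exp_le (c := 1 / (4 * b)) (t := ‖y‖ ^ 2) (by positivity) (by positivity)
  rw [one_div_one_div] at h3
  have h0 : 0 ≤ (2 * Real.pi * a) ^ (-(d : ℝ) / 2) := by positivity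
  unfold heatKernel
  calc (1 + ‖y‖ ^ 2) * ((2 * Real.pi * r) ^ (-(d : ℝ) / 2) * Real.exp (-‖y‖ ^ 2 / (2 * r)))
      ≤ (1 + ‖y‖ ^ 2) * ((2 * Real.pi * a) ^ (-(d : ℝ) / 2) *
        (Real.exp (-(1 / (4 * b)) * ‖y‖ ^ 2) * Real.exp (-(1 / (4 * b)) * ‖y‖ ^ 2))) := by
        gcongr
    _ = (2 * Real.pi * a) ^ (-(d : ℝ) / 2) * ((1 + ‖y‖ ^ 2) * Real.exp (-(1 / (4 * b)) * ‖y‖ ^ 2))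
        * Real.exp (-(1 / (4 * b)) * ‖y‖ ^ 2) := by ring
    _ ≤ _ := by gcongr

/-- A Gaussian that dominates the heat kernel with its first two moments on `[a, b]`. -/
def envelope (a b : ℝ) (y : E d) : ℝ :=
  ((2 * Real.pi * a) ^ (-(d : ℝ) / 2) * (1 + 4 * b)) * Real.exp (-(1 / (4 * b)) * ‖y‖ ^ 2)

theorem integrable_envelope (a : ℝ) {b : ℝ} (hb : 0 < b) : Integrable (envelope (d := d) a b) :=
  (integrable_exp_neg_mul_sq_norm (by positivity)).const_mul _

theorem continuous_envelope (a b : ℝ) : Continuous (envelope (d := d) a b) := by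
  unfold envelope; fun_prop

theorem envelope_nonneg {a b : ℝ} (ha : 0 < a) (hb : 0 < b) (y : E d) : 0 ≤ envelope a b y := by
  unfold envelope; positivity

theorem envelope_le {a b : ℝ} (ha : 0 < a) (hb : 0 < b) (y : E d) :
    |envelope a b y| ≤ (2 * Real.pi * a) ^ (-(d : ℝ) / 2) * (1 + 4 * b) := by
  rw [abs_of_nonneg (envelope_nonneg ha hb y), envelope]
  apply mul_le_of_le_one_right (by positivity)
  apply Real.exp_le_one_iff.2
  have : 0 ≤ (1 / (4 * b)) * ‖y‖ ^ 2 := by positivity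
  linarith

theorem abs_le_envelope {a b : ℝ} (ha : 0 < a) {r : ℝ} (har : a ≤ r) (hrb : r ≤ b) {c p : ℝ}
    {y : E d} (hp : |p| ≤ c * (1 + ‖y‖ ^ 2)) (hc : 0 ≤ c) :
    |p * heatKernel d r y| ≤ c * envelope a b y := by
  have hr : 0 < r := ha.trans_le har
  rw [abs_mul, abs_of_pos (heatKernel_pos hr y)]
  calc |p| * heatKernel d r y ≤ c * (1 + ‖y‖ ^ 2) * heatKernel d r y :=
        mul_le_mul_of_nonneg_right hp (heatKernel_pos hr y).le
    _ = c * ((1 + ‖y‖ ^ 2) * heatKernel d r y) := by ring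
    _ ≤ _ := mul_le_mul_of_nonneg_left (one_add_sq_mul_heatKernel_le ha har hrb y) hc

theorem abs_inner_le_sq (u y : E d) : |inner ℝ u y| ≤ ‖u‖ * (1 + ‖y‖ ^ 2) := by
  refine (abs_real_inner_le_norm u y).trans (mul_le_mul_of_nonneg_left ?_ (norm_nonneg u))
  nlinarith [sq_nonneg (‖y‖ - 1), norm_nonneg y]

theorem inner_sq_le (u y : E d) : inner ℝ u y ^ 2 ≤ ‖u‖ ^ 2 * ‖y‖ ^ 2 := by
  rw [← mul_pow, ← sq_abs]
  exact pow_le_pow_left₀ (abs_nonneg _) (abs_real_inner_le_norm u y) 2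

theorem abs_inner_sq_le (u y : E d) : |inner ℝ u y ^ 2| ≤ ‖u‖ ^ 2 * (1 + ‖y‖ ^ 2) := by
  rw [abs_of_nonneg (sq_nonneg _)]
  refine (inner_sq_le u y).trans (mul_le_mul_of_nonneg_left ?_ (sq_nonneg _))
  linarith

theorem abs_heatKernel_le {a b : ℝ} (ha : 0 < a) {r : ℝ} (har : a ≤ r) (hrb : r ≤ b) (y : E d) :
    |heatKernel d r y| ≤ envelope a b y := by
  have := abs_le_envelope (d := d) ha har hrb (c := 1) (p := 1) (y := y)
    (by simp) zero_le_one
  simpa using this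

theorem abs_heatKernel₁_le {a b : ℝ} (ha : 0 < a) {r : ℝ} (har : a ≤ r) (hrb : r ≤ b) (u y : E d) :
    |heatKernel₁ r u y| ≤ ‖u‖ * envelope a b y :=
  abs_le_envelope ha har hrb (abs_inner_le_sq u y) (norm_nonneg _)

theorem abs_heatKernel₂_le {a b : ℝ} (ha : 0 < a) {r : ℝ} (har : a ≤ r) (hrb : r ≤ b) (u y : E d) :
    |heatKernel₂ r u y| ≤ ‖u‖ ^ 2 * envelope a b y :=
  abs_le_envelope ha har hrb (abs_inner_sq_le u y) (sq_nonneg _)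

theorem heatKernel_le {r : ℝ} (hr : 0 < r) (y : E d) :
    heatKernel d r y ≤ (2 * Real.pi * r) ^ (-(d : ℝ) / 2) := by
  unfold heatKernel
  apply mul_le_of_le_one_right (by positivity)
  apply Real.exp_le_one_iff.2
  rw [neg_div]
  have : 0 ≤ ‖y‖ ^ 2 / (2 * r) := by positivity
  linarith

theorem heatKernel_bound {r : ℝ} (hr : 0 < r) (y : E d) :
    |heatKernel d r y| ≤ (2 * Real.pi * r) ^ (-(d : ℝ) / 2) := by
  rw [abs_of_pos (heatKernel_pos hr y)]; exact heatKernel_le hr y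

/-- A common bound for the heat kernel and its moments. -/
def heatBound (d : ℕ) (r : ℝ) : ℝ := (2 * Real.pi * r) ^ (-(d : ℝ) / 2) * (1 + 4 * r)

theorem heatKernel₁_bound {r : ℝ} (hr : 0 < r) (u y : E d) :
    |heatKernel₁ r u y| ≤ ‖u‖ * heatBound d r :=
  (abs_heatKernel₁_le hr le_rfl le_rfl u y).trans
    (mul_le_mul_of_nonneg_left ((le_abs_self _).trans (envelope_le hr hr y)) (norm_nonneg _))

theorem heatKernel₂_bound {r : ℝ} (hr : 0 < r) (u y : E d) :
    |heatKernel₂ r u y| ≤ ‖u‖ ^ 2 * heatBound d r :=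
  (abs_heatKernel₂_le hr le_rfl le_rfl u y).trans
    (mul_le_mul_of_nonneg_left ((le_abs_self _).trans (envelope_le hr hr y)) (sq_nonneg _))

theorem integrable_heatKernel {r : ℝ} (hr : 0 < r) : Integrable (heatKernel d r) :=
  (integrable_envelope r hr).mono' (continuous_heatKernel r).aestronglyMeasurable
    (Eventually.of_forall fun y => abs_heatKernel_le hr le_rfl le_rfl y)

theorem integrable_heatKernel₁ {r : ℝ} (hr : 0 < r) (u : E d) : Integrable (heatKernel₁ r u) :=
  ((integrable_envelope r hr).const_mul _).mono' (continuous_heatKernel₁ r u).aestronglyMeasurable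
    (Eventually.of_forall fun y => abs_heatKernel₁_le hr le_rfl le_rfl u y)

theorem integrable_heatKernel₂ {r : ℝ} (hr : 0 < r) (u : E d) : Integrable (heatKernel₂ r u) :=
  ((integrable_envelope r hr).const_mul _).mono' (continuous_heatKernel₂ r u).aestronglyMeasurable
    (Eventually.of_forall fun y => abs_heatKernel₂_le hr le_rfl le_rfl u y)

/-! ### Mass, moments and derivatives of the heat kernel. -/

theorem integral_heatKernel {r : ℝ} (hr : 0 < r) : ∫ y, heatKernel d r y = 1 := by
  unfold heatKernel
  rw [integral_const_mul]
  have h := GaussianFourier.integral_rexp_neg_mul_sq_norm (V := E d) (b := 1 / (2 * r))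
    (by positivity)
  have h2 : ∀ y : E d, -‖y‖ ^ 2 / (2 * r) = -(1 / (2 * r)) * ‖y‖ ^ 2 := fun y => by ring
  simp_rw [h2]
  rw [h, finrank_euclideanSpace, Fintype.card_fin,
    show Real.pi / (1 / (2 * r)) = 2 * Real.pi * r by field_simp,
    neg_div, Real.rpow_neg (by positivity)]
  exact inv_mul_cancel₀ (by positivity)

theorem heatKernel_neg (r : ℝ) (y : E d) : heatKernel d r (-y) = heatKernel d r y := by
  simp [heatKernel]

theorem integral_heatKernel₁ (r : ℝ) (u : E d) : ∫ y, heatKernel₁ r u y = 0 := by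
  have h := integral_neg_eq_self (fun y => heatKernel₁ r u y) (volume : Measure (E d))
  simp only [heatKernel₁, heatKernel_neg, inner_neg_right, neg_mul, integral_neg] at h ⊢
  linarith

theorem hasLineDerivAt_heatKernel {r : ℝ} (hr : 0 < r) (u y : E d) :
    HasLineDerivAt ℝ (heatKernel d r) (-(1 / r) * heatKernel₁ r u y) y u := by
  rw [HasLineDerivAt]
  have h1 : HasDerivAt (fun t : ℝ => ‖y + t • u‖ ^ 2) (2 * inner ℝ (y + (0 : ℝ) • u) u) 0 := by
    have h : HasDerivAt (fun t : ℝ => y + t • u) u 0 := by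
      simpa using ((hasDerivAt_id (0 : ℝ)).smul_const u).const_add y
    exact h.norm_sq
  have h2 := ((h1.fun_neg.div_const (2 * r)).exp).const_mul ((2 * Real.pi * r) ^ (-(d : ℝ) / 2))
  convert! h2 using 1
  simp only [heatKernel₁, heatKernel, zero_smul, add_zero, real_inner_comm u y]
  field_simp

theorem hasLineDerivAt_inner (u y : E d) :
    HasLineDerivAt ℝ (fun y : E d => inner ℝ u y) (‖u‖ ^ 2) y u := by
  rw [HasLineDerivAt]
  simp only [inner_add_right, inner_smul_right, real_inner_self_eq_norm_sq]
  simpa using ((hasDerivAt_id (0 : ℝ)).mul_const (‖u‖ ^ 2)).const_add (inner ℝ u y)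

theorem hasLineDerivAt_heatKernel₁ {r : ℝ} (hr : 0 < r) (u y : E d) :
    HasLineDerivAt ℝ (heatKernel₁ r u)
      (‖u‖ ^ 2 * heatKernel d r y - (1 / r) * heatKernel₂ r u y) y u := by
  have h := HasDerivAt.mul (hasLineDerivAt_inner u y) (hasLineDerivAt_heatKernel hr u y)
  rw [HasLineDerivAt]
  convert! h using 1
  simp only [heatKernel₁, heatKernel₂, zero_smul, add_zero]
  ring

theorem sum_inner_sq (y : E d) :
    ∑ i, inner ℝ (EuclideanSpace.basisFun (Fin d) ℝ i) y ^ 2 = ‖y‖ ^ 2 := by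
  have := (EuclideanSpace.basisFun (Fin d) ℝ).sum_sq_norm_inner_right y
  simpa only [Real.norm_eq_abs, sq_abs] using this

theorem hasDerivAt_heatKernel {r : ℝ} (hr : 0 < r) (y : E d) :
    HasDerivAt (fun r => heatKernel d r y)
      ((‖y‖ ^ 2 / (2 * r ^ 2) - d / (2 * r)) * heatKernel d r y) r := by
  have hpi := Real.pi_pos
  have h1 : HasDerivAt (fun r : ℝ => (2 * Real.pi * r) ^ (-(d : ℝ) / 2))
      ((2 * Real.pi) * (-(d : ℝ) / 2) * (2 * Real.pi * r) ^ (-(d : ℝ) / 2 - 1)) r := by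
    have := ((hasDerivAt_id r).const_mul (2 * Real.pi)).rpow_const (p := -(d : ℝ) / 2)
      (Or.inl (by simp; positivity))
    simpa using this
  have h2 : HasDerivAt (fun r : ℝ => Real.exp (-‖y‖ ^ 2 / (2 * r)))
      (Real.exp (-‖y‖ ^ 2 / (2 * r)) * (‖y‖ ^ 2 / (2 * r ^ 2))) r := by
    have h3 : HasDerivAt (fun r : ℝ => -‖y‖ ^ 2 / (2 * r)) (‖y‖ ^ 2 / (2 * r ^ 2)) r := by
      have := (hasDerivAt_const r (-‖y‖ ^ 2)).div ((hasDerivAt_id r).const_mul 2)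
        (by simp; positivity)
      convert! this using 1
      simp; field_simp
    exact h3.exp
  convert! h1.mul h2 using 1
  rw [Real.rpow_sub_one (by positivity), heatKernel]
  field_simp
  ring

/-- The directional derivative of the first-moment kernel is ‖u‖² K_r - (1/r)⟨u, y⟩² K_r, and its
integral vanishes: this is integration by parts against the constant 1. -/
theorem integral_heatKernel₂ {r : ℝ} (hr : 0 < r) (u : E d) :
    ∫ y, heatKernel₂ r u y = r * ‖u‖ ^ 2 := by
  have h := integral_bilinear_hasLineDerivAt_right_eq_neg_left_of_integrable
    (μ := (volume : Measure (E d))) (B := ContinuousLinearMap.mul ℝ ℝ) (v := u)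
    (f := fun _ => (1 : ℝ)) (f' := fun _ => 0) (g := heatKernel₁ r u)
    (g' := fun y => ‖u‖ ^ 2 * heatKernel d r y - (1 / r) * heatKernel₂ r u y)
    (by simp) (by
      simp only [ContinuousLinearMap.mul_apply', one_mul]
      exact ((integrable_heatKernel hr).const_mul _).sub ((integrable_heatKernel₂ hr u).const_mul _))
    (by simpa using integrable_heatKernel₁ hr u)
    (fun x _ => by simp [HasLineDerivAt, hasDerivAt_const])
    (fun x _ => hasLineDerivAt_heatKernel₁ hr u x)
  simp only [ContinuousLinearMap.mul_apply', one_mul, zero_mul, integral_zero, neg_zero] at h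
  rw [integral_sub ((integrable_heatKernel hr).const_mul _)
    ((integrable_heatKernel₂ hr u).const_mul _), integral_const_mul, integral_const_mul,
    integral_heatKernel hr] at h
  field_simp at h
  linarith

/-! ### The heat flow and its moments -/

/-- The heat flow `f * K_r`. -/
def heatFlow (f : E d → ℝ) (r : ℝ) : E d → ℝ := conv f (heatKernel d r)

/-- The first moment `∫ f(z) ⟨u, x - z⟩ K_r(x - z) dz`. -/
def heatFlow₁ (f : E d → ℝ) (r : ℝ) (u : E d) : E d → ℝ := conv f (heatKernel₁ r u)

/-- The second moment `∫ f(z) ⟨u, x - z⟩² K_r(x - z) dz`. -/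
def heatFlow₂ (f : E d → ℝ) (r : ℝ) (u : E d) : E d → ℝ := conv f (heatKernel₂ r u)

section moments

variable {f : E d → ℝ} {r : ℝ}

theorem heatFlow_nonneg (hf0 : ∀ z, 0 ≤ f z) (hr : 0 < r) (x : E d) : 0 ≤ heatFlow f r x :=
  integral_nonneg fun z => mul_nonneg (hf0 z) (heatKernel_pos hr _).le

theorem integrable_heatFlow_integrand (hf : Integrable f) (hr : 0 < r) (x : E d) :
    Integrable (fun z => f z * heatKernel d r (x - z)) :=
  integrable_mul_kernel hf (continuous_heatKernel r) (heatKernel_bound hr) x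

theorem integrable_heatFlow₁_integrand (hf : Integrable f) (hr : 0 < r) (u x : E d) :
    Integrable (fun z => f z * heatKernel₁ r u (x - z)) :=
  integrable_mul_kernel hf (continuous_heatKernel₁ r u) (heatKernel₁_bound hr u) x

theorem integrable_heatFlow₂_integrand (hf : Integrable f) (hr : 0 < r) (u x : E d) :
    Integrable (fun z => f z * heatKernel₂ r u (x - z)) :=
  integrable_mul_kernel hf (continuous_heatKernel₂ r u) (heatKernel₂_bound hr u) x

theorem heatFlow_le (hf : Integrable f) (hf0 : ∀ z, 0 ≤ f z) (hr : 0 < r) (x : E d) :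
    heatFlow f r x ≤ (2 * Real.pi * r) ^ (-(d : ℝ) / 2) * ∫ z, f z := by
  have := (le_abs_self _).trans (abs_conv_le hf (heatKernel_bound hr) x)
  simp only [abs_of_nonneg (hf0 _)] at this
  exact this

theorem heatFlow_pos (hf : Integrable f) (hf0 : ∀ z, 0 ≤ f z) (hpos : 0 < ∫ z, f z) (hr : 0 < r)
    (x : E d) : 0 < heatFlow f r x := by
  rw [integral_pos_iff_support_of_nonneg hf0 hf] at hpos
  refine (integral_pos_iff_support_of_nonneg (fun z => mul_nonneg (hf0 z) (heatKernel_pos hr _).le)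
    (integrable_heatFlow_integrand hf hr x)).2 (hpos.trans_le (measure_mono fun z hz => ?_))
  exact mul_ne_zero hz (heatKernel_pos hr _).ne'

theorem continuous_heatFlow (hf : Integrable f) (hr : 0 < r) : Continuous (heatFlow f r) :=
  continuous_conv hf (continuous_heatKernel r) (heatKernel_bound hr)

theorem continuous_heatFlow₁ (hf : Integrable f) (hr : 0 < r) (u : E d) :
    Continuous (heatFlow₁ f r u) :=
  continuous_conv hf (continuous_heatKernel₁ r u) (heatKernel₁_bound hr u)

theorem continuous_heatFlow₂ (hf : Integrable f) (hr : 0 < r) (u : E d) :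
    Continuous (heatFlow₂ f r u) :=
  continuous_conv hf (continuous_heatKernel₂ r u) (heatKernel₂_bound hr u)

theorem integrable_heatFlow (hf : Integrable f) (hr : 0 < r) : Integrable (heatFlow f r) :=
  integrable_conv hf (integrable_heatKernel hr)

theorem integrable_heatFlow₁ (hf : Integrable f) (hr : 0 < r) (u : E d) :
    Integrable (heatFlow₁ f r u) :=
  integrable_conv hf (integrable_heatKernel₁ hr u)

theorem integrable_heatFlow₂ (hf : Integrable f) (hr : 0 < r) (u : E d) :
    Integrable (heatFlow₂ f r u) :=
  integrable_conv hf (integrable_heatKernel₂ hr u)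

theorem integral_heatFlow (hf : Integrable f) (hr : 0 < r) :
    ∫ x, heatFlow f r x = ∫ x, f x := by
  rw [heatFlow, integral_conv hf (integrable_heatKernel hr), integral_heatKernel hr, mul_one]

theorem hasLineDerivAt_heatFlow (hf : Integrable f) (hr : 0 < r) (u x : E d) :
    HasLineDerivAt ℝ (heatFlow f r) (-(1 / r) * heatFlow₁ f r u x) x u := by
  have h := hasLineDerivAt_conv (k' := fun y => -(1 / r) * heatKernel₁ r u y)
    (C' := (1 / r) * (‖u‖ * heatBound d r)) hf
    (continuous_heatKernel r) (heatKernel_bound hr) ((continuous_heatKernel₁ r u).const_mul _)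
    (fun y => by
      rw [abs_mul, abs_neg, abs_of_pos (one_div_pos.2 hr)]
      exact mul_le_mul_of_nonneg_left (heatKernel₁_bound hr u y) (by positivity))
    (hasLineDerivAt_heatKernel hr u) x
  convert! h using 1
  simp only [heatFlow₁, conv, ← integral_const_mul]
  congr 1; ext z; ring

theorem hasLineDerivAt_heatFlow₁ (hf : Integrable f) (hr : 0 < r) (u x : E d) :
    HasLineDerivAt ℝ (heatFlow₁ f r u)
      (‖u‖ ^ 2 * heatFlow f r x - (1 / r) * heatFlow₂ f r u x) x u := by
  have h := hasLineDerivAt_conv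
    (k' := fun y => ‖u‖ ^ 2 * heatKernel d r y - (1 / r) * heatKernel₂ r u y)
    (C' := ‖u‖ ^ 2 * (2 * Real.pi * r) ^ (-(d : ℝ) / 2) + (1 / r) * (‖u‖ ^ 2 * heatBound d r)) hf
    (continuous_heatKernel₁ r u) (heatKernel₁_bound hr u)
    (((continuous_heatKernel r).const_mul _).sub ((continuous_heatKernel₂ r u).const_mul _))
    (fun y => by
      refine (abs_sub _ _).trans (add_le_add ?_ ?_)
      · rw [abs_mul, abs_of_nonneg (sq_nonneg ‖u‖)]
        exact mul_le_mul_of_nonneg_left (heatKernel_bound hr y) (by positivity)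
      · rw [abs_mul, abs_of_pos (one_div_pos.2 hr)]
        exact mul_le_mul_of_nonneg_left (heatKernel₂_bound hr u y) (by positivity))
    (hasLineDerivAt_heatKernel₁ hr u) x
  convert! h using 1
  simp only [heatFlow, heatFlow₂, conv, ← integral_const_mul]
  rw [← integral_sub ((integrable_heatFlow_integrand hf hr x).const_mul _)
    ((integrable_heatFlow₂_integrand hf hr u x).const_mul _)]
  congr 1; ext z; ring

/-- The time derivative of the heat kernel. -/
def heatKernelDt (d : ℕ) (r : ℝ) (y : E d) : ℝ :=
  (‖y‖ ^ 2 / (2 * r ^ 2) - d / (2 * r)) * heatKernel d r y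

theorem continuous_heatKernelDt (r : ℝ) : Continuous (heatKernelDt d r) := by
  have := continuous_heatKernel (d := d) r
  unfold heatKernelDt; fun_prop

theorem abs_heatKernelDt_le {a b : ℝ} (ha : 0 < a) {r : ℝ} (har : a ≤ r) (hrb : r ≤ b) (y : E d) :
    |heatKernelDt d r y| ≤ (1 / (2 * a ^ 2) + d / (2 * a)) * envelope a b y := by
  have hr : 0 < r := ha.trans_le har
  refine abs_le_envelope ha har hrb ?_ (by positivity)
  have h1 : ‖y‖ ^ 2 / (2 * r ^ 2) ≤ ‖y‖ ^ 2 / (2 * a ^ 2) := by gcongr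
  have h2 : (d : ℝ) / (2 * r) ≤ d / (2 * a) := by gcongr
  refine (abs_sub _ _).trans ?_
  rw [abs_of_nonneg (by positivity), abs_of_nonneg (by positivity)]
  have h3 : 0 ≤ (d : ℝ) / (2 * a) * ‖y‖ ^ 2 := by positivity
  have h4 : (0 : ℝ) ≤ 1 / (2 * a ^ 2) := by positivity
  have h5 : ‖y‖ ^ 2 / (2 * a ^ 2) = 1 / (2 * a ^ 2) * ‖y‖ ^ 2 := by ring
  nlinarith

/-- This is the heat equation ∂_r f_r = ½ Δ f_r, with each second derivative written through the
second moment, so that integration by parts can be done coordinate by coordinate. -/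
theorem conv_heatKernelDt (hf : Integrable f) (hr : 0 < r) (x : E d) :
    conv f (heatKernelDt d r) x =
      1 / 2 * ∑ i, -(1 / r) * (heatFlow f r x -
        (1 / r) * heatFlow₂ f r (EuclideanSpace.basisFun (Fin d) ℝ i) x) := by
  have h : ∀ z, f z * heatKernelDt d r (x - z) = ∑ i, 1 / 2 * (-(1 / r) *
      (f z * heatKernel d r (x - z) - (1 / r) *
        (f z * heatKernel₂ r (EuclideanSpace.basisFun (Fin d) ℝ i) (x - z)))) := by
    intro z
    simp only [heatKernelDt, heatKernel₂, ← Finset.mul_sum, Finset.sum_sub_distrib,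
      Finset.sum_const, Finset.card_univ, Fintype.card_fin, nsmul_eq_mul]
    simp only [← mul_assoc, ← Finset.sum_mul]
    rw [sum_inner_sq]
    field_simp
    ring
  have hi : ∀ i, Integrable fun z => 1 / 2 * (-(1 / r) *
      (f z * heatKernel d r (x - z) - (1 / r) *
        (f z * heatKernel₂ r (EuclideanSpace.basisFun (Fin d) ℝ i) (x - z)))) := fun i =>
    (((integrable_heatFlow_integrand hf hr x).sub
      ((integrable_heatFlow₂_integrand hf hr _ x).const_mul _)).const_mul _).const_mul _
  simp only [conv, h]
  rw [integral_finsetSum _ fun i _ => hi i, Finset.mul_sum]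
  refine Finset.sum_congr rfl fun i _ => ?_
  rw [integral_const_mul, integral_const_mul, integral_sub (integrable_heatFlow_integrand hf hr x)
    ((integrable_heatFlow₂_integrand hf hr _ x).const_mul _), integral_const_mul]
  rfl

theorem hasDerivAt_heatFlow (hf : Integrable f) (hr : 0 < r) (x : E d) :
    HasDerivAt (fun r => heatFlow f r x) (conv f (heatKernelDt d r) x) r := by
  have hs : Icc (r / 2) (2 * r) ∈ 𝓝 r := Icc_mem_nhds (by linarith) (by linarith)
  refine hasDerivAt_conv_param hs hf (fun s _ => continuous_heatKernel s)
    (C := (2 * Real.pi * (r / 2)) ^ (-(d : ℝ) / 2) * (1 + 4 * (2 * r)))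
    (C' := (1 / (2 * (r / 2) ^ 2) + d / (2 * (r / 2))) *
      ((2 * Real.pi * (r / 2)) ^ (-(d : ℝ) / 2) * (1 + 4 * (2 * r))))
    (fun s hs y => ?_)
    (fun s _ => continuous_heatKernelDt s) (fun s hs y => ?_)
    (fun s hs y => hasDerivAt_heatKernel (by linarith [hs.1]) y) x
  · exact (abs_heatKernel_le (by positivity) hs.1 hs.2 y).trans
      ((le_abs_self _).trans (envelope_le (by positivity) (by positivity) y))
  · refine (abs_heatKernelDt_le (by positivity) hs.1 hs.2 y).trans ?_
    exact mul_le_mul_of_nonneg_left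
      ((le_abs_self _).trans (envelope_le (by positivity) (by positivity) y)) (by positivity)

end moments

/-! ### A regularised entropy -/

/-- The regularised entropy density `s log (δ + s)`. -/
def phi (δ s : ℝ) : ℝ := s * Real.log (δ + s)

/-- The derivative of `phi`. -/
def phi₁ (δ s : ℝ) : ℝ := Real.log (δ + s) + s / (δ + s)

/-- The second derivative of `phi`. -/
def phi₂ (δ s : ℝ) : ℝ := (s + 2 * δ) / (δ + s) ^ 2

section phi

variable {δ : ℝ}

theorem hasDerivAt_phi (hδ : 0 < δ) {s : ℝ} (hs : 0 ≤ s) : HasDerivAt (phi δ) (phi₁ δ s) s := by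
  have h1 : HasDerivAt (fun s => δ + s) 1 s := by simpa using (hasDerivAt_id s).const_add δ
  have h := (hasDerivAt_id s).mul (h1.log (by positivity))
  convert! h using 1
  simp [phi₁]; ring

theorem hasDerivAt_phi₁ (hδ : 0 < δ) {s : ℝ} (hs : 0 ≤ s) :
    HasDerivAt (phi₁ δ) (phi₂ δ s) s := by
  have h1 : HasDerivAt (fun s => δ + s) 1 s := by simpa using (hasDerivAt_id s).const_add δ
  have h := (h1.log (by positivity)).add ((hasDerivAt_id s).div h1 (by positivity))
  convert! h using 1
  simp only [phi₂, id]; field_simp; ring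

theorem phi₂_nonneg (hδ : 0 < δ) {s : ℝ} (hs : 0 ≤ s) : 0 ≤ phi₂ δ s := by
  unfold phi₂; positivity

/-- The bound φ'' ≤ 1/s says that the regularised dissipation never exceeds half the true Fisher
information, uniformly in δ. -/
theorem mul_phi₂_le (hδ : 0 < δ) {s : ℝ} (hs : 0 ≤ s) : s * phi₂ δ s ≤ 1 := by
  unfold phi₂
  rw [← mul_div_assoc, div_le_one (by positivity)]
  nlinarith [sq_nonneg δ]

theorem phi₂_le (hδ : 0 < δ) {s : ℝ} (hs : 0 ≤ s) : phi₂ δ s ≤ 2 / δ := by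
  unfold phi₂
  rw [div_le_div_iff₀ (by positivity) hδ]
  nlinarith [sq_nonneg s, mul_nonneg hδ.le hs]

theorem continuousOn_phi₁ (hδ : 0 < δ) : ContinuousOn (phi₁ δ) (Ici 0) := fun _ hs =>
  (hasDerivAt_phi₁ hδ hs).continuousAt.continuousWithinAt

theorem continuousOn_phi (hδ : 0 < δ) : ContinuousOn (phi δ) (Ici 0) := fun _ hs =>
  (hasDerivAt_phi hδ hs).continuousAt.continuousWithinAt

theorem continuousOn_phi₂ (hδ : 0 < δ) : ContinuousOn (phi₂ δ) (Ici 0) := by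
  intro s hs
  have hs : 0 ≤ s := hs
  unfold phi₂
  refine ContinuousAt.continuousWithinAt ?_
  refine ContinuousAt.div (by fun_prop) (by fun_prop) (by positivity)

theorem abs_log_add_le (hδ : 0 < δ) {s M : ℝ} (hs : 0 ≤ s) (hsM : s ≤ M) :
    |Real.log (δ + s)| ≤ |Real.log δ| + |Real.log (δ + M)| := by
  have h1 : Real.log δ ≤ Real.log (δ + s) := Real.log_le_log hδ (by linarith)
  have h2 : Real.log (δ + s) ≤ Real.log (δ + M) := Real.log_le_log (by linarith) (by linarith)
  rw [abs_le]
  constructor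
  · linarith [neg_abs_le (Real.log δ), abs_nonneg (Real.log (δ + M))]
  · linarith [le_abs_self (Real.log (δ + M)), abs_nonneg (Real.log δ)]

/-- The regularisation keeps the logarithm bounded near s = 0. On a bounded range the entropy
density is then dominated by a multiple of s, hence integrable along the flow. -/
theorem abs_phi_le (hδ : 0 < δ) {s M : ℝ} (hs : 0 ≤ s) (hsM : s ≤ M) :
    |phi δ s| ≤ (|Real.log δ| + |Real.log (δ + M)|) * s := by
  rw [phi, abs_mul, abs_of_nonneg hs, mul_comm]
  exact mul_le_mul_of_nonneg_right (abs_log_add_le hδ hs hsM) hs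

theorem abs_phi₁_le (hδ : 0 < δ) {s M : ℝ} (hs : 0 ≤ s) (hsM : s ≤ M) :
    |phi₁ δ s| ≤ |Real.log δ| + |Real.log (δ + M)| + 1 := by
  refine (abs_add_le _ _).trans (add_le_add (abs_log_add_le hδ hs hsM) ?_)
  rw [abs_of_nonneg (by positivity), div_le_one (by positivity)]
  linarith

/-- `phi` lies above its tangents. -/
theorem phi_tangent_le (hδ : 0 < δ) {s t : ℝ} (hs : 0 ≤ s) (ht : 0 ≤ t) :
    phi δ s + phi₁ δ s * (t - s) ≤ phi δ t := by
  have ha : 0 < δ + s := by positivity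
  have hb : 0 < δ + t := by positivity
  have h1 := Real.one_sub_inv_le_log_of_pos (div_pos hb ha)
  rw [Real.log_div hb.ne' ha.ne', inv_div] at h1
  have h2 := mul_le_mul_of_nonneg_left h1 ht
  -- What the inequality 1 - 1/x ≤ log x leaves over is this manifestly nonnegative quotient.
  have h3 : t * (1 - (δ + s) / (δ + t)) - s / (δ + s) * (t - s) =
      (t - s) ^ 2 * δ / ((δ + t) * (δ + s)) := by field_simp; ring
  have h4 : 0 ≤ (t - s) ^ 2 * δ / ((δ + t) * (δ + s)) := by positivity
  unfold phi phi₁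
  linarith

end phi

/-! ### The entropy along the heat flow -/

/-- The regularised entropy of the heat flow at time `r`. -/
def flowEntropy (δ : ℝ) (f : E d → ℝ) (r : ℝ) : ℝ := ∫ x, phi δ (heatFlow f r x)

/-- The regularised entropy dissipation of the heat flow at time `r`. -/
def dissipation (δ : ℝ) (f : E d → ℝ) (r : ℝ) : ℝ :=
  1 / 2 * ∑ i, ∫ x, phi₂ δ (heatFlow f r x) *
    ((1 / r) * heatFlow₁ f r (EuclideanSpace.basisFun (Fin d) ℝ i) x) ^ 2

section

variable {f : E d → ℝ} {δ r : ℝ}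

theorem continuous_phi_heatFlow (hδ : 0 < δ) (hf : Integrable f) (hf0 : ∀ z, 0 ≤ f z)
    (hr : 0 < r) : Continuous fun x => phi δ (heatFlow f r x) :=
  (continuousOn_phi hδ).comp_continuous (continuous_heatFlow hf hr) (heatFlow_nonneg hf0 hr)

theorem continuous_phi₁_heatFlow (hδ : 0 < δ) (hf : Integrable f) (hf0 : ∀ z, 0 ≤ f z)
    (hr : 0 < r) : Continuous fun x => phi₁ δ (heatFlow f r x) :=
  (continuousOn_phi₁ hδ).comp_continuous (continuous_heatFlow hf hr) (heatFlow_nonneg hf0 hr)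

theorem continuous_phi₂_heatFlow (hδ : 0 < δ) (hf : Integrable f) (hf0 : ∀ z, 0 ≤ f z)
    (hr : 0 < r) : Continuous fun x => phi₂ δ (heatFlow f r x) :=
  (continuousOn_phi₂ hδ).comp_continuous (continuous_heatFlow hf hr) (heatFlow_nonneg hf0 hr)

theorem integrable_phi_heatFlow (hδ : 0 < δ) (hf : Integrable f) (hf0 : ∀ z, 0 ≤ f z)
    (hr : 0 < r) : Integrable fun x => phi δ (heatFlow f r x) :=
  ((integrable_heatFlow hf hr).const_mul _).mono'
    (continuous_phi_heatFlow hδ hf hf0 hr).aestronglyMeasurable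
    (Eventually.of_forall fun x => abs_phi_le hδ (heatFlow_nonneg hf0 hr x)
      (heatFlow_le hf hf0 hr x))

/-- One factor of the square is integrable, the other is bounded, and φ'' ≤ 2/δ; without δ the
quotient by f_r would not be controlled. -/
theorem integrable_phi₂_mul_sq (hδ : 0 < δ) (hf : Integrable f) (hf0 : ∀ z, 0 ≤ f z)
    (hr : 0 < r) (u : E d) :
    Integrable fun x => phi₂ δ (heatFlow f r x) * ((1 / r) * heatFlow₁ f r u x) ^ 2 := by
  have h1 : Integrable fun x => heatFlow₁ f r u x * heatFlow₁ f r u x :=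
    (integrable_heatFlow₁ hf hr u).mul_bdd (c := ‖u‖ * heatBound d r * ∫ z, |f z|)
      (continuous_heatFlow₁ hf hr u).aestronglyMeasurable
      (Eventually.of_forall fun x => abs_conv_le hf (heatKernel₁_bound hr u) x)
  have h2 := (h1.bdd_mul (c := 2 / δ) (continuous_phi₂_heatFlow hδ hf hf0 hr).aestronglyMeasurable
    (Eventually.of_forall fun x => by
      rw [Real.norm_eq_abs, abs_of_nonneg (phi₂_nonneg hδ (heatFlow_nonneg hf0 hr x))]
      exact phi₂_le hδ (heatFlow_nonneg hf0 hr x))).const_mul ((1 / r) ^ 2)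
  refine h2.congr (Eventually.of_forall fun x => ?_)
  simp only
  ring

/-- Integration by parts moves one derivative from ∂²f_r onto φ'(f_r). There are no boundary terms
because φ' is bounded on the range of f_r, while f_r and its moments are integrable. -/
theorem integral_phi₁_mul_second_derivative (hδ : 0 < δ) (hf : Integrable f) (hf0 : ∀ z, 0 ≤ f z)
    (hr : 0 < r) (u : E d) :
    Integrable (fun x => phi₁ δ (heatFlow f r x) *
      (-(1 / r) * (‖u‖ ^ 2 * heatFlow f r x - (1 / r) * heatFlow₂ f r u x))) ∧
    ∫ x, phi₁ δ (heatFlow f r x) *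
      (-(1 / r) * (‖u‖ ^ 2 * heatFlow f r x - (1 / r) * heatFlow₂ f r u x)) =
    -∫ x, phi₂ δ (heatFlow f r x) * ((1 / r) * heatFlow₁ f r u x) ^ 2 := by
  set M := (2 * Real.pi * r) ^ (-(d : ℝ) / 2) * ∫ z, f z with hM
  have hb : ∀ x, ‖phi₁ δ (heatFlow f r x)‖ ≤ |Real.log δ| + |Real.log (δ + M)| + 1 := fun x =>
    abs_phi₁_le hδ (heatFlow_nonneg hf0 hr x) (heatFlow_le hf hf0 hr x)
  have hm := (continuous_phi₁_heatFlow hδ hf hf0 hr).aestronglyMeasurable (μ := volume)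
  have hi : Integrable (fun x => phi₁ δ (heatFlow f r x) *
      (-(1 / r) * (‖u‖ ^ 2 * heatFlow f r x - (1 / r) * heatFlow₂ f r u x))) := by
    refine Integrable.bdd_mul ?_ hm (Eventually.of_forall hb)
    exact (((integrable_heatFlow hf hr).const_mul _).sub
      ((integrable_heatFlow₂ hf hr u).const_mul _)).const_mul _
  refine ⟨hi, ?_⟩
  have h := integral_bilinear_hasLineDerivAt_right_eq_neg_left_of_integrable
    (μ := (volume : Measure (E d))) (B := ContinuousLinearMap.mul ℝ ℝ) (v := u)
    (f := fun x => phi₁ δ (heatFlow f r x))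
    (f' := fun x => phi₂ δ (heatFlow f r x) * (-(1 / r) * heatFlow₁ f r u x))
    (g := fun x => -(1 / r) * heatFlow₁ f r u x)
    (g' := fun x => -(1 / r) * (‖u‖ ^ 2 * heatFlow f r x - (1 / r) * heatFlow₂ f r u x))
    (by
      refine (integrable_phi₂_mul_sq hδ hf hf0 hr u).congr (Eventually.of_forall fun x => ?_)
      simp only [ContinuousLinearMap.mul_apply']
      ring)
    (by simpa only [ContinuousLinearMap.mul_apply'] using hi)
    (by
      simp only [ContinuousLinearMap.mul_apply']
      exact ((integrable_heatFlow₁ hf hr u).const_mul _).bdd_mul hm (Eventually.of_forall hb))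
    (fun x _ => by
      have h1 := hasLineDerivAt_heatFlow hf hr u x
      rw [HasLineDerivAt] at h1 ⊢
      have h2 : HasDerivAt (phi₁ δ) (phi₂ δ (heatFlow f r x)) (heatFlow f r (x + (0 : ℝ) • u)) := by
        simpa using hasDerivAt_phi₁ hδ (heatFlow_nonneg hf0 hr x)
      exact h2.comp (0 : ℝ) h1)
    (fun x _ => (hasLineDerivAt_heatFlow₁ hf hr u x).const_mul _)
  simp only [ContinuousLinearMap.mul_apply'] at h
  rw [h]
  congr 1
  refine integral_congr_ae (Eventually.of_forall fun x => ?_)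
  simp only
  ring

/-- **De Bruijn's identity** for the regularised entropy. -/
theorem hasDerivAt_flowEntropy (hδ : 0 < δ) (hf : Integrable f) (hf0 : ∀ z, 0 ≤ f z)
    (hr : 0 < r) : HasDerivAt (flowEntropy δ f) (-dissipation δ f r) r := by
  have hs : Icc (r / 2) (2 * r) ∈ 𝓝 r := Icc_mem_nhds (by linarith) (by linarith)
  set a := r / 2 with ha
  set b := 2 * r with hb
  have ha0 : 0 < a := by positivity
  have hb0 : 0 < b := by positivity
  -- The supremum bound of the flow decreases in time, so its value at the earliest time `a` serves
  -- on the whole interval.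
  set M := (2 * Real.pi * a) ^ (-(d : ℝ) / 2) * ∫ z, f z with hM
  set C := (1 / (2 * a ^ 2) + (d : ℝ) / (2 * a)) with hC
  have hle : ∀ s ∈ Icc a b, ∀ x, heatFlow f s x ≤ M := fun s hs x => by
    refine (heatFlow_le hf hf0 (ha0.trans_le hs.1) x).trans ?_
    refine mul_le_mul_of_nonneg_right ?_ (integral_nonneg hf0)
    apply Real.rpow_le_rpow_of_nonpos (by positivity)
    · have := Real.pi_pos; have := hs.1; gcongr
    · have : (0 : ℝ) ≤ d := Nat.cast_nonneg d
      linarith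
  -- The convolution of f with the envelope is one integrable function of x that dominates all time
  -- derivatives on the interval.
  have henv : Integrable (conv f (envelope a b)) := integrable_conv hf (integrable_envelope a hb0)
  have hdt : ∀ s ∈ Icc a b, ∀ x, |conv f (heatKernelDt d s) x| ≤ C * conv f (envelope a b) x := by
    intro s hs x
    rw [conv, conv, ← integral_const_mul, ← Real.norm_eq_abs]
    refine norm_integral_le_of_norm_le
      ((integrable_mul_kernel hf (continuous_envelope a b) (envelope_le ha0 hb0) x).const_mul C)
      (Eventually.of_forall fun z => ?_)
    rw [norm_mul, Real.norm_eq_abs, abs_of_nonneg (hf0 z), mul_left_comm]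
    exact mul_le_mul_of_nonneg_left (abs_heatKernelDt_le ha0 hs.1 hs.2 _) (hf0 z)
  have key := hasDerivAt_integral_of_dominated_loc_of_deriv_le (μ := (volume : Measure (E d)))
    (F := fun s x => phi δ (heatFlow f s x))
    (F' := fun s x => phi₁ δ (heatFlow f s x) * conv f (heatKernelDt d s) x) (x₀ := r)
    (s := Icc a b)
    (bound := fun x => (|Real.log δ| + |Real.log (δ + M)| + 1) * (C * conv f (envelope a b) x)) hs
    (by filter_upwards [hs] with s hs using
      (continuous_phi_heatFlow hδ hf hf0 (ha0.trans_le hs.1)).aestronglyMeasurable)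
    (integrable_phi_heatFlow hδ hf hf0 hr)
    (by
      refine (continuous_phi₁_heatFlow hδ hf hf0 hr).aestronglyMeasurable.mul ?_
      have : conv f (heatKernelDt d r) = fun x => 1 / 2 * ∑ i, -(1 / r) * (heatFlow f r x -
        (1 / r) * heatFlow₂ f r (EuclideanSpace.basisFun (Fin d) ℝ i) x) :=
        funext fun x => conv_heatKernelDt hf hr x
      rw [this]
      have h1 := continuous_heatFlow hf hr
      have h2 := continuous_heatFlow₂ hf hr
      exact Continuous.aestronglyMeasurable (by fun_prop))
    (Eventually.of_forall fun x s hs => by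
      rw [norm_mul]
      exact mul_le_mul (abs_phi₁_le hδ (heatFlow_nonneg hf0 (ha0.trans_le hs.1) x) (hle s hs x))
        (hdt s hs x) (abs_nonneg _) (by positivity))
    ((henv.const_mul _).const_mul _)
    (Eventually.of_forall fun x s hs =>
      HasDerivAt.comp (h₂ := phi δ) s (hasDerivAt_phi hδ (heatFlow_nonneg hf0 (ha0.trans_le hs.1) x))
        (hasDerivAt_heatFlow hf (ha0.trans_le hs.1) x))
  convert! key.2 using 1
  have hn : ∀ i, ‖EuclideanSpace.basisFun (Fin d) ℝ i‖ ^ 2 = 1 := fun i => by simp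
  have hx : ∀ x, phi₁ δ (heatFlow f r x) * conv f (heatKernelDt d r) x =
      1 / 2 * ∑ i, phi₁ δ (heatFlow f r x) * (-(1 / r) *
        (‖EuclideanSpace.basisFun (Fin d) ℝ i‖ ^ 2 * heatFlow f r x -
        (1 / r) * heatFlow₂ f r (EuclideanSpace.basisFun (Fin d) ℝ i) x)) := by
    intro x
    simp only [hn, one_mul, conv_heatKernelDt hf hr, ← Finset.mul_sum]
    ring
  simp only [hx]
  rw [integral_const_mul, integral_finsetSum _
    fun i _ => (integral_phi₁_mul_second_derivative hδ hf hf0 hr _).1]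
  simp only [(integral_phi₁_mul_second_derivative hδ hf hf0 hr _).2, dissipation]
  rw [Finset.sum_neg_distrib, mul_neg]

theorem dissipation_nonneg (hδ : 0 < δ) (hf0 : ∀ z, 0 ≤ f z) (hr : 0 < r) :
    0 ≤ dissipation δ f r := by
  refine mul_nonneg (by norm_num) (Finset.sum_nonneg fun i _ => integral_nonneg fun x => ?_)
  exact mul_nonneg (phi₂_nonneg hδ (heatFlow_nonneg hf0 hr x)) (sq_nonneg _)

theorem continuousOn_flowEntropy (hδ : 0 < δ) (hf : Integrable f) (hf0 : ∀ z, 0 ≤ f z) :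
    ContinuousOn (flowEntropy δ f) (Ioi 0) := fun _ hr =>
  (hasDerivAt_flowEntropy hδ hf hf0 hr).continuousAt.continuousWithinAt

/-- A nonnegative derivative of a continuous function is automatically integrable, so no regularity
of the dissipation in r has to be proved. -/
theorem integrableOn_dissipation (hδ : 0 < δ) (hf : Integrable f) (hf0 : ∀ z, 0 ≤ f z) {a b : ℝ}
    (ha : 0 < a) : IntegrableOn (dissipation δ f) (Ioc a b) := by
  refine intervalIntegral.integrableOn_deriv_of_nonneg (g := fun r => -flowEntropy δ f r)
    ?_ (fun r hr => ?_) (fun r hr => dissipation_nonneg hδ hf0 (ha.trans hr.1))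
  · exact ((continuousOn_flowEntropy hδ hf hf0).mono fun r hr => ha.trans_le hr.1).neg
  · simpa using (hasDerivAt_flowEntropy hδ hf hf0 (ha.trans hr.1)).fun_neg

theorem integral_dissipation (hδ : 0 < δ) (hf : Integrable f) (hf0 : ∀ z, 0 ≤ f z) {a b : ℝ}
    (ha : 0 < a) (hab : a ≤ b) :
    ∫ r in Ioc a b, dissipation δ f r = flowEntropy δ f a - flowEntropy δ f b := by
  rw [← intervalIntegral.integral_of_le hab]
  have h := intervalIntegral.integral_eq_sub_of_hasDerivAt (a := a) (b := b)
    (f := fun r => -flowEntropy δ f r) (f' := dissipation δ f) (fun r hr => ?_) ?_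
  · rw [h]; ring
  · rw [uIcc_of_le hab] at hr
    simpa using (hasDerivAt_flowEntropy hδ hf hf0 (ha.trans_le hr.1)).fun_neg
  · rw [intervalIntegrable_iff_integrableOn_Ioc_of_le hab]
    exact integrableOn_dissipation hδ hf hf0 ha

/-- Convexity bounds the entropy of the flow by that of the heat kernel. -/
theorem flowEntropy_le (hδ : 0 < δ) (hf : Integrable f) (hf0 : ∀ z, 0 ≤ f z)
    (hf1 : ∫ z, f z = 1) (hr : 0 < r) :
    flowEntropy δ f r ≤ ∫ y, phi δ (heatKernel d r y) := by
  have hbound : ∀ y, |phi δ (heatKernel d r y)| ≤ _ := fun y =>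
    abs_phi_le hδ (heatKernel_pos hr y).le (heatKernel_le hr y)
  have hcont : Continuous fun y => phi δ (heatKernel d r y) :=
    (continuousOn_phi hδ).comp_continuous (continuous_heatKernel r)
      fun y => (heatKernel_pos hr y).le
  have hint : Integrable fun y => phi δ (heatKernel d r y) :=
    ((integrable_heatKernel hr).const_mul _).mono' hcont.aestronglyMeasurable
      (Eventually.of_forall hbound)
  have hbound' : ∀ y, |phi δ (heatKernel d r y)| ≤
      (|Real.log δ| + |Real.log (δ + (2 * Real.pi * r) ^ (-(d : ℝ) / 2))|) *
        (2 * Real.pi * r) ^ (-(d : ℝ) / 2) := fun y =>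
    (hbound y).trans (mul_le_mul_of_nonneg_left (heatKernel_le hr y) (by positivity))
  have h1 : ∀ x, phi δ (heatFlow f r x) ≤ conv f (fun y => phi δ (heatKernel d r y)) x := by
    intro x
    set m := heatFlow f r x with hm
    have hm0 : 0 ≤ m := heatFlow_nonneg hf0 hr x
    have hi := integrable_heatFlow_integrand hf hr x
    -- Jensen's inequality by the tangent at m = f_r(x): as ∫ f = 1 and ∫ f(z) K_r(x - z) dz = m,
    -- the value φ(m) is the f-average of the tangent.
    have h2 : phi δ m = ∫ z, ((phi δ m - phi₁ δ m * m) * f z +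
        phi₁ δ m * (f z * heatKernel d r (x - z))) := by
      rw [integral_add (hf.const_mul _) (hi.const_mul _), integral_const_mul, integral_const_mul,
        hf1, show (∫ z, f z * heatKernel d r (x - z)) = m from rfl]
      ring
    rw [h2, conv]
    refine integral_mono ((hf.const_mul _).add (hi.const_mul _))
      (integrable_mul_kernel hf hcont hbound' x) fun z => ?_
    have := mul_le_mul_of_nonneg_left
      (phi_tangent_le hδ hm0 (heatKernel_pos hr (x - z)).le) (hf0 z)
    simp only
    linarith
  calc flowEntropy δ f r ≤ ∫ x, conv f (fun y => phi δ (heatKernel d r y)) x :=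
        integral_mono (integrable_phi_heatFlow hδ hf hf0 hr) (integrable_conv hf hint) h1
    _ = _ := by rw [integral_conv hf hint, hf1, one_mul]

end

/-! ### Approximation of the identity in `L^p` -/

/-- Composition with translations acts continuously on L^p for finite p; here this is evaluated at
the trivial translation and read back on representatives. -/
theorem tendsto_eLpNorm_translate_sub {p : ℝ≥0∞} (hp1 : 1 ≤ p) (hp : p ≠ ⊤) {f : E d → ℝ}
    (hf : MemLp f p volume) :
    Tendsto (fun y : E d => eLpNorm (fun x => f (x - y) - f x) p volume) (𝓝 0) (𝓝 0) := by
  have : Fact (1 ≤ p) := ⟨hp1⟩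
  have hmp : ∀ y : E d, MeasurePreserving (fun x : E d => x - y) volume volume := fun y =>
    measurePreserving_sub_right volume y
  let G : C(E d, C(E d, E d)) := ContinuousMap.curry ⟨fun a : E d × E d => a.2 - a.1, by fun_prop⟩
  have hc : Continuous fun y : E d => Lp.compMeasurePreserving (fun x : E d => x - y) (hmp y)
      (hf.toLp f) :=
    Continuous.compMeasurePreservingLp (f := fun _ => hf.toLp f) (g := G) continuous_const
      G.continuous hmp hp
  have h0 := (hc.tendsto 0).edist (tendsto_const_nhds (x := Lp.compMeasurePreserving
    (fun x : E d => x - 0) (hmp 0) (hf.toLp f)))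
  rw [edist_self] at h0
  refine h0.congr fun y => ?_
  rw [Lp.edist_def]
  refine eLpNorm_congr_ae ?_
  filter_upwards [Lp.coeFn_compMeasurePreserving (hf.toLp f) (hmp y),
    Lp.coeFn_compMeasurePreserving (hf.toLp f) (hmp 0), hf.coeFn_toLp,
    (hmp y).quasiMeasurePreserving.ae_eq_comp hf.coeFn_toLp] with x h1 h2 h3 h4
  simp only [Pi.sub_apply, h1, h2]
  simp only [Function.comp, sub_zero] at h4 ⊢
  rw [h4, h3]

theorem eLpNorm_translate (p : ℝ≥0∞) {f : E d → ℝ} (hf : AEStronglyMeasurable f volume) (y : E d) :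
    eLpNorm (fun x => f (x - y)) p volume = eLpNorm f p volume :=
  eLpNorm_comp_measurePreserving hf (measurePreserving_sub_right volume y)

/-- Since k has mass 1, f * k - f is the mean of f(x - y) - f(x) under the probability k(y) dy. The
power then goes inside by monotonicity of L^p norms over a probability space. -/
theorem enorm_conv_sub_rpow_le {p : ℝ} (hp : 1 ≤ p) {f k : E d → ℝ}
    (hf : AEStronglyMeasurable f volume) (hk : Continuous k) (hk0 : ∀ y, 0 ≤ k y)
    (hki : Integrable k) (hk1 : ∫ y, k y = 1) {x : E d}
    (hi : Integrable fun z => f z * k (x - z)) :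
    ‖conv f k x - f x‖ₑ ^ p ≤ ∫⁻ y, ENNReal.ofReal (k y) * ‖f (x - y) - f x‖ₑ ^ p := by
  have hp0 : 0 < p := by linarith
  have hi' : Integrable fun y => f (x - y) * k y := by
    have := hi.comp_sub_left x
    simpa using this
  have h1 : conv f k x - f x = ∫ y, k y * (f (x - y) - f x) := by
    have h2 : conv f k x = ∫ y, f (x - y) * k y := by
      rw [conv, ← integral_sub_left_eq_self _ volume x]
      simp
    have h3 : ∀ y, k y * (f (x - y) - f x) = f (x - y) * k y - k y * f x := fun y => by ring
    simp only [h3]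
    rw [integral_sub hi' (hki.mul_const _), integral_mul_const, hk1, one_mul, h2]
  have hkm : Measurable fun y => ENNReal.ofReal (k y) := by fun_prop
  have hfm : AEStronglyMeasurable (fun y => f (x - y) - f x) volume :=
    (hf.comp_quasiMeasurePreserving
      (quasiMeasurePreserving_sub_left volume x)).sub aestronglyMeasurable_const
  set ν := (volume : Measure (E d)).withDensity fun y => ENNReal.ofReal (k y) with hν
  have : IsProbabilityMeasure ν := by
    constructor
    rw [hν, withDensity_apply _ MeasurableSet.univ, Measure.restrict_univ,
      ← ofReal_integral_eq_lintegral_ofReal hki (Eventually.of_forall hk0), hk1, ENNReal.ofReal_one]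
  have h4 : ‖conv f k x - f x‖ₑ ≤ ∫⁻ y, ‖f (x - y) - f x‖ₑ ∂ν := by
    rw [h1, hν, lintegral_withDensity_eq_lintegral_mul₀ hkm.aemeasurable hfm.enorm]
    refine (enorm_integral_le_lintegral_enorm _).trans (lintegral_mono fun y => ?_)
    simp only [Pi.mul_apply, enorm_mul, Real.enorm_of_nonneg (hk0 y), le_refl]
  have h5 := eLpNorm'_le_eLpNorm'_of_exponent_le (f := fun y => f (x - y) - f x) zero_lt_one hp ν
    (hfm.mono_ac (withDensity_absolutelyContinuous _ _))
  simp only [eLpNorm', ENNReal.rpow_one, div_one] at h5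
  have h6 := ENNReal.rpow_le_rpow (h4.trans h5) hp0.le
  rw [← ENNReal.rpow_mul, one_div_mul_cancel hp0.ne', ENNReal.rpow_one] at h6
  refine h6.trans (le_of_eq ?_)
  rw [hν, lintegral_withDensity_eq_lintegral_mul₀ hkm.aemeasurable (hfm.enorm.pow_const _)]
  rfl

theorem lintegral_enorm_conv_sub_rpow_le {p : ℝ} (hp : 1 ≤ p) {f k : E d → ℝ}
    (hf : AEStronglyMeasurable f volume) (hk : Continuous k) (hk0 : ∀ y, 0 ≤ k y)
    (hki : Integrable k) (hk1 : ∫ y, k y = 1)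
    (hi : ∀ x, Integrable fun z => f z * k (x - z)) :
    ∫⁻ x, ‖conv f k x - f x‖ₑ ^ p ≤
      ∫⁻ y, ENNReal.ofReal (k y) * ∫⁻ x, ‖f (x - y) - f x‖ₑ ^ p := by
  have hsub : AEStronglyMeasurable (fun q : E d × E d => f (q.1 - q.2))
      ((volume : Measure (E d)).prod volume) :=
    hf.comp_quasiMeasurePreserving (quasiMeasurePreserving_sub volume volume)
  have hm : AEMeasurable (fun q : E d × E d => ENNReal.ofReal (k q.2) * ‖f (q.1 - q.2) - f q.1‖ₑ ^ p)
      ((volume : Measure (E d)).prod volume) := by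
    refine AEMeasurable.mul (by fun_prop) ?_
    exact (hsub.sub hf.comp_fst).enorm.pow_const _
  calc ∫⁻ x, ‖conv f k x - f x‖ₑ ^ p
      ≤ ∫⁻ x, ∫⁻ y, ENNReal.ofReal (k y) * ‖f (x - y) - f x‖ₑ ^ p :=
        lintegral_mono fun x => enorm_conv_sub_rpow_le hp hf hk hk0 hki hk1 (hi x)
    _ = ∫⁻ y, ∫⁻ x, ENNReal.ofReal (k y) * ‖f (x - y) - f x‖ₑ ^ p :=
        lintegral_lintegral_swap hm
    _ = _ := by
        refine lintegral_congr fun y => ?_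
        rw [lintegral_const_mul']
        exact ENNReal.ofReal_ne_top

theorem lintegral_enorm_rpow_eq {p : ℝ} (hp : 0 < p) (h : E d → ℝ) :
    ∫⁻ x, ‖h x‖ₑ ^ p = eLpNorm h (ENNReal.ofReal p) volume ^ p := by
  rw [eLpNorm_eq_lintegral_rpow_enorm_toReal (by simpa using hp) ENNReal.ofReal_ne_top,
    ENNReal.toReal_ofReal hp.le, ← ENNReal.rpow_mul, one_div_mul_cancel hp.ne', ENNReal.rpow_one]

theorem lintegral_translate_sub_rpow_le {p : ℝ} (hp : 1 ≤ p) {f : E d → ℝ}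
    (hf : AEStronglyMeasurable f volume) (y : E d) :
    ∫⁻ x, ‖f (x - y) - f x‖ₑ ^ p ≤ (2 * eLpNorm f (ENNReal.ofReal p) volume) ^ p := by
  have hp0 : 0 < p := by linarith
  rw [lintegral_enorm_rpow_eq hp0 (fun x => f (x - y) - f x)]
  refine ENNReal.rpow_le_rpow ?_ hp0.le
  refine (eLpNorm_sub_le ((hf.comp_measurePreserving
    (measurePreserving_sub_right volume y))) hf (by simpa using hp)).trans (le_of_eq ?_)
  rw [two_mul]
  congr 1
  exact eLpNorm_translate _ hf y

/-- The difference f * k - f is an average of functions of norm at most 2‖f‖; adding f back gives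
the membership. -/
theorem memLp_conv {p : ℝ} (hp : 1 ≤ p) {f k : E d → ℝ} (hf : MemLp f (ENNReal.ofReal p) volume)
    (hk : Continuous k) (hk0 : ∀ y, 0 ≤ k y) (hki : Integrable k) (hk1 : ∫ y, k y = 1)
    (hi : ∀ x, Integrable fun z => f z * k (x - z)) (hc : Continuous (conv f k)) :
    MemLp (conv f k) (ENNReal.ofReal p) volume := by
  have hp0 : 0 < p := by linarith
  have h1 : MemLp (fun x => conv f k x - f x) (ENNReal.ofReal p) volume := by
    refine ⟨hc.aestronglyMeasurable.sub hf.1, ?_⟩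
    rw [lt_top_iff_ne_top]
    intro htop
    have h2 := (lintegral_enorm_conv_sub_rpow_le hp hf.1 hk hk0 hki hk1 hi).trans
      (lintegral_mono fun y => mul_le_mul_right (lintegral_translate_sub_rpow_le hp hf.1 y) _)
    rw [lintegral_mul_const _ (by fun_prop), ← ofReal_integral_eq_lintegral_ofReal hki
      (Eventually.of_forall hk0), hk1, ENNReal.ofReal_one, one_mul,
      lintegral_enorm_rpow_eq hp0 (fun x => conv f k x - f x), htop,
      ENNReal.top_rpow_of_pos hp0, top_le_iff] at h2
    exact ENNReal.rpow_ne_top_of_nonneg hp0.le (ENNReal.mul_ne_top (by norm_num) hf.2.ne) h2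
  refine (h1.add hf).congr_norm hc.aestronglyMeasurable (Eventually.of_forall fun x => ?_)
  simp

/-- Convolution with a concentrating family of probability densities tends to the identity in
`L^p`. -/
theorem tendsto_lintegral_conv_sub {ι : Type*} {l : Filter ι} {p : ℝ} (hp : 1 ≤ p)
    {f : E d → ℝ} (hf : MemLp f (ENNReal.ofReal p) volume) {k : ι → E d → ℝ}
    (hk : ∀ᶠ i in l, Continuous (k i) ∧ (∀ y, 0 ≤ k i y) ∧ Integrable (k i) ∧ ∫ y, k i y = 1 ∧
      ∀ x, Integrable fun z => f z * k i (x - z))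
    (htail : ∀ η > 0, Tendsto (fun i => ∫⁻ y in {y | η ≤ ‖y‖}, ENNReal.ofReal (k i y)) l (𝓝 0)) :
    Tendsto (fun i => ∫⁻ x, ‖conv f (k i) x - f x‖ₑ ^ p) l (𝓝 0) := by
  have hp0 : 0 < p := by linarith
  have hP1 : (1 : ℝ≥0∞) ≤ ENNReal.ofReal p := by simpa using hp
  set w : E d → ℝ≥0∞ := fun y => ∫⁻ x, ‖f (x - y) - f x‖ₑ ^ p with hw
  have hw0 : Tendsto w (𝓝 0) (𝓝 0) := by
    have h := (ENNReal.continuous_rpow_const (y := p)).continuousAt.tendsto.comp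
      (tendsto_eLpNorm_translate_sub hP1 ENNReal.ofReal_ne_top hf)
    rw [ENNReal.zero_rpow_of_pos hp0] at h
    refine h.congr fun y => ?_
    simp only [Function.comp, hw]
    rw [lintegral_enorm_rpow_eq hp0 (fun x => f (x - y) - f x)]
  set B : ℝ≥0∞ := (2 * eLpNorm f (ENNReal.ofReal p) volume) ^ p with hB
  have hBt : B ≠ ⊤ := by
    refine ENNReal.rpow_ne_top_of_nonneg hp0.le ?_
    exact ENNReal.mul_ne_top (by norm_num) hf.2.ne
  have hwB : ∀ y, w y ≤ B := fun y => lintegral_translate_sub_rpow_le hp hf.1 y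
  rw [ENNReal.tendsto_nhds_zero]
  intro ε hε
  have hε2 : 0 < ε / 2 := ENNReal.half_pos hε.ne'
  obtain ⟨η, hη, hηw⟩ := Metric.eventually_nhds_iff.1 (ENNReal.tendsto_nhds_zero.1 hw0 _ hε2)
  have h2 : Tendsto (fun i => (∫⁻ y in {y | η ≤ ‖y‖}, ENNReal.ofReal (k i y)) * B) l (𝓝 0) := by
    have := ENNReal.Tendsto.mul_const (htail η hη) (Or.inr hBt)
    simpa using this
  filter_upwards [hk, ENNReal.tendsto_nhds_zero.1 h2 _ hε2] with i hi h3
  obtain ⟨hc, h0, hint, h1, hfi⟩ := hi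
  refine (lintegral_enorm_conv_sub_rpow_le hp hf.1 hc h0 hint h1 hfi).trans ?_
  have hmeas : MeasurableSet {y : E d | η ≤ ‖y‖} := measurableSet_le measurable_const measurable_norm
  -- Far from the origin the modulus of continuity is bounded by B and the tail mass is small; near
  -- the origin the modulus is small and the mass is at most 1.
  rw [← lintegral_add_compl _ hmeas, ← ENNReal.add_halves ε]
  refine add_le_add ?_ ?_
  · refine le_trans ?_ h3
    rw [← lintegral_mul_const' _ _ hBt]
    exact lintegral_mono fun y => mul_le_mul_right (hwB y) _
  · have h5 : ∫⁻ y, ENNReal.ofReal (k i y) = 1 := by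
      rw [← ofReal_integral_eq_lintegral_ofReal hint (Eventually.of_forall h0), h1,
        ENNReal.ofReal_one]
    calc ∫⁻ y in {y | η ≤ ‖y‖}ᶜ, ENNReal.ofReal (k i y) * w y
        ≤ ∫⁻ y in {y | η ≤ ‖y‖}ᶜ, ENNReal.ofReal (k i y) * (ε / 2) := by
          refine setLIntegral_mono' hmeas.compl fun y hy => mul_le_mul_right (hηw ?_) _
          simpa using hy
      _ ≤ ∫⁻ y, ENNReal.ofReal (k i y) * (ε / 2) := setLIntegral_le_lintegral _ _
      _ = ε / 2 := by
        rw [lintegral_mul_const _ (by fun_prop), h5, one_mul]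

/-! ### Convergence of the heat flow to its initial value -/

/-- Chebyshev's inequality: the second moment of the kernel is r d, so the tail mass is at most r d
/ η². -/
theorem tendsto_lintegral_heatKernel_tail {η : ℝ} (hη : 0 < η) :
    Tendsto (fun r => ∫⁻ y in {y : E d | η ≤ ‖y‖}, ENNReal.ofReal (heatKernel d r y))
      (𝓝[>] 0) (𝓝 0) := by
  have hb : ∀ r ∈ Ioi (0 : ℝ), ∫⁻ y in {y : E d | η ≤ ‖y‖}, ENNReal.ofReal (heatKernel d r y) ≤
      ENNReal.ofReal (1 / η ^ 2 * (r * d)) := by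
    intro r hr
    have hr : 0 < r := hr
    have hint : Integrable fun y => 1 / η ^ 2 * ∑ i, heatKernel₂ r
        (EuclideanSpace.basisFun (Fin d) ℝ i) y :=
      (integrable_finsetSum _ fun i _ => integrable_heatKernel₂ hr _).const_mul _
    have heq : ∀ y : E d, 1 / η ^ 2 * ∑ i, heatKernel₂ r (EuclideanSpace.basisFun (Fin d) ℝ i) y =
        1 / η ^ 2 * (‖y‖ ^ 2 * heatKernel d r y) := by
      intro y
      simp only [heatKernel₂, ← Finset.sum_mul, sum_inner_sq]
    have hval : ∫ y, 1 / η ^ 2 * ∑ i, heatKernel₂ r (EuclideanSpace.basisFun (Fin d) ℝ i) y =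
        1 / η ^ 2 * (r * d) := by
      rw [integral_const_mul, integral_finsetSum _ fun i _ => integrable_heatKernel₂ hr _]
      simp only [integral_heatKernel₂ hr]
      simp [mul_comm]
    rw [← hval, ofReal_integral_eq_lintegral_ofReal hint (Eventually.of_forall fun y => by
      simp only [heq]
      have := heatKernel_pos (d := d) hr y
      positivity)]
    refine (setLIntegral_mono' (measurableSet_le measurable_const measurable_norm)
      fun y hy => ?_).trans (setLIntegral_le_lintegral _ _)
    have hy : η ≤ ‖y‖ := hy
    apply ENNReal.ofReal_le_ofReal
    rw [heq, ← mul_assoc]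
    refine le_mul_of_one_le_left (heatKernel_pos hr y).le ?_
    rw [one_div, ← div_eq_inv_mul, one_le_div (by positivity)]
    gcongr
  have hlim : Tendsto (fun r : ℝ => ENNReal.ofReal (1 / η ^ 2 * (r * d))) (𝓝[>] 0) (𝓝 0) := by
    have h : Tendsto (fun r : ℝ => 1 / η ^ 2 * (r * d)) (𝓝[>] 0) (𝓝 (1 / η ^ 2 * (0 * d))) :=
      Tendsto.mono_left (Continuous.tendsto (by fun_prop) _) nhdsWithin_le_nhds
    have := ENNReal.tendsto_ofReal h
    simpa using this
  exact tendsto_of_tendsto_of_tendsto_of_le_of_le' tendsto_const_nhds hlim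
    (Eventually.of_forall fun _ => zero_le) (eventually_nhdsWithin_of_forall hb)

theorem tendsto_heatFlow_L1 {f : E d → ℝ} (hf : Integrable f) :
    Tendsto (fun r => eLpNorm (heatFlow f r - f) 1 volume) (𝓝[>] 0) (𝓝 0) := by
  have h := tendsto_lintegral_conv_sub (l := 𝓝[>] (0 : ℝ)) (p := 1) le_rfl
    (by simpa using memLp_one_iff_integrable.2 hf) (k := fun r => heatKernel d r)
    (eventually_nhdsWithin_of_forall fun r hr => ⟨continuous_heatKernel r,
      fun y => (heatKernel_pos hr y).le, integrable_heatKernel hr, integral_heatKernel hr,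
      integrable_heatFlow_integrand hf hr⟩)
    (fun η hη => tendsto_lintegral_heatKernel_tail hη)
  refine h.congr fun r => ?_
  simp only [ENNReal.rpow_one, eLpNorm_one_eq_lintegral_enorm]
  rfl

/-- A sequence of times along which the heat flow converges almost everywhere. -/
theorem exists_seq_heatFlow_tendsto_ae {f : E d → ℝ} (hf : Integrable f) {t : ℕ → ℝ}
    (ht : ∀ n, 0 < t n) (ht0 : Tendsto t atTop (𝓝 0)) :
    ∃ ns : ℕ → ℕ, StrictMono ns ∧
      ∀ᵐ x, Tendsto (fun i => heatFlow f (t (ns i)) x) atTop (𝓝 (f x)) := by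
  refine (tendstoInMeasure_of_tendsto_eLpNorm one_ne_zero
    (fun n => (continuous_heatFlow hf (ht n)).aestronglyMeasurable) hf.1
    ((tendsto_heatFlow_L1 hf).comp ?_)).exists_seq_tendsto_ae
  exact tendsto_nhdsWithin_iff.2 ⟨ht0, Eventually.of_forall ht⟩

/-! ### Mollification and the weak product rule -/

/-- The triple product is the L² inner product of c b and a. Multiplication by the bounded c
preserves strong convergence, and the inner product is jointly continuous. -/
theorem tendsto_integral_mul_mul_of_L2 {a b : ℕ → E d → ℝ} {a₀ b₀ c : E d → ℝ}
    (ha : ∀ n, MemLp (a n) 2 volume) (ha₀ : MemLp a₀ 2 volume)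
    (hb : ∀ n, MemLp (b n) 2 volume) (hb₀ : MemLp b₀ 2 volume)
    (hta : Tendsto (fun n => eLpNorm (a n - a₀) 2 volume) atTop (𝓝 0))
    (htb : Tendsto (fun n => eLpNorm (b n - b₀) 2 volume) atTop (𝓝 0))
    (hc : AEStronglyMeasurable c volume) {C : ℝ} (hC : ∀ x, |c x| ≤ C) :
    Tendsto (fun n => ∫ x, a n x * b n x * c x) atTop (𝓝 (∫ x, a₀ x * b₀ x * c x)) := by
  have hcb : ∀ {b : E d → ℝ}, MemLp b 2 volume → MemLp (fun x => c x * b x) 2 volume :=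
    fun hb => hb.of_le_mul (c := C) (hc.mul hb.1) (Eventually.of_forall fun x => by
      rw [norm_mul]; exact mul_le_mul_of_nonneg_right (hC x) (norm_nonneg _))
  have hinner : ∀ {a b : E d → ℝ} (ha : MemLp a 2 volume) (hb : MemLp b 2 volume),
      inner ℝ ((hcb hb).toLp _) (ha.toLp a) = ∫ x, a x * b x * c x := by
    intro a b ha hb
    rw [L2.inner_def]
    refine integral_congr_ae ?_
    filter_upwards [(hcb hb).coeFn_toLp, ha.coeFn_toLp] with x h1 h2
    rw [h1, h2]
    simp only [RCLike.inner_apply, conj_trivial]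
    ring
  have hA : Tendsto (fun n => (ha n).toLp (a n)) atTop (𝓝 (ha₀.toLp a₀)) := by
    rw [Lp.tendsto_Lp_iff_tendsto_eLpNorm'']
    exact hta
  have hB : Tendsto (fun n => (hcb (hb n)).toLp _) atTop (𝓝 ((hcb hb₀).toLp _)) := by
    rw [Lp.tendsto_Lp_iff_tendsto_eLpNorm'']
    have h1 : Tendsto (fun n => ENNReal.ofReal C * eLpNorm (b n - b₀) 2 volume) atTop (𝓝 0) := by
      have := ENNReal.Tendsto.const_mul htb (Or.inr (ENNReal.ofReal_ne_top (r := C)))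
      simpa using this
    refine tendsto_of_tendsto_of_tendsto_of_le_of_le tendsto_const_nhds h1
      (fun _ => zero_le) fun n => ?_
    refine eLpNorm_le_mul_eLpNorm_of_ae_le_mul (Eventually.of_forall fun x => ?_) 2
    simp only [Pi.sub_apply, ← mul_sub, norm_mul]
    exact mul_le_mul_of_nonneg_right (hC x) (norm_nonneg _)
  have h := hB.inner (𝕜 := ℝ) hA
  have hn : ∀ n, inner ℝ ((hcb (hb n)).toLp _) ((ha n).toLp (a n)) = ∫ x, a n x * b n x * c x :=
    fun n => hinner (ha n) (hb n)
  rw [hinner ha₀ hb₀] at h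
  exact h.congr hn

/-- A standard mollifier supported in the ball of radius `1 / (n + 1)`. -/
def bump (d n : ℕ) : ContDiffBump (0 : E d) where
  rIn := 1 / (2 * (n + 1))
  rOut := 1 / (n + 1)
  rIn_pos := by positivity
  rIn_lt_rOut := by
    apply one_div_lt_one_div_of_lt (by positivity)
    have : (0 : ℝ) < n + 1 := by positivity
    linarith

/-- The normalised mollifier. -/
def mollifier (d n : ℕ) : E d → ℝ := (bump d n).normed volume

theorem contDiff_mollifier (n : ℕ) : ContDiff ℝ (⊤ : ℕ∞) (mollifier d n) :=
  (bump d n).contDiff_normed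

theorem continuous_mollifier (n : ℕ) : Continuous (mollifier d n) :=
  (bump d n).continuous_normed

theorem hasCompactSupport_mollifier (n : ℕ) : HasCompactSupport (mollifier d n) :=
  (bump d n).hasCompactSupport_normed

theorem mollifier_nonneg (n : ℕ) (y : E d) : 0 ≤ mollifier d n y := (bump d n).nonneg_normed y

theorem integral_mollifier (n : ℕ) : ∫ y, mollifier d n y = 1 := (bump d n).integral_normed

theorem integrable_mollifier (n : ℕ) : Integrable (mollifier d n) :=
  (continuous_mollifier n).integrable_of_hasCompactSupport (hasCompactSupport_mollifier n)

theorem tendsto_lintegral_mollifier_tail {η : ℝ} (hη : 0 < η) :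
    Tendsto (fun n => ∫⁻ y in {y : E d | η ≤ ‖y‖}, ENNReal.ofReal (mollifier d n y))
      atTop (𝓝 0) := by
  refine tendsto_const_nhds.congr' ?_
  have h := (tendsto_one_div_add_atTop_nhds_zero_nat (𝕜 := ℝ)).eventually (gt_mem_nhds hη)
  filter_upwards [h] with n hn
  symm
  refine (setLIntegral_congr_fun (measurableSet_le measurable_const measurable_norm)
    (g := fun _ => 0) fun y hy => ?_).trans (by simp)
  have hy : η ≤ ‖y‖ := hy
  have : y ∉ Function.support (mollifier d n) := by
    rw [mollifier, (bump d n).support_normed_eq]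
    simp only [Metric.mem_ball, dist_zero_right, not_lt]
    exact hn.le.trans hy
  simp [Function.notMem_support.1 this]

theorem integrable_mul_mollifier {g : E d → ℝ} (hg : LocallyIntegrable g) (n : ℕ) (x : E d) :
    Integrable fun z => g z * mollifier d n (x - z) := by
  have h := (hasCompactSupport_mollifier n).convolutionExists_right
    (ContinuousLinearMap.mul ℝ ℝ) hg (continuous_mollifier n) x
  exact h

theorem continuous_conv_mollifier {g : E d → ℝ} (hg : LocallyIntegrable g) (n : ℕ) :
    Continuous (conv g (mollifier d n)) :=
  (hasCompactSupport_mollifier n).continuous_convolution_right (ContinuousLinearMap.mul ℝ ℝ) hg (continuous_mollifier n)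

theorem hasLineDerivAt_conv_mollifier {g : E d → ℝ} (hg : LocallyIntegrable g) (n : ℕ)
    (x v : E d) : HasLineDerivAt ℝ (conv g (mollifier d n))
      (conv g (fun y => fderiv ℝ (mollifier d n) y v) x) x v := by
  have h1 : ContDiff ℝ 1 (mollifier d n) := (contDiff_mollifier n).of_le (by simp)
  have h := (hasCompactSupport_mollifier n).hasFDerivAt_convolution_right
    (ContinuousLinearMap.mul ℝ ℝ) hg h1 x
  have h2 := h.hasLineDerivAt v
  rw [convolution_precompR_apply _ hg ((hasCompactSupport_mollifier n).fderiv (𝕜 := ℝ))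
    (h1.continuous_fderiv (by simp))] at h2
  exact h2

theorem fderiv_mollifier_sub (n : ℕ) (x v z : E d) :
    fderiv ℝ (fun z => mollifier d n (x - z)) z v = -fderiv ℝ (mollifier d n) (x - z) v := by
  have h1 : HasFDerivAt (mollifier d n) (fderiv ℝ (mollifier d n) (x - z)) (x - z) :=
    ((contDiff_mollifier n).differentiable (by simp) _).hasFDerivAt
  have h2 : HasFDerivAt (fun z : E d => x - z) (-ContinuousLinearMap.id ℝ (E d)) z :=
    (hasFDerivAt_id z).const_sub x
  have h3 : HasFDerivAt (fun z => mollifier d n (x - z)) _ z := HasFDerivAt.comp z h1 h2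
  rw [h3.fderiv]
  simp

/-- Weak differentiation commutes with mollification: the reflected mollifier z ↦ k(x - z) is itself
an admissible test function. -/
theorem conv_fderiv_mollifier {g : E d → ℝ} {G : E d → E d} (hG : IsWeakGradient g G) (n : ℕ)
    (x v : E d) : conv g (fun y => fderiv ℝ (mollifier d n) y v) x =
      conv (fun z => inner ℝ (G z) v) (mollifier d n) x := by
  have hd := fderiv_mollifier_sub n x v
  have h := hG.2 (fun z => mollifier d n (x - z)) ((contDiff_mollifier n).comp (by fun_prop))
    ((hasCompactSupport_mollifier n).comp_homeomorph (Homeomorph.subLeft x)) v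
  simp only [hd, mul_neg, integral_neg, neg_inj] at h
  exact h

theorem memLp_inner {G : E d → E d} (hG : MemLp G 2 volume) (v : E d) :
    MemLp (fun z => inner ℝ (G z) v) 2 volume :=
  hG.of_le_mul (c := ‖v‖) (by have := hG.1; fun_prop) (Eventually.of_forall fun x => by
    rw [mul_comm]; exact norm_inner_le_norm _ _)

theorem ofReal_two : ENNReal.ofReal (2 : ℝ) = 2 := by simp

theorem memLp_conv_mollifier {g : E d → ℝ} (hg : MemLp g 2 volume) (n : ℕ) :
    MemLp (conv g (mollifier d n)) 2 volume := by
  have hl := hg.locallyIntegrable one_le_two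
  have h := memLp_conv (p := 2) one_le_two (f := g) (k := mollifier d n) (by rwa [ofReal_two])
    (continuous_mollifier n) (mollifier_nonneg n) (integrable_mollifier n) (integral_mollifier n)
    (integrable_mul_mollifier hl n) (continuous_conv_mollifier hl n)
  rwa [ofReal_two] at h

theorem tendsto_eLpNorm_conv_mollifier {g : E d → ℝ} (hg : MemLp g 2 volume) :
    Tendsto (fun n => eLpNorm (conv g (mollifier d n) - g) 2 volume) atTop (𝓝 0) := by
  have hl := hg.locallyIntegrable one_le_two
  have h := tendsto_lintegral_conv_sub (p := 2) one_le_two (f := g) (by rwa [ofReal_two])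
    (k := fun n => mollifier d n) (l := atTop)
    (Eventually.of_forall fun n => ⟨continuous_mollifier n, mollifier_nonneg n,
      integrable_mollifier n, integral_mollifier n, integrable_mul_mollifier hl n⟩)
    (fun η hη => tendsto_lintegral_mollifier_tail hη)
  have h2 := (ENNReal.continuous_rpow_const (y := 1 / 2)).continuousAt.tendsto.comp h
  rw [ENNReal.zero_rpow_of_pos (by norm_num)] at h2
  refine h2.congr fun n => ?_
  simp only [Function.comp]
  rw [lintegral_enorm_rpow_eq two_pos (fun x => conv g (mollifier d n) x - g x),
    ← ENNReal.rpow_mul, ofReal_two]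
  norm_num
  rfl

/-- The weak product rule `∇(g²) = 2 g ∇g`. -/
theorem integral_sq_mul_lineDeriv {g : E d → ℝ} {G : E d → E d} (hg : MemLp g 2 volume)
    (hG : IsWeakGradient g G) {ζ ζ' : E d → ℝ} {v : E d} {C C' : ℝ} (hζ : Continuous ζ)
    (hζ' : Continuous ζ') (hC : ∀ x, |ζ x| ≤ C) (hC' : ∀ x, |ζ' x| ≤ C')
    (h : ∀ x, HasLineDerivAt ℝ ζ (ζ' x) x v) :
    ∫ x, g x ^ 2 * ζ' x = -∫ x, 2 * g x * inner ℝ (G x) v * ζ x := by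
  have hGv := memLp_inner hG.1 v
  have hl := hg.locallyIntegrable one_le_two
  set a : ℕ → E d → ℝ := fun n => conv g (mollifier d n) with ha
  set b : ℕ → E d → ℝ := fun n => conv (fun z => inner ℝ (G z) v) (mollifier d n) with hb
  have ha2 : ∀ n, MemLp (a n) 2 volume := memLp_conv_mollifier hg
  have hb2 : ∀ n, MemLp (b n) 2 volume := memLp_conv_mollifier hGv
  have hta := tendsto_eLpNorm_conv_mollifier hg
  have htb := tendsto_eLpNorm_conv_mollifier hGv
  -- For the mollified function the product rule is classical and ∂_v a_n = b_n. The test function ζ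
  -- is only bounded with bounded derivative, so that Gaussian kernels are admitted; a_n², a_n b_n ∈
  -- L¹ makes up for the missing compact support.
  have hparts : ∀ n, ∫ x, a n x * a n x * ζ' x = -∫ x, a n x * b n x * (2 * ζ x) := by
    intro n
    have haa : Integrable fun x => a n x * a n x := (ha2 n).integrable_mul (ha2 n)
    have hab : Integrable fun x => a n x * b n x := (ha2 n).integrable_mul (hb2 n)
    have hkey := integral_bilinear_hasLineDerivAt_right_eq_neg_left_of_integrable
      (μ := (volume : Measure (E d))) (B := ContinuousLinearMap.mul ℝ ℝ) (v := v)
      (f := fun x => a n x * a n x) (f' := fun x => 2 * (a n x * b n x)) (g := ζ) (g' := ζ')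
      (by
        simp only [ContinuousLinearMap.mul_apply']
        exact (hab.const_mul 2).mul_bdd hζ.aestronglyMeasurable (Eventually.of_forall hC))
      (by
        simp only [ContinuousLinearMap.mul_apply']
        exact haa.mul_bdd hζ'.aestronglyMeasurable (Eventually.of_forall hC'))
      (by
        simp only [ContinuousLinearMap.mul_apply']
        exact haa.mul_bdd hζ.aestronglyMeasurable (Eventually.of_forall hC))
      (fun x _ => by
        have h1 := hasLineDerivAt_conv_mollifier hl n x v
        rw [conv_fderiv_mollifier hG] at h1
        have h2 := HasDerivAt.mul h1 h1
        rw [HasLineDerivAt]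
        convert! h2 using 1
        simp only [zero_smul, add_zero]
        ring)
      (fun x _ => h x)
    simp only [ContinuousLinearMap.mul_apply'] at hkey
    rw [hkey]
    congr 1
    refine integral_congr_ae (Eventually.of_forall fun x => ?_)
    simp only
    ring
  have h1 := tendsto_integral_mul_mul_of_L2 ha2 hg ha2 hg hta hta hζ'.aestronglyMeasurable hC'
  have h2 := (tendsto_integral_mul_mul_of_L2 ha2 hg hb2 hGv hta htb (c := fun x => 2 * ζ x)
    (C := 2 * C) (by fun_prop) (fun x => by
      rw [abs_mul, abs_two]; exact mul_le_mul_of_nonneg_left (hC x) two_pos.le)).neg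
  have h3 := tendsto_nhds_unique h1 (h2.congr fun n => (hparts n).symm)
  convert! h3 using 1
  · refine integral_congr_ae (Eventually.of_forall fun x => ?_)
    simp only; ring
  · congr 1
    refine integral_congr_ae (Eventually.of_forall fun x => ?_)
    simp only; ring

/-! ### The Fisher information along the heat flow -/

/-- The `u`-component of `∫ |2 l G - ((1 - l) / r) g (x - z)|² K_r(x - z) dz`. -/
def scoreEnergy (g : E d → ℝ) (G : E d → E d) (l r : ℝ) (u x : E d) : ℝ :=
  4 * l ^ 2 * conv (fun z => inner ℝ (G z) u ^ 2) (heatKernel d r) x -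
    4 * l * ((1 - l) / r) * conv (fun z => g z * inner ℝ (G z) u) (heatKernel₁ r u) x +
    ((1 - l) / r) ^ 2 * heatFlow₂ (fun z => g z ^ 2) r u x

/-- The defect of the posterior variance from its Gaussian value. -/
def varianceDefect (f : E d → ℝ) (l r : ℝ) (u x : E d) : ℝ :=
  l * ‖u‖ ^ 2 * heatFlow f r x - (1 / r) * heatFlow₂ f r u x +
    (1 / r) * heatFlow₁ f r u x ^ 2 / heatFlow f r x

theorem hasLineDerivAt_comp_const_sub {k k' : E d → ℝ} {v : E d}
    (h : ∀ y, HasLineDerivAt ℝ k (k' y) y v) (x z : E d) :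
    HasLineDerivAt ℝ (fun z => k (x - z)) (-k' (x - z)) z v := by
  have h1 : HasDerivAt (fun t : ℝ => k (x - z + t • v)) (k' (x - z)) (-(0 : ℝ)) := by
    rw [neg_zero]
    exact h (x - z)
  have h2 := HasDerivAt.comp (h₂ := fun t : ℝ => k (x - z + t • v)) (0 : ℝ) h1
    (hasDerivAt_neg (0 : ℝ))
  rw [mul_neg, mul_one] at h2
  rw [HasLineDerivAt]
  refine h2.congr_of_eventuallyEq (Eventually.of_forall fun t => ?_)
  simp only [Function.comp]
  congr 1
  rw [neg_smul]
  abel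

theorem integral_add₃ {F₁ F₂ F₃ : E d → ℝ} (h₁ : Integrable F₁) (h₂ : Integrable F₂)
    (h₃ : Integrable F₃) : Integrable (fun z => F₁ z + F₂ z + F₃ z) ∧
      ∫ z, (F₁ z + F₂ z + F₃ z) = (∫ z, F₁ z) + (∫ z, F₂ z) + ∫ z, F₃ z :=
  ⟨(h₁.add h₂).add h₃, by
    refine (integral_add (h₁.add h₂) h₃).trans ?_
    congr 1
    exact integral_add h₁ h₂⟩

section

variable {g : E d → ℝ} {G : E d → E d} {r : ℝ}

theorem integrable_sq' (hg : MemLp g 2 volume) : Integrable fun z => g z ^ 2 := hg.integrable_sq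

/-- Both sides are ∂_u f_r: the derivative falls on f = g² on the left and on the kernel on the
right. This is the weak product rule tested with K_r(x - ·). -/
theorem conv_mul_gradient_heatKernel (hg : MemLp g 2 volume) (hG : IsWeakGradient g G)
    (hr : 0 < r) (u x : E d) :
    2 * conv (fun z => g z * inner ℝ (G z) u) (heatKernel d r) x =
      -(1 / r) * heatFlow₁ (fun z => g z ^ 2) r u x := by
  have hc := continuous_heatKernel (d := d) r
  have hc1 := continuous_heatKernel₁ r u
  have h := integral_sq_mul_lineDeriv hg hG (ζ := fun z => heatKernel d r (x - z))
    (ζ' := fun z => -(-(1 / r) * heatKernel₁ r u (x - z))) (v := u) (by fun_prop) (by fun_prop)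
    (fun z => heatKernel_bound hr _) (C' := (1 / r) * (‖u‖ * heatBound d r))
    (fun z => by
      rw [neg_mul, neg_neg, abs_mul, abs_of_pos (one_div_pos.2 hr)]
      exact mul_le_mul_of_nonneg_left (heatKernel₁_bound hr u _) (by positivity))
    (fun z => hasLineDerivAt_comp_const_sub (hasLineDerivAt_heatKernel hr u) x z)
  have e1 : ∫ z, g z ^ 2 * -(-(1 / r) * heatKernel₁ r u (x - z)) =
      (1 / r) * heatFlow₁ (fun z => g z ^ 2) r u x := by
    rw [heatFlow₁, conv, ← integral_const_mul]
    congr 1; ext z; ring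
  have e2 : ∫ z, 2 * g z * inner ℝ (G z) u * heatKernel d r (x - z) =
      2 * conv (fun z => g z * inner ℝ (G z) u) (heatKernel d r) x := by
    rw [conv, ← integral_const_mul]
    congr 1; ext z; ring
  rw [e1, e2] at h
  linarith

/-- The weak product rule tested with ⟨u, x - ·⟩K_r(x - ·). It evaluates the posterior correlation
of the score of f with the linear function, from which the variance defect arises. -/
theorem conv_mul_gradient_heatKernel₁ (hg : MemLp g 2 volume) (hG : IsWeakGradient g G)
    (hr : 0 < r) (u x : E d) :
    2 * conv (fun z => g z * inner ℝ (G z) u) (heatKernel₁ r u) x =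
      ‖u‖ ^ 2 * heatFlow (fun z => g z ^ 2) r x -
        (1 / r) * heatFlow₂ (fun z => g z ^ 2) r u x := by
  have hc := continuous_heatKernel (d := d) r
  have hc1 := continuous_heatKernel₁ r u
  have hc2 := continuous_heatKernel₂ r u
  have hf := integrable_sq' hg
  have h := integral_sq_mul_lineDeriv hg hG (ζ := fun z => heatKernel₁ r u (x - z))
    (ζ' := fun z => -(‖u‖ ^ 2 * heatKernel d r (x - z) - (1 / r) * heatKernel₂ r u (x - z)))
    (v := u) (by fun_prop) (by fun_prop)
    (fun z => heatKernel₁_bound hr u _)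
    (C' := ‖u‖ ^ 2 * (2 * Real.pi * r) ^ (-(d : ℝ) / 2) + (1 / r) * (‖u‖ ^ 2 * heatBound d r))
    (fun z => by
      rw [abs_neg]
      refine (abs_sub _ _).trans (add_le_add ?_ ?_)
      · rw [abs_mul, abs_of_nonneg (sq_nonneg ‖u‖)]
        exact mul_le_mul_of_nonneg_left (heatKernel_bound hr _) (by positivity)
      · rw [abs_mul, abs_of_pos (one_div_pos.2 hr)]
        exact mul_le_mul_of_nonneg_left (heatKernel₂_bound hr u _) (by positivity))
    (fun z => hasLineDerivAt_comp_const_sub (hasLineDerivAt_heatKernel₁ hr u) x z)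
  have e1 : ∫ z, g z ^ 2 * -(‖u‖ ^ 2 * heatKernel d r (x - z) - (1 / r) *
      heatKernel₂ r u (x - z)) = -(‖u‖ ^ 2 * heatFlow (fun z => g z ^ 2) r x -
        (1 / r) * heatFlow₂ (fun z => g z ^ 2) r u x) := by
    rw [heatFlow, heatFlow₂, conv, conv, ← integral_const_mul, ← integral_const_mul,
      ← integral_sub ((integrable_heatFlow_integrand hf hr x).const_mul _)
      ((integrable_heatFlow₂_integrand hf hr u x).const_mul _), ← integral_neg]
    congr 1; ext z; ring
  have e2 : ∫ z, 2 * g z * inner ℝ (G z) u * heatKernel₁ r u (x - z) =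
      2 * conv (fun z => g z * inner ℝ (G z) u) (heatKernel₁ r u) x := by
    rw [conv, ← integral_const_mul]
    congr 1; ext z; ring
  rw [e1, e2] at h
  linarith

/-- Divided by g, the bracket is l times the score 2⟨∇g, u⟩/g of f, plus 1 - l times the Gaussian
score -⟨u, x - z⟩/r, minus a centring constant c, minus t⟨u, x - z⟩. Keeping the factor g inside the
square avoids division at zeros of g. The two integration by parts formulas evaluate the cross
terms. -/
theorem integral_score_expansion (hg : MemLp g 2 volume) (hG : IsWeakGradient g G)
    (hr : 0 < r) (l : ℝ) (u x : E d) (c : ℝ) (t : ℝ) :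
    Integrable (fun z => (2 * l * inner ℝ (G z) u -
      g z * (((1 - l) / r) * inner ℝ u (x - z) + c) - t * (g z * inner ℝ u (x - z))) ^ 2 *
        heatKernel d r (x - z)) ∧
    ∫ z, (2 * l * inner ℝ (G z) u - g z * (((1 - l) / r) * inner ℝ u (x - z) + c) -
        t * (g z * inner ℝ u (x - z))) ^ 2 * heatKernel d r (x - z) =
      scoreEnergy g G l r u x + 2 * c * ((1 / r) * heatFlow₁ (fun z => g z ^ 2) r u x) +
        c ^ 2 * heatFlow (fun z => g z ^ 2) r x
      - 2 * t * (l * ‖u‖ ^ 2 * heatFlow (fun z => g z ^ 2) r x -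
          (1 / r) * heatFlow₂ (fun z => g z ^ 2) r u x - c * heatFlow₁ (fun z => g z ^ 2) r u x)
      + t ^ 2 * heatFlow₂ (fun z => g z ^ 2) r u x := by
  have hGu := memLp_inner hG.1 u
  have hf := integrable_sq' hg
  have hGG := hGu.integrable_sq
  have hgG : Integrable fun z => g z * inner ℝ (G z) u := hg.integrable_mul hGu
  have i1 := integrable_heatFlow_integrand hGG hr x
  have i2 := integrable_heatFlow₁_integrand hgG hr u x
  have i3 := integrable_heatFlow₂_integrand hf hr u x
  have i4 := integrable_heatFlow_integrand hgG hr x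
  have i5 := integrable_heatFlow₁_integrand hf hr u x
  have i6 := integrable_heatFlow_integrand hf hr x
  set q := (1 - l) / r with hq
  have hexp : (fun z => (2 * l * inner ℝ (G z) u - g z * (q * inner ℝ u (x - z) + c) -
        t * (g z * inner ℝ u (x - z))) ^ 2 * heatKernel d r (x - z)) = fun z =>
      4 * l ^ 2 * (inner ℝ (G z) u ^ 2 * heatKernel d r (x - z)) +
      (-(4 * l * (q + t))) * (g z * inner ℝ (G z) u * heatKernel₁ r u (x - z)) +
      (q + t) ^ 2 * (g z ^ 2 * heatKernel₂ r u (x - z)) +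
      (-(4 * l * c)) * (g z * inner ℝ (G z) u * heatKernel d r (x - z)) +
      2 * c * (q + t) * (g z ^ 2 * heatKernel₁ r u (x - z)) +
      c ^ 2 * (g z ^ 2 * heatKernel d r (x - z)) := by
    funext z
    simp only [heatKernel₁, heatKernel₂]
    ring
  have j3 := integral_add₃ (i1.const_mul (4 * l ^ 2)) (i2.const_mul (-(4 * l * (q + t))))
    (i3.const_mul ((q + t) ^ 2))
  have j5 := integral_add₃ j3.1 (i4.const_mul (-(4 * l * c))) (i5.const_mul (2 * c * (q + t)))
  rw [hexp]
  refine ⟨j5.1.add (i6.const_mul (c ^ 2)), ?_⟩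
  have k1 := conv_mul_gradient_heatKernel hg hG hr u x
  have k2 := conv_mul_gradient_heatKernel₁ hg hG hr u x
  have s : ∫ z, (4 * l ^ 2 * (inner ℝ (G z) u ^ 2 * heatKernel d r (x - z)) +
      (-(4 * l * (q + t))) * (g z * inner ℝ (G z) u * heatKernel₁ r u (x - z)) +
      (q + t) ^ 2 * (g z ^ 2 * heatKernel₂ r u (x - z)) +
      (-(4 * l * c)) * (g z * inner ℝ (G z) u * heatKernel d r (x - z)) +
      2 * c * (q + t) * (g z ^ 2 * heatKernel₁ r u (x - z)) +
      c ^ 2 * (g z ^ 2 * heatKernel d r (x - z))) =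
      4 * l ^ 2 * conv (fun z => inner ℝ (G z) u ^ 2) (heatKernel d r) x +
      (-(4 * l * (q + t))) * conv (fun z => g z * inner ℝ (G z) u) (heatKernel₁ r u) x +
      (q + t) ^ 2 * heatFlow₂ (fun z => g z ^ 2) r u x +
      (-(4 * l * c)) * conv (fun z => g z * inner ℝ (G z) u) (heatKernel d r) x +
      2 * c * (q + t) * heatFlow₁ (fun z => g z ^ 2) r u x +
      c ^ 2 * heatFlow (fun z => g z ^ 2) r x := by
    refine (integral_add j5.1 (i6.const_mul (c ^ 2))).trans ?_
    rw [j5.2, j3.2]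
    simp only [integral_const_mul]
    rfl
  rw [s, scoreEnergy, ← hq]
  -- Writing (1 - l)/r as 1/r - l/r makes the terms carrying l/r cancel against those produced by
  -- integration by parts.
  have hl : (1 - l) / r = 1 / r - l / r := by ring
  linear_combination (-(2 * l * t)) * k2 + (-(2 * l * c)) * k1 +
    (2 * c * heatFlow₁ (fun z => g z ^ 2) r u x +
      2 * t * heatFlow₂ (fun z => g z ^ 2) r u x) * (hq.trans hl)

/-- The difference is f_r(x) times the posterior variance of the mixed score, whose posterior mean
∂_u log f_r(x) is used as c. This is the pointwise Blachman-Stam inequality. -/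
theorem scoreEnergy_sub_nonneg (hg : MemLp g 2 volume) (hG : IsWeakGradient g G)
    (hr : 0 < r) (l : ℝ) (u x : E d) (hpos : 0 < heatFlow (fun z => g z ^ 2) r x) :
    0 ≤ scoreEnergy g G l r u x -
      ((1 / r) * heatFlow₁ (fun z => g z ^ 2) r u x) ^ 2 / heatFlow (fun z => g z ^ 2) r x := by
  set m := heatFlow (fun z => g z ^ 2) r x with hm
  set m1 := heatFlow₁ (fun z => g z ^ 2) r u x with hm1
  have h := integral_score_expansion hg hG hr l u x (-((1 / r) * m1) / m) 0
  have h0 : 0 ≤ ∫ z, (2 * l * inner ℝ (G z) u - g z * (((1 - l) / r) * inner ℝ u (x - z) +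
      -((1 / r) * m1) / m) - 0 * (g z * inner ℝ u (x - z))) ^ 2 * heatKernel d r (x - z) :=
    integral_nonneg fun z => mul_nonneg (sq_nonneg _) (heatKernel_pos hr _).le
  rw [h.2, ← hm, ← hm1] at h0
  have e : 2 * (-((1 / r) * m1) / m) * ((1 / r) * m1) + (-((1 / r) * m1) / m) ^ 2 * m =
      -(((1 / r) * m1) ^ 2 / m) := by field_simp; ring
  linarith

/-- The vector `-(1 / r) ∫ f(z) (x - z) K_r(x - z) dz`. -/
def flowGradient (f : E d → ℝ) (r : ℝ) (x : E d) : E d :=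
  -(1 / r) • ∫ z, (f z * heatKernel d r (x - z)) • (x - z)

theorem inner_flowGradient {f : E d → ℝ} (hf : Integrable f) (hr : 0 < r) (u x : E d) :
    inner ℝ u (flowGradient f r x) = -(1 / r) * heatFlow₁ f r u x := by
  have hi : Integrable fun z => (f z * heatKernel d r (x - z)) • (x - z) := by
    have hc := continuous_heatKernel (d := d) r
    refine (hf.norm.mul_const (heatBound d r)).mono'
      ((hf.1.mul (Continuous.aestronglyMeasurable (by fun_prop))).smul
        (Continuous.aestronglyMeasurable (by fun_prop))) (Eventually.of_forall fun z => ?_)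
    rw [norm_smul, norm_mul, mul_assoc]
    refine mul_le_mul_of_nonneg_left ?_ (norm_nonneg _)
    rw [Real.norm_of_nonneg (heatKernel_pos hr _).le, mul_comm]
    refine (mul_le_mul_of_nonneg_right ?_ (heatKernel_pos hr (x - z)).le).trans
      ((one_add_sq_mul_heatKernel_le hr le_rfl le_rfl (x - z)).trans
        ((le_abs_self _).trans (envelope_le hr hr (x - z))))
    nlinarith [sq_nonneg (‖x - z‖ - 1), norm_nonneg (x - z)]
  rw [flowGradient, inner_smul_right, ← integral_inner hi u, heatFlow₁, conv]
  congr 2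
  ext z
  rw [inner_smul_right, heatKernel₁]
  ring

/-- The Cauchy--Schwarz inequality for the score, with remainder. -/
theorem varianceDefect_sq_le (hg : MemLp g 2 volume) (hG : IsWeakGradient g G)
    (hr : 0 < r) (l : ℝ) (u x : E d) (hpos : 0 < heatFlow (fun z => g z ^ 2) r x) :
    varianceDefect (fun z => g z ^ 2) l r u x ^ 2 ≤
      ‖u‖ ^ 2 * (∑ i, (scoreEnergy g G l r (EuclideanSpace.basisFun (Fin d) ℝ i) x -
        ((1 / r) * heatFlow₁ (fun z => g z ^ 2) r (EuclideanSpace.basisFun (Fin d) ℝ i) x) ^ 2 /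
          heatFlow (fun z => g z ^ 2) r x)) * heatFlow₂ (fun z => g z ^ 2) r u x := by
  have hf := integrable_sq' hg
  set m := heatFlow (fun z => g z ^ 2) r x with hm
  set e := EuclideanSpace.basisFun (Fin d) ℝ with he
  set p := flowGradient (fun z => g z ^ 2) r x with hp
  set S : E d → ℝ := fun u => scoreEnergy g G l r u x -
    ((1 / r) * heatFlow₁ (fun z => g z ^ 2) r u x) ^ 2 / m with hS
  have hpu : ∀ u, inner ℝ u p = -(1 / r) * heatFlow₁ (fun z => g z ^ 2) r u x :=
    fun u => inner_flowGradient hf hr u x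
  -- A is the vector of mixed scores, times g, centred by ∇ log f_r(x) = p / m.
  set A : E d → E d := fun z => (2 * l) • G z - g z • (((1 - l) / r) • (x - z) + (1 / m) • p)
    with hA
  have hAu : ∀ u z, inner ℝ u (A z) = 2 * l * inner ℝ (G z) u -
      g z * (((1 - l) / r) * inner ℝ u (x - z) + (1 / m) * inner ℝ u p) := by
    intro u z
    simp only [hA, inner_sub_right, inner_add_right, inner_smul_right, real_inner_comm u (G z)]
  have hexp := fun u t => integral_score_expansion hg hG hr l u x ((1 / m) * inner ℝ u p) t
  have hval : ∀ u t, ∫ z, (inner ℝ u (A z) - t * (g z * inner ℝ u (x - z))) ^ 2 *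
      heatKernel d r (x - z) = S u - 2 * t * varianceDefect (fun z => g z ^ 2) l r u x +
        t ^ 2 * heatFlow₂ (fun z => g z ^ 2) r u x := by
    intro u t
    simp only [hAu]
    rw [(hexp u t).2, hpu, ← hm, hS, varianceDefect, ← hm]
    simp only
    field_simp
    ring
  have hint : ∀ u t, Integrable fun z => (inner ℝ u (A z) - t * (g z * inner ℝ u (x - z))) ^ 2 *
      heatKernel d r (x - z) := by
    intro u t
    simp only [hAu]
    exact (hexp u t).1
  have hint0 : ∀ u, Integrable fun z => inner ℝ u (A z) ^ 2 * heatKernel d r (x - z) := fun u => by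
    simpa using hint u 0
  have hval0 : ∀ u, ∫ z, inner ℝ u (A z) ^ 2 * heatKernel d r (x - z) = S u := fun u => by
    simpa using hval u 0
  -- As S u is the integral of ⟨u, A⟩² against K_r(x - ·), it is at most ‖u‖² times the integral of
  -- |A|². Thus one coordinate sum controls all directions u.
  have hsum : S u ≤ ‖u‖ ^ 2 * ∑ i, S (e i) := by
    simp only [← hval0]
    rw [← integral_finsetSum _ fun i _ => hint0 (e i), ← integral_const_mul]
    refine integral_mono (hint0 u) ((integrable_finsetSum _ fun i _ => hint0 (e i)).const_mul _)
      fun z => ?_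
    simp only
    rw [← Finset.sum_mul, he, sum_inner_sq, ← mul_assoc]
    exact mul_le_mul_of_nonneg_right (inner_sq_le u (A z)) (heatKernel_pos hr _).le
  have hW : 0 ≤ heatFlow₂ (fun z => g z ^ 2) r u x := integral_nonneg fun z =>
    mul_nonneg (sq_nonneg _) (mul_nonneg (sq_nonneg _) (heatKernel_pos hr _).le)
  -- The integral is a nonnegative quadratic polynomial in t, with the variance defect as half its
  -- middle coefficient up to sign; the discriminant inequality is Cauchy-Schwarz.
  have hdisc := discrim_le_zero (a := heatFlow₂ (fun z => g z ^ 2) r u x)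
    (b := -2 * varianceDefect (fun z => g z ^ 2) l r u x) (c := S u) fun t => by
      have h0 : 0 ≤ ∫ z, (inner ℝ u (A z) - t * (g z * inner ℝ u (x - z))) ^ 2 *
          heatKernel d r (x - z) :=
        integral_nonneg fun z => mul_nonneg (sq_nonneg _) (heatKernel_pos hr _).le
      rw [hval] at h0
      linarith
  rw [discrim] at hdisc
  have h3 := mul_le_mul_of_nonneg_right hsum hW
  linarith

/-- After integration in x the cross term disappears because the first moment of K_r is zero. This
is the independence of the two scores. -/
theorem integrable_scoreEnergy (hg : MemLp g 2 volume) (hG : IsWeakGradient g G)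
    (hr : 0 < r) (l : ℝ) (u : E d) : Integrable (scoreEnergy g G l r u) ∧
    ∫ x, scoreEnergy g G l r u x = 4 * l ^ 2 * (∫ z, inner ℝ (G z) u ^ 2) +
      ((1 - l) / r) ^ 2 * ((∫ z, g z ^ 2) * (r * ‖u‖ ^ 2)) := by
  have hGu := memLp_inner hG.1 u
  have hf := integrable_sq' hg
  have hGG := hGu.integrable_sq
  have hgG : Integrable fun z => g z * inner ℝ (G z) u := hg.integrable_mul hGu
  have h := integral_add₃ ((integrable_conv hGG (integrable_heatKernel hr)).const_mul (4 * l ^ 2))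
    ((integrable_conv hgG (integrable_heatKernel₁ hr u)).const_mul (-(4 * l * ((1 - l) / r))))
    ((integrable_heatFlow₂ hf hr u).const_mul (((1 - l) / r) ^ 2))
  have heq : scoreEnergy g G l r u = fun x =>
      4 * l ^ 2 * conv (fun z => inner ℝ (G z) u ^ 2) (heatKernel d r) x +
      -(4 * l * ((1 - l) / r)) * conv (fun z => g z * inner ℝ (G z) u) (heatKernel₁ r u) x +
      ((1 - l) / r) ^ 2 * heatFlow₂ (fun z => g z ^ 2) r u x := by
    funext x
    rw [scoreEnergy]
    ring
  refine ⟨heq ▸ h.1, ?_⟩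
  rw [heq, h.2, integral_const_mul, integral_const_mul, integral_const_mul,
    integral_conv hGG (integrable_heatKernel hr), integral_conv hgG (integrable_heatKernel₁ hr u),
    heatFlow₂, integral_conv hf (integrable_heatKernel₂ hr u), integral_heatKernel hr,
    integral_heatKernel₁, integral_heatKernel₂ hr]
  ring

theorem heatBound_pos (hr : 0 < r) : 0 < heatBound d r := by
  unfold heatBound; positivity

/-- The bound on the Fisher information of the heat flow at time `r`. -/
def fisherBound (d : ℕ) (D M l r : ℝ) : ℝ := 4 * l ^ 2 * D + (1 - l) ^ 2 / r * d * M

theorem integral_sum_scoreEnergy (hg : MemLp g 2 volume) (hG : IsWeakGradient g G)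
    (hr : 0 < r) (l : ℝ) :
    ∫ x, ∑ i, scoreEnergy g G l r (EuclideanSpace.basisFun (Fin d) ℝ i) x =
      fisherBound d (∫ z, ‖G z‖ ^ 2) (∫ z, g z ^ 2) l r := by
  rw [integral_finsetSum _ fun i _ => (integrable_scoreEnergy hg hG hr l _).1]
  simp only [(integrable_scoreEnergy hg hG hr l _).2]
  rw [Finset.sum_add_distrib, ← Finset.mul_sum,
    ← integral_finsetSum _ fun i _ => (memLp_inner hG.1 _).integrable_sq]
  simp only [real_inner_comm _ (G _), sum_inner_sq]
  simp only [EuclideanSpace.basisFun_apply, PiLp.norm_single, norm_one, one_pow, mul_one,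
    Finset.sum_const, Finset.card_univ, Fintype.card_fin, nsmul_eq_mul, fisherBound]
  field_simp

/-- The Fisher information bound with the variance defect as remainder. -/
theorem lintegral_varianceDefect_le (hg : MemLp g 2 volume) (hG : IsWeakGradient g G)
    (hpos : 0 < ∫ z, g z ^ 2) (hr : 0 < r) (l : ℝ) {δ : ℝ} (hδ : 0 < δ) {u : E d}
    (hu : ‖u‖ = 1) :
    ∫⁻ x, ENNReal.ofReal (varianceDefect (fun z => g z ^ 2) l r u x ^ 2 /
      (heatBound d r * ∫ z, g z ^ 2)) ≤
    ENNReal.ofReal (fisherBound d (∫ z, ‖G z‖ ^ 2) (∫ z, g z ^ 2) l r -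
      2 * dissipation δ (fun z => g z ^ 2) r) ∧
    0 ≤ fisherBound d (∫ z, ‖G z‖ ^ 2) (∫ z, g z ^ 2) l r -
      2 * dissipation δ (fun z => g z ^ 2) r := by
  have hf := integrable_sq' hg
  have hf0 : ∀ z, 0 ≤ g z ^ 2 := fun z => sq_nonneg _
  set e := EuclideanSpace.basisFun (Fin d) ℝ with he
  set R : E d → ℝ := fun x => ∑ i, scoreEnergy g G l r (e i) x -
    ∑ i, phi₂ δ (heatFlow (fun z => g z ^ 2) r x) *
      ((1 / r) * heatFlow₁ (fun z => g z ^ 2) r (e i) x) ^ 2 with hR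
  have hi1 : Integrable fun x => ∑ i, scoreEnergy g G l r (e i) x :=
    integrable_finsetSum _ fun i _ => (integrable_scoreEnergy hg hG hr l _).1
  have hi2 : Integrable fun x => ∑ i, phi₂ δ (heatFlow (fun z => g z ^ 2) r x) *
      ((1 / r) * heatFlow₁ (fun z => g z ^ 2) r (e i) x) ^ 2 :=
    integrable_finsetSum _ fun i _ => integrable_phi₂_mul_sq hδ hf hf0 hr _
  have hRi : Integrable R := hi1.sub hi2
  have hRv : ∫ x, R x = fisherBound d (∫ z, ‖G z‖ ^ 2) (∫ z, g z ^ 2) l r -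
      2 * dissipation δ (fun z => g z ^ 2) r := by
    rw [hR, integral_sub hi1 hi2, integral_sum_scoreEnergy hg hG hr,
      integral_finsetSum _ fun i _ => integrable_phi₂_mul_sq hδ hf hf0 hr _, dissipation]
    ring
  have hm : ∀ x, 0 < heatFlow (fun z => g z ^ 2) r x := heatFlow_pos hf hf0 hpos hr
  -- Since φ'' ≤ 1/s, replacing (∂f_r)²/f_r by its regularisation only enlarges the remainder.
  have hle : ∀ x, ∑ i, (scoreEnergy g G l r (e i) x -
      ((1 / r) * heatFlow₁ (fun z => g z ^ 2) r (e i) x) ^ 2 /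
        heatFlow (fun z => g z ^ 2) r x) ≤ R x := by
    intro x
    rw [hR, Finset.sum_sub_distrib]
    refine sub_le_sub_left (Finset.sum_le_sum fun i _ => ?_) _
    rw [le_div_iff₀ (hm x)]
    have := mul_le_mul_of_nonneg_left (mul_phi₂_le hδ (hm x).le)
      (sq_nonneg ((1 / r) * heatFlow₁ (fun z => g z ^ 2) r (e i) x))
    linarith
  have h0 : ∀ x, 0 ≤ R x := fun x => (Finset.sum_nonneg fun i _ =>
    scoreEnergy_sub_nonneg hg hG hr l (e i) x (hm x)).trans (hle x)
  rw [← hRv]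
  refine ⟨?_, integral_nonneg h0⟩
  rw [ofReal_integral_eq_lintegral_ofReal hRi (Eventually.of_forall h0)]
  refine lintegral_mono fun x => ENNReal.ofReal_le_ofReal ?_
  -- The second moment is bounded uniformly in x, so the pointwise Cauchy-Schwarz bound becomes a
  -- bound by a constant multiple of R.
  have hW : heatFlow₂ (fun z => g z ^ 2) r u x ≤ heatBound d r * ∫ z, g z ^ 2 := by
    have h := (le_abs_self _).trans (abs_conv_le hf (heatKernel₂_bound hr u) x)
    simp only [hu, one_pow, one_mul, abs_of_nonneg (hf0 _)] at h
    exact h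
  have hH : 0 < heatBound d r := heatBound_pos hr
  have h1 := varianceDefect_sq_le hg hG hr l u x (hm x)
  rw [hu, one_pow, one_mul] at h1
  rw [div_le_iff₀ (mul_pos hH hpos)]
  refine h1.trans ((mul_le_mul_of_nonneg_left hW (Finset.sum_nonneg fun i _ =>
    scoreEnergy_sub_nonneg hg hG hr l (e i) x (hm x))).trans ?_)
  exact mul_le_mul_of_nonneg_right (hle x) (mul_pos hH hpos).le

end

/-! ### The logarithmic Sobolev inequality with remainder -/

/-- Subtracting the linear term makes the density nonnegative, as required by Fatou's lemma, at the
price of a constant, because the mass is preserved by the flow. -/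
theorem phi_sub_nonneg {δ s : ℝ} (hδ : 0 < δ) (hs : 0 ≤ s) : 0 ≤ phi δ s - Real.log δ * s := by
  have h := Real.log_le_log hδ (show δ ≤ δ + s by linarith)
  rw [phi]
  nlinarith

/-- Lower semicontinuity of the regularised entropy along the heat flow. -/
theorem integral_phi_le_of_flowEntropy_le {f : E d → ℝ} (hf : Integrable f) (hf0 : ∀ z, 0 ≤ f z)
    {δ C : ℝ} (hδ : 0 < δ) {a₀ : ℝ} (ha₀ : 0 < a₀)
    (hC : ∀ a ∈ Ioo 0 a₀, flowEntropy δ f a ≤ C) :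
    Integrable (fun x => phi δ (f x)) ∧ ∫ x, phi δ (f x) ≤ C := by
  -- The shift by 2 keeps every time strictly below a₀, including n = 0.
  set t : ℕ → ℝ := fun n => a₀ / (n + 2) with ht
  have htpos : ∀ n, 0 < t n := fun n => by positivity
  have htlt : ∀ n, t n < a₀ := fun n => by
    rw [ht]
    refine div_lt_self ha₀ ?_
    have : (0 : ℝ) ≤ n := Nat.cast_nonneg n
    linarith
  have ht0 : Tendsto t atTop (𝓝 0) := by
    refine Tendsto.div_atTop tendsto_const_nhds ?_
    exact tendsto_atTop_add_const_right _ _ tendsto_natCast_atTop_atTop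
  obtain ⟨ns, -, hns⟩ := exists_seq_heatFlow_tendsto_ae hf htpos ht0
  set h : ℕ → E d → ℝ := fun n x =>
    phi δ (heatFlow f (t (ns n)) x) - Real.log δ * heatFlow f (t (ns n)) x with hh
  set h' : E d → ℝ := fun x => phi δ (f x) - Real.log δ * f x with hh'
  set B := C - Real.log δ * ∫ x, f x with hB
  have hn0 : ∀ n x, 0 ≤ h n x := fun n x => phi_sub_nonneg hδ (heatFlow_nonneg hf0 (htpos _) x)
  have h'0 : ∀ x, 0 ≤ h' x := fun x => phi_sub_nonneg hδ (hf0 x)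
  have hni : ∀ n, Integrable (h n) := fun n =>
    (integrable_phi_heatFlow hδ hf hf0 (htpos _)).sub
      ((integrable_heatFlow hf (htpos _)).const_mul _)
  have hnB : ∀ n, ∫ x, h n x ≤ B := fun n => by
    rw [hh, integral_sub (integrable_phi_heatFlow hδ hf hf0 (htpos _))
      ((integrable_heatFlow hf (htpos _)).const_mul _), integral_const_mul,
      integral_heatFlow hf (htpos _)]
    exact sub_le_sub_right (hC _ ⟨htpos _, htlt _⟩) _
  have hB0 : 0 ≤ B := (integral_nonneg (hn0 0)).trans (hnB 0)
  have hlim : ∀ᵐ x, Tendsto (fun n => h n x) atTop (𝓝 (h' x)) := by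
    filter_upwards [hns] with x hx
    exact ((hasDerivAt_phi hδ (hf0 x)).continuousAt.tendsto.comp hx).sub (hx.const_mul _)
  have hm' : AEStronglyMeasurable h' volume :=
    aestronglyMeasurable_of_tendsto_ae atTop (fun n => (hni n).1) hlim
  have hfatou : ∫⁻ x, ENNReal.ofReal (h' x) ≤ ENNReal.ofReal B := by
    calc ∫⁻ x, ENNReal.ofReal (h' x)
        = ∫⁻ x, liminf (fun n => ENNReal.ofReal (h n x)) atTop := by
          refine lintegral_congr_ae ?_
          filter_upwards [hlim] with x hx
          exact (ENNReal.tendsto_ofReal hx).liminf_eq.symm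
      _ ≤ liminf (fun n => ∫⁻ x, ENNReal.ofReal (h n x)) atTop :=
          lintegral_liminf_le' fun n => (hni n).1.aemeasurable.ennreal_ofReal
      _ ≤ ENNReal.ofReal B := by
          refine liminf_le_of_le (by isBoundedDefault) fun b hb => ?_
          obtain ⟨n, hn⟩ := hb.exists
          refine hn.trans ?_
          rw [← ofReal_integral_eq_lintegral_ofReal (hni n) (Eventually.of_forall (hn0 n))]
          exact ENNReal.ofReal_le_ofReal (hnB n)
  have hi' : Integrable h' := by
    refine ⟨hm', ?_⟩
    rw [hasFiniteIntegral_iff_ofReal (Eventually.of_forall h'0)]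
    exact hfatou.trans_lt ENNReal.ofReal_lt_top
  have hle : ∫ x, h' x ≤ B := by
    rwa [← ofReal_integral_eq_lintegral_ofReal hi' (Eventually.of_forall h'0),
      ENNReal.ofReal_le_ofReal_iff hB0] at hfatou
  have heq : (fun x => phi δ (f x)) = fun x => h' x + Real.log δ * f x := by
    funext x; rw [hh']; ring
  have hphi : Integrable fun x => phi δ (f x) := by
    rw [heq]; exact hi'.add (hf.const_mul _)
  refine ⟨hphi, ?_⟩
  rw [heq, integral_add hi' (hf.const_mul _), integral_const_mul]
  linarith

section

variable {g : E d → ℝ} {G : E d → E d}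

/-- `g² log (1 + g²)` is integrable for `g ∈ H¹`. -/
theorem integrable_sq_mul_log_one_add (hg : MemLp g 2 volume) (hG : IsWeakGradient g G)
    (hpos : 0 < ∫ z, g z ^ 2) : Integrable fun x => phi 1 (g x ^ 2) := by
  have hf := integrable_sq' hg
  have hf0 : ∀ z, 0 ≤ g z ^ 2 := fun z => sq_nonneg _
  set D := ∫ z, ‖G z‖ ^ 2 with hD
  have hD0 : 0 ≤ D := integral_nonneg fun z => sq_nonneg _
  refine (integral_phi_le_of_flowEntropy_le hf hf0 one_pos (a₀ := 1) one_pos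
    (C := flowEntropy 1 (fun z => g z ^ 2) 1 + 2 * D) fun a ha => ?_).1
  have hnontriv : ∀ r ∈ Ioc a 1, dissipation 1 (fun z => g z ^ 2) r ≤ 2 * D := fun r hr => by
    have hr0 : 0 < r := ha.1.trans hr.1
    -- In dimension zero there is no unit vector, but the dissipation is an empty sum.
    rcases Nat.eq_zero_or_pos d with rfl | hd
    · simp [dissipation, hD0]
    · have hu : ‖EuclideanSpace.basisFun (Fin d) ℝ ⟨0, hd⟩‖ = 1 := by simp
      -- With l = 1 the Gaussian score drops out and the bound 4D does not depend on r, so that the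
      -- entropy stays bounded as the time tends to 0.
      have h := (lintegral_varianceDefect_le hg hG hpos hr0 1 one_pos hu).2
      simp only [fisherBound, sub_self] at h
      norm_num at h
      linarith
  have h1 := integral_dissipation one_pos hf hf0 ha.1 ha.2.le
  have h2 : ∫ r in Ioc a 1, dissipation 1 (fun z => g z ^ 2) r ≤ ∫ r in Ioc a 1, 2 * D :=
    setIntegral_mono_on (integrableOn_dissipation one_pos hf hf0 ha.1)
      (integrable_const _) measurableSet_Ioc hnontriv
  have h3 : ∫ _ in Ioc a (1 : ℝ), 2 * D ≤ 2 * D := by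
    rw [setIntegral_const, Real.volume_real_Ioc_of_le ha.2.le, smul_eq_mul]
    nlinarith [ha.1]
  linarith

/-- A primitive of half the Fisher information bound with `l = τ / (τ + r)`. -/
def fisherPrimitive (d : ℕ) (D τ r : ℝ) : ℝ :=
  -(2 * D * τ ^ 2) / (τ + r) + d / 2 * (Real.log (τ + r) + τ / (τ + r))

/-- The weight l = τ/(τ + r) minimises 4l²D + (1 - l)²d/r when D = d/(4τ), the value for a Gaussian
density of variance τ. The factor 1/2 is that of de Bruijn's identity. -/
theorem hasDerivAt_fisherPrimitive {D τ r : ℝ} (hτ : 0 < τ) (hr : 0 < r) :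
    HasDerivAt (fisherPrimitive d D τ) (1 / 2 * fisherBound d D 1 (τ / (τ + r)) r) r := by
  have h1 : HasDerivAt (fun r => τ + r) 1 r := by simpa using (hasDerivAt_id r).const_add τ
  have h2 : τ + r ≠ 0 := by positivity
  have h3 := ((hasDerivAt_const r (-(2 * D * τ ^ 2))).div h1 h2).add
    (((h1.log h2).add ((hasDerivAt_const r τ).div h1 h2)).const_mul ((d : ℝ) / 2))
  convert! h3 using 1
  rw [fisherBound]
  field_simp
  ring

/-- Allows the initial time a > 0 to be replaced by 0, where the formula for the Fisher bound has a
1/r but its primitive is harmless. -/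
theorem fisherPrimitive_zero_le {D τ r : ℝ} (hD : 0 ≤ D) (hτ : 0 < τ) (hr : 0 ≤ r) :
    fisherPrimitive d D τ 0 ≤ fisherPrimitive d D τ r := by
  have h1 := Real.one_sub_inv_le_log_of_pos (show 0 < (τ + r) / τ by positivity)
  rw [Real.log_div (by positivity) hτ.ne', inv_div] at h1
  have h2 : 2 * D * τ ^ 2 / (τ + r) ≤ 2 * D * τ ^ 2 / τ := by gcongr; linarith
  have h3 : (0 : ℝ) ≤ d / 2 := by positivity
  unfold fisherPrimitive
  rw [add_zero, div_self hτ.ne', neg_div, neg_div]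
  have h4 : (d : ℝ) / 2 * (Real.log τ + 1) ≤
      d / 2 * (Real.log (τ + r) + τ / (τ + r)) := mul_le_mul_of_nonneg_left (by linarith) h3
  linarith

theorem continuousOn_fisherBound {D τ a b : ℝ} (hτ : 0 < τ) (ha : 0 < a) :
    ContinuousOn (fun r => fisherBound d D 1 (τ / (τ + r)) r) (Icc a b) := by
  have h1 : ∀ r ∈ Icc a b, τ + r ≠ 0 := fun r hr => by linarith [hr.1]
  have h2 : ∀ r ∈ Icc a b, r ≠ 0 := fun r hr => by linarith [hr.1]
  unfold fisherBound
  fun_prop (disch := assumption)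

theorem integrableOn_fisherBound {D τ a b : ℝ} (hτ : 0 < τ) (ha : 0 < a) :
    IntegrableOn (fun r => fisherBound d D 1 (τ / (τ + r)) r) (Ioc a b) :=
  ((continuousOn_fisherBound hτ ha).integrableOn_Icc).mono_set Ioc_subset_Icc_self

theorem integral_fisherBound {D τ a b : ℝ} (hτ : 0 < τ) (ha : 0 < a) (hab : a ≤ b) :
    ∫ r in Ioc a b, 1 / 2 * fisherBound d D 1 (τ / (τ + r)) r =
      fisherPrimitive d D τ b - fisherPrimitive d D τ a := by
  rw [← intervalIntegral.integral_of_le hab]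
  refine intervalIntegral.integral_eq_sub_of_hasDerivAt (fun r hr => ?_) ?_
  · rw [uIcc_of_le hab] at hr
    exact hasDerivAt_fisherPrimitive hτ (ha.trans_le hr.1)
  · rw [intervalIntegrable_iff_integrableOn_Ioc_of_le hab]
    exact (integrableOn_fisherBound hτ ha).const_mul _

/-! ### Entropy of the Gaussian at the far end of the flow. -/

theorem log_heatKernel {r : ℝ} (hr : 0 < r) (y : E d) :
    Real.log (heatKernel d r y) = -(d / 2) * Real.log (2 * Real.pi * r) - ‖y‖ ^ 2 / (2 * r) := by
  have := Real.pi_pos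
  rw [heatKernel, Real.log_mul (by positivity) (by positivity), Real.log_exp,
    Real.log_rpow (by positivity)]
  ring

theorem heatKernel_mul_log {r : ℝ} (hr : 0 < r) (y : E d) :
    heatKernel d r y * Real.log (heatKernel d r y) =
      -(d / 2) * Real.log (2 * Real.pi * r) * heatKernel d r y +
      -(1 / (2 * r)) * ∑ i, heatKernel₂ r (EuclideanSpace.basisFun (Fin d) ℝ i) y := by
  simp only [heatKernel₂, ← Finset.sum_mul, sum_inner_sq, log_heatKernel hr]
  ring

theorem integral_heatKernel_mul_log {r : ℝ} (hr : 0 < r) :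
    Integrable (fun y => heatKernel d r y * Real.log (heatKernel d r y)) ∧
    ∫ y, heatKernel d r y * Real.log (heatKernel d r y) =
      -(d / 2) * Real.log (2 * Real.pi * r) - d / 2 := by
  have h1 := (integrable_heatKernel (d := d) hr).const_mul (-(d / 2) * Real.log (2 * Real.pi * r))
  have h2 : Integrable fun y => -(1 / (2 * r)) *
      ∑ i, heatKernel₂ r (EuclideanSpace.basisFun (Fin d) ℝ i) y :=
    (integrable_finsetSum _ fun i _ => integrable_heatKernel₂ hr _).const_mul _
  simp only [heatKernel_mul_log hr]
  refine ⟨h1.add h2, ?_⟩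
  rw [integral_add h1 h2, integral_const_mul, integral_const_mul, integral_heatKernel hr,
    integral_finsetSum _ fun i _ => integrable_heatKernel₂ hr _]
  simp only [integral_heatKernel₂ hr]
  simp
  field_simp
  ring

/-- Removes δ from the bound at the final time. -/
theorem tendsto_integral_phi_heatKernel {r : ℝ} (hr : 0 < r) :
    Tendsto (fun n : ℕ => ∫ y, phi (1 / ((n : ℝ) + 1)) (heatKernel d r y)) atTop
      (𝓝 (-(d / 2) * Real.log (2 * Real.pi * r) - d / 2)) := by
  rw [← (integral_heatKernel_mul_log (d := d) hr).2]
  set M := (2 * Real.pi * r) ^ (-(d : ℝ) / 2) with hM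
  refine tendsto_integral_of_dominated_convergence
    (fun y => |heatKernel d r y * Real.log (heatKernel d r y)| + M * heatKernel d r y)
    (fun n => ?_) ((integral_heatKernel_mul_log hr).1.abs.add
      ((integrable_heatKernel hr).const_mul _)) (fun n => Eventually.of_forall fun y => ?_)
    (Eventually.of_forall fun y => ?_)
  · exact ((continuousOn_phi (δ := 1 / ((n : ℝ) + 1)) (by positivity)).comp_continuous
      (continuous_heatKernel r) fun y => (heatKernel_pos hr y).le).aestronglyMeasurable
  · have hK := heatKernel_pos (d := d) hr y
    have hKM := heatKernel_le (d := d) hr y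
    have hn : 0 < 1 / ((n : ℝ) + 1) := by positivity
    have hn1 : 1 / ((n : ℝ) + 1) ≤ 1 := by
      rw [div_le_one (by positivity)]
      linarith [Nat.cast_nonneg (α := ℝ) n]
    have h1 : Real.log (heatKernel d r y) ≤ Real.log (1 / ((n : ℝ) + 1) + heatKernel d r y) :=
      Real.log_le_log hK (by linarith)
    -- From log x ≤ x - 1 with x = δ + K_r(y) and δ ≤ 1.
    have h2 : Real.log (1 / ((n : ℝ) + 1) + heatKernel d r y) ≤ M := by
      refine (Real.log_le_sub_one_of_pos (by positivity)).trans ?_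
      linarith
    have h3 : |Real.log (1 / ((n : ℝ) + 1) + heatKernel d r y)| ≤
        |Real.log (heatKernel d r y)| + M := by
      have hM0 : 0 ≤ M := hK.le.trans hKM
      rw [abs_le]
      constructor
      · linarith [neg_abs_le (Real.log (heatKernel d r y))]
      · linarith [abs_nonneg (Real.log (heatKernel d r y))]
    rw [phi, Real.norm_eq_abs, abs_mul, abs_mul, abs_of_pos hK]
    nlinarith
  · have hK := heatKernel_pos (d := d) hr y
    unfold phi
    refine Tendsto.const_mul _ ?_
    have h1 : Tendsto (fun n : ℕ => 1 / ((n : ℝ) + 1) + heatKernel d r y) atTop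
        (𝓝 (0 + heatKernel d r y)) :=
      tendsto_one_div_add_atTop_nhds_zero_nat.add_const _
    rw [zero_add] at h1
    exact (Real.continuousAt_log hK.ne').tendsto.comp h1

/-- The sharp constant in the logarithmic Sobolev inequality with parameter `τ`. -/
def sharpBound (d : ℕ) (D τ : ℝ) : ℝ := 2 * τ * D - d - d / 2 * Real.log (2 * Real.pi * τ)

/-- The Gaussian entropy contributes -(d/2) log b and the primitive (d/2) log(τ + b); their sum
tends to 0, and the constants left over are the sharp ones. -/
theorem tendsto_fisherPrimitive_sub {D τ : ℝ} (hτ : 0 < τ) :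
    Tendsto (fun b => -(d / 2) * Real.log (2 * Real.pi * b) - d / 2 + fisherPrimitive d D τ b -
      fisherPrimitive d D τ 0) atTop (𝓝 (sharpBound d D τ)) := by
  have hpi := Real.pi_pos
  have h1 : Tendsto (fun b : ℝ => τ + b) atTop atTop := tendsto_atTop_add_const_left _ _ tendsto_id
  have h2 : Tendsto (fun b : ℝ => -(2 * D * τ ^ 2) / (τ + b)) atTop (𝓝 0) :=
    tendsto_const_nhds.div_atTop h1
  have h3 : Tendsto (fun b : ℝ => τ / (τ + b)) atTop (𝓝 0) := tendsto_const_nhds.div_atTop h1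
  have h4 : Tendsto (fun b : ℝ => Real.log (τ / b + 1)) atTop (𝓝 0) := by
    have h5 : Tendsto (fun b : ℝ => τ / b + 1) atTop (𝓝 (0 + 1)) :=
      (tendsto_const_nhds.div_atTop tendsto_id).add_const 1
    rw [zero_add] at h5
    have := (Real.continuousAt_log one_ne_zero).tendsto.comp h5
    rwa [Real.log_one] at this
  have h6 := ((h2.add ((h4.add h3).const_mul ((d : ℝ) / 2))).add_const
    (-(d / 2) * Real.log (2 * Real.pi) - d / 2 - fisherPrimitive d D τ 0))
  have hval : (0 + (d : ℝ) / 2 * (0 + 0)) +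
      (-(d / 2) * Real.log (2 * Real.pi) - d / 2 - fisherPrimitive d D τ 0) =
      sharpBound d D τ := by
    rw [sharpBound, fisherPrimitive, Real.log_mul (by positivity) hτ.ne', add_zero (0 : ℝ),
      add_zero τ, div_self hτ.ne']
    field_simp
    ring
  rw [hval] at h6
  refine h6.congr' ?_
  filter_upwards [eventually_gt_atTop 0] with b hb
  have h7 : τ / b + 1 = (τ + b) / b := by field_simp
  rw [h7, Real.log_div (by positivity) hb.ne', Real.log_mul (x := 2 * Real.pi) (by positivity)
    hb.ne']
  conv_rhs => rw [fisherPrimitive]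
  ring

/-- **The sharp logarithmic Sobolev inequality** with a remainder that controls the variance
defect of the heat flow on a given time interval. -/
theorem logSobolev_remainder (hd : 1 ≤ d) (hg : MemLp g 2 volume) (hG : IsWeakGradient g G)
    (h1 : ∫ z, g z ^ 2 = 1) (hent : Integrable fun z => g z ^ 2 * Real.log (g z ^ 2))
    {τ a₀ b₀ ε : ℝ} (hτ : 0 < τ) (ha₀ : 0 < a₀) (hab : a₀ ≤ b₀) (hε : 0 < ε) :
    ∃ e : ℝ → ℝ, IntegrableOn e (Ioc a₀ b₀) ∧ (∀ r ∈ Ioc a₀ b₀, 0 ≤ e r) ∧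
      (∀ r ∈ Ioc a₀ b₀, ∀ u : E d, ‖u‖ = 1 →
        ∫⁻ x, ENNReal.ofReal (varianceDefect (fun z => g z ^ 2) (τ / (τ + r)) r u x ^ 2 /
          heatBound d r) ≤ ENNReal.ofReal (2 * e r)) ∧
      (∫ z, g z ^ 2 * Real.log (g z ^ 2)) + ∫ r in Ioc a₀ b₀, e r ≤
        sharpBound d (∫ z, ‖G z‖ ^ 2) τ + ε := by
  have hf := integrable_sq' hg
  have hf0 : ∀ z, 0 ≤ g z ^ 2 := fun z => sq_nonneg _
  set f : E d → ℝ := fun z => g z ^ 2 with hfdef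
  set D := ∫ z, ‖G z‖ ^ 2 with hD
  have hD0 : 0 ≤ D := integral_nonneg fun z => sq_nonneg _
  have hpos : 0 < ∫ z, g z ^ 2 := by rw [h1]; exact one_pos
  -- Half of ε is spent on the final time b. Only then is δ chosen, depending on b, with the other
  -- half.
  obtain ⟨b, hbb, hb⟩ := ((eventually_ge_atTop b₀).and ((tendsto_fisherPrimitive_sub (d := d)
    (D := D) hτ).eventually (gt_mem_nhds (show sharpBound d D τ < sharpBound d D τ + ε / 2 by
      linarith)))).exists
  have hb0 : 0 < b := ha₀.trans_le (hab.trans hbb)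
  obtain ⟨n, hn⟩ := ((tendsto_integral_phi_heatKernel (d := d) hb0).eventually
    (gt_mem_nhds (show _ < -(d / 2) * Real.log (2 * Real.pi * b) - d / 2 + ε / 2 by
      linarith))).exists
  set δ : ℝ := 1 / ((n : ℝ) + 1) with hδdef
  have hδ : 0 < δ := by positivity
  -- The remainder is half the gap in the Fisher information bound; it depends on ε through δ.
  set e : ℝ → ℝ := fun r => 1 / 2 * fisherBound d D 1 (τ / (τ + r)) r - dissipation δ f r with he
  have hei : ∀ a, 0 < a → IntegrableOn e (Ioc a b) := fun a ha =>
    ((integrableOn_fisherBound hτ ha).const_mul _).sub (integrableOn_dissipation hδ hf hf0 ha)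
  have hrem := fun {r : ℝ} (hr : 0 < r) {u : E d} (hu : ‖u‖ = 1) =>
    lintegral_varianceDefect_le hg hG hpos hr (τ / (τ + r)) hδ hu
  rw [h1] at hrem
  simp only [mul_one] at hrem
  have h2e : ∀ r, fisherBound d D 1 (τ / (τ + r)) r - 2 * dissipation δ f r = 2 * e r :=
    fun r => by rw [he]; ring
  have he0 : ∀ r, 0 < r → 0 ≤ e r := fun r hr => by
    have hu : ‖EuclideanSpace.basisFun (Fin d) ℝ ⟨0, hd⟩‖ = 1 := by simp
    have h := (hrem hr hu).2
    rw [h2e] at h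
    linarith
  refine ⟨e, (hei a₀ ha₀).mono_set (Ioc_subset_Ioc_right hbb),
    fun r hr => he0 r (ha₀.trans hr.1), fun r hr u hu => ?_, ?_⟩
  · have h := (hrem (ha₀.trans hr.1) hu).1
    rwa [h2e] at h
  -- The fundamental theorem of calculus on (a, b] bounds the entropy at time a by this constant,
  -- which does not involve a, so lower semicontinuity at time 0 applies.
  · set C := (∫ y, phi δ (heatKernel d b y)) + fisherPrimitive d D τ b - fisherPrimitive d D τ 0 -
      ∫ r in Ioc a₀ b₀, e r with hC
    have hflow : ∀ a ∈ Ioo 0 a₀, flowEntropy δ f a ≤ C := by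
      intro a ha
      have hab' : a ≤ b := ha.2.le.trans (hab.trans hbb)
      have i1 : ∫ r in Ioc a b, e r = (fisherPrimitive d D τ b - fisherPrimitive d D τ a) -
          (flowEntropy δ f a - flowEntropy δ f b) := by
        rw [he, integral_sub ((integrableOn_fisherBound hτ ha.1).const_mul _)
          (integrableOn_dissipation hδ hf hf0 ha.1), integral_fisherBound hτ ha.1 hab',
          integral_dissipation hδ hf hf0 ha.1 hab']
      have i2 : ∫ r in Ioc a₀ b₀, e r ≤ ∫ r in Ioc a b, e r := by
        refine setIntegral_mono_set (hei a ha.1) ?_ ?_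
        · filter_upwards [ae_restrict_mem measurableSet_Ioc] with r hr using
            he0 r (ha.1.trans hr.1)
        · exact (Ioc_subset_Ioc ha.2.le hbb).eventuallyLE
      have i3 := flowEntropy_le hδ hf hf0 h1 hb0
      have i4 := fisherPrimitive_zero_le (d := d) hD0 hτ ha.1.le
      rw [hC]
      linarith
    obtain ⟨hi, hle⟩ := integral_phi_le_of_flowEntropy_le hf hf0 hδ ha₀ hflow
    -- Adding δ inside the logarithm only increases the density, so δ need not tend to 0 on this
    -- side.
    have hmono : ∫ z, g z ^ 2 * Real.log (g z ^ 2) ≤ ∫ z, phi δ (f z) := by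
      refine integral_mono hent hi fun z => ?_
      simp only [phi, hfdef]
      rcases (hf0 z).eq_or_lt with h | h
      · rw [← h]; simp
      · exact mul_le_mul_of_nonneg_left (Real.log_le_log h (by linarith)) h.le
    linarith

theorem logSobolev (hd : 1 ≤ d) (hg : MemLp g 2 volume) (hG : IsWeakGradient g G)
    (h1 : ∫ z, g z ^ 2 = 1) (hent : Integrable fun z => g z ^ 2 * Real.log (g z ^ 2))
    {τ : ℝ} (hτ : 0 < τ) :
    ∫ z, g z ^ 2 * Real.log (g z ^ 2) ≤ sharpBound d (∫ z, ‖G z‖ ^ 2) τ := by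
  refine le_of_forall_pos_le_add fun ε hε => ?_
  -- The remainder is merely nonnegative here, so the interval (1, 2] is arbitrary.
  obtain ⟨e, -, h0, -, hle⟩ := logSobolev_remainder hd hg hG h1 hent hτ one_pos one_le_two hε
  have := setIntegral_nonneg (μ := volume) measurableSet_Ioc h0
  linarith

end

/-! ### Stability of the logarithmic Sobolev inequality -/

theorem tendsto_conv_of_L1 {f : ℕ → E d → ℝ} {f₀ k : E d → ℝ} (hf : ∀ n, Integrable (f n))
    (hf₀ : Integrable f₀) (hlim : Tendsto (fun n => ∫ x, |f n x - f₀ x|) atTop (𝓝 0))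
    (hk : Continuous k) {C : ℝ} (hC : ∀ y, |k y| ≤ C) (x : E d) :
    Tendsto (fun n => conv (f n) k x) atTop (𝓝 (conv f₀ k x)) := by
  rw [tendsto_iff_norm_sub_tendsto_zero]
  have h : Tendsto (fun n => C * ∫ x, |f n x - f₀ x|) atTop (𝓝 0) := by
    simpa using hlim.const_mul C
  refine squeeze_zero (fun n => norm_nonneg _) (fun n => ?_) h
  have := abs_conv_le ((hf n).sub hf₀) hC x
  simp only [Pi.sub_apply] at this
  refine le_trans (le_of_eq ?_) this
  rw [Real.norm_eq_abs, conv, conv, ← integral_sub (integrable_mul_kernel (hf n) hk hC x)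
    (integrable_mul_kernel hf₀ hk hC x), conv]
  congr 2
  ext z
  simp only [Pi.sub_apply]
  ring

theorem continuous_varianceDefect {f : E d → ℝ} (hf : Integrable f) (hf0 : ∀ z, 0 ≤ f z)
    (hpos : 0 < ∫ z, f z) {r : ℝ} (hr : 0 < r) (l : ℝ) (u : E d) :
    Continuous (varianceDefect f l r u) := by
  have h0 := continuous_heatFlow hf hr
  have h1 := continuous_heatFlow₁ hf hr u
  have h2 := continuous_heatFlow₂ hf hr u
  unfold varianceDefect
  refine ((h0.const_mul _).sub (h2.const_mul _)).add
    (((h1.pow 2).const_mul _).div h0 fun x => (heatFlow_pos hf hf0 hpos hr x).ne')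

theorem tendsto_varianceDefect {f : ℕ → E d → ℝ} {f₀ : E d → ℝ} (hf : ∀ n, Integrable (f n))
    (hf₀ : Integrable f₀) (hlim : Tendsto (fun n => ∫ x, |f n x - f₀ x|) atTop (𝓝 0))
    (hf00 : ∀ z, 0 ≤ f₀ z) (hpos : 0 < ∫ z, f₀ z) {r : ℝ} (hr : 0 < r) (l : ℝ) (u x : E d) :
    Tendsto (fun n => varianceDefect (f n) l r u x) atTop (𝓝 (varianceDefect f₀ l r u x)) := by
  have h0 := tendsto_conv_of_L1 hf hf₀ hlim (continuous_heatKernel r) (heatKernel_bound hr) x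
  have h1 := tendsto_conv_of_L1 hf hf₀ hlim (continuous_heatKernel₁ r u)
    (heatKernel₁_bound hr u) x
  have h2 := tendsto_conv_of_L1 hf hf₀ hlim (continuous_heatKernel₂ r u)
    (heatKernel₂_bound hr u) x
  exact ((h0.const_mul _).sub (h2.const_mul _)).add
    (((h1.pow 2).const_mul _).div h0 (heatFlow_pos hf₀ hf00 hpos hr x).ne')

/-- The remainders tend to 0 in L¹ of the time interval, hence almost everywhere along a
subsequence. At such a time, L¹ convergence of the densities gives pointwise convergence of the
defects, Fatou's lemma makes the integral of the limit zero, and continuity removes the null set in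
x. The null set of times depends neither on u nor on x. -/
theorem ae_varianceDefect_eq_zero (hd : 1 ≤ d) {τ : ℝ} (hτ : 0 < τ) {g : ℕ → E d → ℝ}
    {G : ℕ → E d → E d} (hg : ∀ n, MemLp (g n) 2 volume) (hG : ∀ n, IsWeakGradient (g n) (G n))
    (h1 : ∀ n, ∫ z, g n z ^ 2 = 1)
    (hent : ∀ n, Integrable fun z => g n z ^ 2 * Real.log (g n z ^ 2))
    (hdef : Tendsto (fun n => sharpBound d (∫ z, ‖G n z‖ ^ 2) τ -
      ∫ z, g n z ^ 2 * Real.log (g n z ^ 2)) atTop (𝓝 0))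
    {f : E d → ℝ} (hf : Integrable f) (hf0 : ∀ z, 0 ≤ f z) (hf1 : ∫ z, f z = 1)
    (hlim : Tendsto (fun n => ∫ x, |g n x ^ 2 - f x|) atTop (𝓝 0))
    {a b : ℝ} (ha : 0 < a) (hab : a ≤ b) :
    ∀ᵐ r ∂volume.restrict (Ioc a b), ∀ u : E d, ‖u‖ = 1 → ∀ x,
      varianceDefect f (τ / (τ + r)) r u x = 0 := by
  have hex := fun n : ℕ => logSobolev_remainder hd (hg n) (hG n) (h1 n) (hent n) hτ ha hab
    (ε := 1 / ((n : ℝ) + 1)) (by positivity)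
  choose e hei he0 heV hele using hex
  have hint : Tendsto (fun n => ∫ r in Ioc a b, e n r) atTop (𝓝 0) := by
    have h := hdef.add tendsto_one_div_add_atTop_nhds_zero_nat
    rw [add_zero] at h
    refine squeeze_zero (fun n => setIntegral_nonneg measurableSet_Ioc (he0 n)) (fun n => ?_) h
    linarith [hele n]
  have hL1 : Tendsto (fun n => eLpNorm (e n - 0) 1 (volume.restrict (Ioc a b))) atTop (𝓝 0) := by
    have h := ENNReal.tendsto_ofReal hint
    rw [ENNReal.ofReal_zero] at h
    refine h.congr fun n => ?_
    have h0 : 0 ≤ᵐ[volume.restrict (Ioc a b)] e n := by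
      filter_upwards [ae_restrict_mem measurableSet_Ioc] with r hr using he0 n r hr
    rw [sub_zero, ofReal_integral_eq_lintegral_ofReal (hei n) h0, eLpNorm_one_eq_lintegral_enorm]
    refine lintegral_congr_ae ?_
    filter_upwards [h0] with r hr
    exact (Real.enorm_of_nonneg hr).symm
  obtain ⟨ns, hns, hae⟩ := (tendstoInMeasure_of_tendsto_eLpNorm one_ne_zero
    (fun n => (hei n).aestronglyMeasurable) aestronglyMeasurable_zero hL1).exists_seq_tendsto_ae
  filter_upwards [hae, ae_restrict_mem measurableSet_Ioc] with r hr hrab u hu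
  have hr0 : 0 < r := ha.trans hrab.1
  have hH : 0 < heatBound d r := heatBound_pos hr0
  have hfn : ∀ n, Integrable fun z => g n z ^ 2 := fun n => integrable_sq' (hg n)
  have hfn0 : ∀ n z, 0 ≤ g n z ^ 2 := fun n z => sq_nonneg _
  set l := τ / (τ + r) with hl
  have hV : ∫⁻ x, ENNReal.ofReal (varianceDefect f l r u x ^ 2 / heatBound d r) = 0 := by
    refine le_antisymm ?_ zero_le
    have hc : ∀ n, Continuous fun x => ENNReal.ofReal
        (varianceDefect (fun z => g n z ^ 2) l r u x ^ 2 / heatBound d r) := fun n => by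
      have := continuous_varianceDefect (hfn n) (hfn0 n) (by rw [h1]; exact one_pos) hr0 l u
      exact ENNReal.continuous_ofReal.comp ((this.pow 2).div_const _)
    calc ∫⁻ x, ENNReal.ofReal (varianceDefect f l r u x ^ 2 / heatBound d r)
        = ∫⁻ x, liminf (fun n => ENNReal.ofReal
            (varianceDefect (fun z => g (ns n) z ^ 2) l r u x ^ 2 / heatBound d r)) atTop := by
          refine lintegral_congr fun x => ?_
          have h := (tendsto_varianceDefect hfn hf hlim hf0 (by rw [hf1]; exact one_pos) hr0 l
            u x).comp hns.tendsto_atTop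
          exact (ENNReal.tendsto_ofReal ((h.pow 2).div_const (heatBound d r))).liminf_eq.symm
      _ ≤ liminf (fun n => ∫⁻ x, ENNReal.ofReal
            (varianceDefect (fun z => g (ns n) z ^ 2) l r u x ^ 2 / heatBound d r)) atTop :=
          lintegral_liminf_le fun n => (hc (ns n)).measurable
      _ ≤ liminf (fun n => ENNReal.ofReal (2 * e (ns n) r)) atTop :=
          liminf_le_liminf (Eventually.of_forall fun n => heV (ns n) r hrab u hu)
      _ = 0 := by
          have h := ENNReal.tendsto_ofReal (hr.const_mul 2)
          simp only [Pi.zero_apply, mul_zero, ENNReal.ofReal_zero] at h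
          exact h.liminf_eq
  have hVc := continuous_varianceDefect hf hf0 (by rw [hf1]; exact one_pos) hr0 l u
  have hVc2 : Continuous fun x => ENNReal.ofReal
      (varianceDefect f l r u x ^ 2 / heatBound d r) :=
    ENNReal.continuous_ofReal.comp ((hVc.pow 2).div_const _)
  rw [lintegral_eq_zero_iff hVc2.measurable] at hV
  have hae0 : varianceDefect f l r u =ᵐ[volume] fun _ => 0 := by
    filter_upwards [hV] with x hx
    have hx : ENNReal.ofReal (varianceDefect f l r u x ^ 2 / heatBound d r) = 0 := hx
    rw [ENNReal.ofReal_eq_zero, div_le_iff₀ hH, zero_mul] at hx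
    exact pow_eq_zero_iff two_ne_zero |>.1 (le_antisymm hx (sq_nonneg _))
  intro x
  exact congrFun (hVc.ae_eq_iff_eq volume continuous_const |>.1 hae0) x

/-- A heat flow without variance defect is Gaussian. -/
theorem exists_heatFlow_eq_heatKernel {f : E d → ℝ} (hf : Integrable f) (hf0 : ∀ z, 0 ≤ f z)
    (hf1 : ∫ z, f z = 1) {τ r : ℝ} (hτ : 0 < τ) (hr : 0 < r)
    (hV : ∀ u : E d, ‖u‖ = 1 → ∀ x, varianceDefect f (τ / (τ + r)) r u x = 0) :
    ∃ a : E d, ∀ x, heatFlow f r x = heatKernel d (τ + r) (x - a) := by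
  have hpos : ∀ x, 0 < heatFlow f r x := heatFlow_pos hf hf0 (by rw [hf1]; exact one_pos) hr
  set s := τ + r with hs
  have hs0 : 0 < s := by positivity
  set m : ℝ := heatFlow f r 0 with hm
  have hm0 : 0 < m := hpos 0
  -- For a Gaussian centred at a with variance s, ∇ log f_r(0) = a / s.
  set a : E d := (s / m) • flowGradient f r 0 with ha
  have hline : ∀ u : E d, ‖u‖ = 1 → ∀ t : ℝ, Real.log (heatFlow f r (t • u)) =
      Real.log m + t * (-(1 / r) * heatFlow₁ f r u 0 / m) - t ^ 2 / (2 * s) := by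
    intro u hu
    have d0 : ∀ t : ℝ, HasDerivAt (fun t : ℝ => heatFlow f r (t • u))
        (-(1 / r) * heatFlow₁ f r u (t • u)) t := fun t => by
      have := hasDerivAt_of_hasLineDerivAt (fun x => hasLineDerivAt_heatFlow hf hr u x) 0 t
      simpa only [zero_add] using this
    have d1 : ∀ t : ℝ, HasDerivAt (fun t : ℝ => heatFlow₁ f r u (t • u))
        (‖u‖ ^ 2 * heatFlow f r (t • u) - (1 / r) * heatFlow₂ f r u (t • u)) t := fun t => by
      have := hasDerivAt_of_hasLineDerivAt (fun x => hasLineDerivAt_heatFlow₁ hf hr u x) 0 t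
      simpa only [zero_add] using this
    set p : ℝ → ℝ := fun t => -(1 / r) * heatFlow₁ f r u (t • u) / heatFlow f r (t • u) with hp
    -- Vanishing defect means posterior variance rτ/s, and then (log f_r)'' = -(1 - τ/s)/r = -1/s
    -- along the line.
    have dp : ∀ t, HasDerivAt (fun t => p t + t / s) 0 t := by
      intro t
      have h := (((d1 t).const_mul (-(1 / r))).div (d0 t) (hpos _).ne').add
        ((hasDerivAt_id t).div_const s)
      convert! h using 1
      have hv := hV u hu (t • u)
      have hne := (hpos (t • u)).ne'
      rw [varianceDefect, hu] at hv
      have h2 : heatFlow₂ f r u (t • u) = r * (τ / s * heatFlow f r (t • u) +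
          (1 / r) * heatFlow₁ f r u (t • u) ^ 2 / heatFlow f r (t • u)) := by
        field_simp at hv ⊢
        linarith
      rw [h2, hu]
      field_simp
      rw [hs]
      ring
    have hpc : ∀ t, p t = p 0 - t / s := fun t => by
      have := is_const_of_deriv_eq_zero (fun t => (dp t).differentiableAt)
        (fun t => (dp t).deriv) t 0
      simp only [zero_div, add_zero] at this
      linarith
    have dq : ∀ t, HasDerivAt (fun t => Real.log (heatFlow f r (t • u)) - t * p 0 +
        t ^ 2 / (2 * s)) 0 t := by
      intro t
      have h := (((d0 t).log (hpos _).ne').sub ((hasDerivAt_id t).mul_const (p 0))).add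
        (((hasDerivAt_id t).pow 2).div_const (2 * s))
      convert! h using 1
      have h3 : -(1 / r) * heatFlow₁ f r u (t • u) / heatFlow f r (t • u) = p 0 - t / s := hpc t
      rw [h3]
      simp
      field_simp
      ring
    intro t
    have h := is_const_of_deriv_eq_zero (fun t => (dq t).differentiableAt)
      (fun t => (dq t).deriv) t 0
    simp only [hp, zero_smul, zero_mul, sub_zero, zero_pow two_ne_zero, zero_div, add_zero] at h
    rw [← hm] at h
    linarith
  have hexp : ∀ x, heatFlow f r x = m * Real.exp (inner ℝ x a / s - ‖x‖ ^ 2 / (2 * s)) := by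
    intro x
    rcases eq_or_ne x 0 with rfl | hx
    · simp [hm]
    · have hn : ‖x‖ ≠ 0 := norm_ne_zero_iff.2 hx
      have h := hline (‖x‖⁻¹ • x) (by rw [norm_smul, norm_inv, norm_norm, inv_mul_cancel₀ hn]) ‖x‖
      rw [smul_smul, mul_inv_cancel₀ hn, one_smul, ← inner_flowGradient hf hr, inner_smul_left] at h
      rw [← Real.exp_log (hpos x), h, add_sub_assoc, Real.exp_add, Real.exp_log hm0, ha,
        inner_smul_right]
      congr 2
      simp only [conj_trivial]
      field_simp
  -- Completing the square leaves one unknown constant, which conservation of mass fixes to 1.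
  set c := m * Real.exp (‖a‖ ^ 2 / (2 * s)) * (2 * Real.pi * s) ^ ((d : ℝ) / 2) with hc
  have hK : ∀ x, heatFlow f r x = c * heatKernel d s (x - a) := by
    intro x
    rw [hexp x, hc, heatKernel, neg_div (2 : ℝ), Real.rpow_neg (by positivity), norm_sub_sq_real]
    have h2 : inner ℝ x a / s - ‖x‖ ^ 2 / (2 * s) =
        ‖a‖ ^ 2 / (2 * s) + -(‖x‖ ^ 2 - 2 * inner ℝ x a + ‖a‖ ^ 2) / (2 * s) := by
      field_simp; ring
    rw [h2, Real.exp_add]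
    have h3 : (2 * Real.pi * s) ^ ((d : ℝ) / 2) ≠ 0 := by positivity
    field_simp
  have hint := integral_heatFlow hf hr
  rw [hf1, funext hK, integral_const_mul, integral_sub_right_eq_self (fun x => heatKernel d s x),
    integral_heatKernel hs0, mul_one] at hint
  exact ⟨a, fun x => by rw [hK, hint, one_mul]⟩

theorem tendsto_heatKernel {s : ℕ → ℝ} {y : ℕ → E d} {s₀ : ℝ} {y₀ : E d} (hs₀ : 0 < s₀)
    (hs : Tendsto s atTop (𝓝 s₀)) (hy : Tendsto y atTop (𝓝 y₀)) :
    Tendsto (fun n => heatKernel d (s n) (y n)) atTop (𝓝 (heatKernel d s₀ y₀)) := by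
  have := Real.pi_pos
  refine Tendsto.mul ?_ (Real.continuous_exp.continuousAt.tendsto.comp ?_)
  · exact (hs.const_mul _).rpow_const (Or.inl (by positivity))
  · exact ((hy.norm.pow 2).neg).div (hs.const_mul 2) (by positivity)

/-- **Stability**: sequences that are asymptotically optimal in the logarithmic Sobolev inequality
can only converge to a Gaussian. -/
theorem ae_eq_heatKernel_of_deficit_tendsto_zero (hd : 1 ≤ d) {τ : ℝ} (hτ : 0 < τ)
    {g : ℕ → E d → ℝ} {G : ℕ → E d → E d} (hg : ∀ n, MemLp (g n) 2 volume)
    (hG : ∀ n, IsWeakGradient (g n) (G n)) (h1 : ∀ n, ∫ z, g n z ^ 2 = 1)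
    (hent : ∀ n, Integrable fun z => g n z ^ 2 * Real.log (g n z ^ 2))
    (hdef : Tendsto (fun n => sharpBound d (∫ z, ‖G n z‖ ^ 2) τ -
      ∫ z, g n z ^ 2 * Real.log (g n z ^ 2)) atTop (𝓝 0))
    {f : E d → ℝ} (hf : Integrable f) (hf0 : ∀ z, 0 ≤ f z) (hf1 : ∫ z, f z = 1)
    (hlim : Tendsto (fun n => ∫ x, |g n x ^ 2 - f x|) atTop (𝓝 0)) :
    ∃ a : E d, f =ᵐ[volume] fun x => heatKernel d τ (x - a) := by
  -- The exceptional times form a null set, so each interval (1/(k + 2), 1/(k + 1)] contains a good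
  -- one.
  have hex : ∀ k : ℕ, ∃ r : ℝ, 0 < r ∧ r ≤ 1 / ((k : ℝ) + 1) ∧
      ∃ a : E d, ∀ x, heatFlow f r x = heatKernel d (τ + r) (x - a) := by
    intro k
    have ha : (0 : ℝ) < 1 / ((k : ℝ) + 2) := by positivity
    have hab : 1 / ((k : ℝ) + 2) < 1 / ((k : ℝ) + 1) :=
      one_div_lt_one_div_of_lt (by positivity) (by linarith)
    have hne : (ae ((volume : Measure ℝ).restrict
        (Ioc (1 / ((k : ℝ) + 2)) (1 / ((k : ℝ) + 1))))).NeBot := by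
      rw [ae_restrict_neBot, Real.volume_Ioc]
      simpa using hab
    obtain ⟨r, hV, hr⟩ := ((ae_varianceDefect_eq_zero hd hτ hg hG h1 hent hdef hf hf0 hf1 hlim ha
      hab.le).and (ae_restrict_mem measurableSet_Ioc)).exists
    exact ⟨r, ha.trans hr.1, hr.2,
      exists_heatFlow_eq_heatKernel hf hf0 hf1 hτ (ha.trans hr.1) hV⟩
  choose r hr0 hrle a ha using hex
  have hr : Tendsto r atTop (𝓝 0) := squeeze_zero (fun k => (hr0 k).le) hrle
    tendsto_one_div_add_atTop_nhds_zero_nat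
  obtain ⟨ns, hns, hae⟩ := exists_seq_heatFlow_tendsto_ae hf hr0 hr
  have hrn := hr.comp hns.tendsto_atTop
  -- The centres may depend on the time. If they return infinitely often to a ball, a subsequence
  -- converges; otherwise they escape to infinity and the flow tends to 0 almost everywhere,
  -- contradicting mass 1.
  by_cases hb : ∃ R : ℝ, ∃ᶠ n in atTop, a (ns n) ∈ Metric.closedBall (0 : E d) R
  · obtain ⟨R, hR⟩ := hb
    obtain ⟨a₀, -, φ, hφ, hφa⟩ := tendsto_subseq_of_frequently_bounded
      Metric.isBounded_closedBall hR
    refine ⟨a₀, ?_⟩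
    filter_upwards [hae] with x hx
    refine tendsto_nhds_unique (hx.comp hφ.tendsto_atTop) ?_
    have h := tendsto_heatKernel (d := d) hτ (s := fun n => τ + r (ns (φ n)))
      (by simpa using (hrn.comp hφ.tendsto_atTop).const_add τ) (hφa.const_sub x)
    refine h.congr fun n => ?_
    simp only [Function.comp, ha]
  · exfalso
    push Not at hb
    have htop : Tendsto (fun n => ‖a (ns n)‖) atTop atTop := by
      refine tendsto_atTop.2 fun R => ?_
      filter_upwards [hb R] with n hn
      simpa using (not_le.1 (by simpa using hn)).le
    have hzero : f =ᵐ[volume] fun _ => 0 := by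
      filter_upwards [hae] with x hx
      refine tendsto_nhds_unique hx ?_
      have h1 : Tendsto (fun n => ‖x - a (ns n)‖) atTop atTop := by
        refine tendsto_atTop_mono (fun n => ?_) (tendsto_atTop_add_const_right _ (-‖x‖) htop)
        have := norm_sub_norm_le (a (ns n)) x
        rw [norm_sub_rev] at this
        linarith
      have h2 : Tendsto (fun n => (2 * Real.pi * τ) ^ (-(d : ℝ) / 2) *
          Real.exp (-((1 / (2 * (τ + 1))) * ‖x - a (ns n)‖ ^ 2))) atTop (𝓝 0) := by
        have h3 := (tendsto_pow_atTop two_ne_zero).comp h1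
        have h4 := Real.tendsto_exp_neg_atTop_nhds_zero.comp
          (h3.const_mul_atTop (show 0 < 1 / (2 * (τ + 1)) by positivity))
        simpa using h4.const_mul ((2 * Real.pi * τ) ^ (-(d : ℝ) / 2))
      refine squeeze_zero (fun n => heatFlow_nonneg hf0 (hr0 _) x) (fun n => ?_) h2
      rw [ha, heatKernel]
      have hrp := hr0 (ns n)
      have hr1 : r (ns n) ≤ 1 := (hrle (ns n)).trans (by
        rw [div_le_one (by positivity)]
        linarith [Nat.cast_nonneg (α := ℝ) (ns n)])
      have hpi := Real.pi_pos
      gcongr ?_ * ?_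
      · apply Real.rpow_le_rpow_of_nonpos (by positivity)
        · gcongr; linarith
        · have : (0 : ℝ) ≤ d := Nat.cast_nonneg d
          linarith
      · apply Real.exp_le_exp.2
        rw [neg_div, neg_le_neg_iff, div_mul_eq_mul_div, one_mul]
        gcongr
    rw [integral_congr_ae hzero] at hf1
    simp at hf1

/-! ### Extended integrals -/

theorem extIntegral_of_integrable {f : E d → ℝ} (hf : Integrable f) :
    extIntegral f = ((∫ x, f x : ℝ) : EReal) := by
  have h1 : (∫⁻ x, ENNReal.ofReal (f x)) ≠ ⊤ := (hf.lintegral_lt_top).ne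
  have h2 : (∫⁻ x, ENNReal.ofReal (-f x)) ≠ ⊤ := (hf.neg.lintegral_lt_top).ne
  rw [extIntegral, integral_eq_lintegral_pos_part_sub_lintegral_neg_part hf, EReal.coe_sub,
    EReal.coe_ennreal_toReal h1, EReal.coe_ennreal_toReal h2]

theorem integrable_of_lintegral_ne_top {f : E d → ℝ} (hm : AEStronglyMeasurable f volume)
    (h1 : (∫⁻ x, ENNReal.ofReal (f x)) ≠ ⊤) (h2 : (∫⁻ x, ENNReal.ofReal (-f x)) ≠ ⊤) :
    Integrable f := by
  refine ⟨hm, ?_⟩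
  rw [hasFiniteIntegral_iff_enorm]
  calc ∫⁻ x, ‖f x‖ₑ ≤ ∫⁻ x, (ENNReal.ofReal (f x) + ENNReal.ofReal (-f x)) := by
        refine lintegral_mono fun x => ?_
        rw [Real.enorm_eq_ofReal_abs]
        rcases le_total 0 (f x) with h | h
        · rw [abs_of_nonneg h]; exact le_self_add
        · rw [abs_of_nonpos h]; exact le_add_self
    _ = _ := lintegral_add_left' hm.aemeasurable.ennreal_ofReal _
    _ < ⊤ := ENNReal.add_lt_top.2 ⟨h1.lt_top, h2.lt_top⟩

/-- The positive part may be infinite as well, because `⊤ - ⊤ = ⊥` in `EReal`. -/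
theorem extIntegral_eq_bot {f : E d → ℝ} (h : (∫⁻ x, ENNReal.ofReal (-f x)) = ⊤) :
    extIntegral f = ⊥ := by
  rw [extIntegral, h, EReal.coe_ennreal_top, EReal.sub_top]

theorem extIntegral_eq_top {f : E d → ℝ} (h : (∫⁻ x, ENNReal.ofReal (f x)) = ⊤)
    (h2 : (∫⁻ x, ENNReal.ofReal (-f x)) ≠ ⊤) : extIntegral f = ⊤ := by
  rw [extIntegral, h, EReal.coe_ennreal_top, ← EReal.coe_ennreal_toReal h2, EReal.top_sub_coe]

/-! ### Weak gradients -/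

/-- Each coordinate of the difference annihilates all test functions. This makes the gradient norm
independent of the choice in its definition. -/
theorem IsWeakGradient.ae_unique {g : E d → ℝ} {G G' : E d → E d} (h : IsWeakGradient g G)
    (h' : IsWeakGradient g G') : G =ᵐ[volume] G' := by
  have hcoord : ∀ i, ∀ᵐ x, inner ℝ (G x) (EuclideanSpace.basisFun (Fin d) ℝ i) -
      inner ℝ (G' x) (EuclideanSpace.basisFun (Fin d) ℝ i) = 0 := by
    intro i
    set v := EuclideanSpace.basisFun (Fin d) ℝ i
    have hl := (memLp_inner h.1 v).locallyIntegrable one_le_two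
    have hl' := (memLp_inner h'.1 v).locallyIntegrable one_le_two
    refine ae_eq_zero_of_integral_contDiff_smul_eq_zero (hl.sub hl') fun φ hφ hφc => ?_
    have h1 := (h.2 φ hφ hφc v).symm.trans (h'.2 φ hφ hφc v)
    have i1 := hl.integrable_smul_left_of_hasCompactSupport hφ.continuous hφc
    have i2 := hl'.integrable_smul_left_of_hasCompactSupport hφ.continuous hφc
    simp only [smul_eq_mul] at i1 i2
    simp only [smul_eq_mul, mul_sub]
    rw [integral_sub i1 i2]
    simp only [mul_comm (φ _)]
    linarith
  filter_upwards [ae_all_iff.2 hcoord] with x hx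
  rw [← sub_eq_zero, ← norm_eq_zero, ← sq_eq_zero_iff, ← sum_inner_sq]
  refine Finset.sum_eq_zero fun i _ => ?_
  rw [real_inner_comm, inner_sub_left, hx i, zero_pow two_ne_zero]

theorem gradNormSq_eq {g : E d → ℝ} {G : E d → E d} (h : IsWeakGradient g G) :
    gradNormSq g = ∫ x, ‖G x‖ ^ 2 := by
  have hex : ∃ G : E d → E d, IsWeakGradient g G := ⟨G, h⟩
  rw [gradNormSq, weakGradient, dif_pos hex]
  refine integral_congr_ae ?_
  filter_upwards [hex.choose_spec.ae_unique h] with x hx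
  rw [hx]

theorem IsWeakGradient.congr {g g' : E d → ℝ} {G : E d → E d} (h : IsWeakGradient g G)
    (hg : g' =ᵐ[volume] g) : IsWeakGradient g' G := by
  refine ⟨h.1, fun φ hφ hc v => ?_⟩
  rw [← h.2 φ hφ hc v]
  refine integral_congr_ae ?_
  filter_upwards [hg] with x hx
  rw [hx]

theorem IsWeakGradient.neg {g : E d → ℝ} {G : E d → E d} (h : IsWeakGradient g G) :
    IsWeakGradient (fun x => -g x) (fun x => -G x) := by
  refine ⟨h.1.neg, fun φ hφ hc v => ?_⟩
  simp only [neg_mul, integral_neg, inner_neg_left, h.2 φ hφ hc v]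

/-- A classical gradient is a weak gradient. -/
theorem isWeakGradient_of_hasLineDerivAt {g : E d → ℝ} {G : E d → E d} (hg : Continuous g)
    (hG : Continuous G) (hG2 : MemLp G 2 volume)
    (h : ∀ x v, HasLineDerivAt ℝ g (inner ℝ (G x) v) x v) : IsWeakGradient g G := by
  refine ⟨hG2, fun φ hφ hc v => ?_⟩
  have h1 : ContDiff ℝ 1 φ := hφ.of_le (by simp)
  have c1 : Continuous fun x => fderiv ℝ φ x v :=
    (h1.continuous_fderiv (by simp)).clm_apply continuous_const
  have hparts := integral_bilinear_hasLineDerivAt_right_eq_neg_left_of_integrable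
    (μ := (volume : Measure (E d))) (B := ContinuousLinearMap.mul ℝ ℝ) (v := v)
    (f := g) (f' := fun x => inner ℝ (G x) v) (g := φ) (g' := fun x => fderiv ℝ φ x v)
    (by
      simp only [ContinuousLinearMap.mul_apply']
      exact Continuous.integrable_of_hasCompactSupport (by have := hφ.continuous; fun_prop)
        hc.mul_left)
    (by
      simp only [ContinuousLinearMap.mul_apply']
      exact Continuous.integrable_of_hasCompactSupport (by fun_prop)
        (HasCompactSupport.mul_left (hc.fderiv_apply ℝ v)))
    (by
      simp only [ContinuousLinearMap.mul_apply']
      exact Continuous.integrable_of_hasCompactSupport (by have := hφ.continuous; fun_prop)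
        hc.mul_left)
    (fun x _ => h x v)
    (fun x _ => (h1.differentiable (by simp) x).hasFDerivAt.hasLineDerivAt v)
  simpa only [ContinuousLinearMap.mul_apply'] using hparts

theorem mem_unitH1_iff {g : E d → ℝ} : g ∈ unitH1 d ↔
    MemLp g 2 volume ∧ (∃ G, IsWeakGradient g G) ∧ ∫ x, g x ^ 2 = 1 := by
  have key : MemLp g 2 volume → (eLpNorm g 2 volume = 1 ↔ ∫ x, g x ^ 2 = 1) := by
    intro hg
    have h0 : 0 ≤ ∫ x, g x ^ 2 := integral_nonneg fun x => sq_nonneg _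
    rw [hg.eLpNorm_eq_integral_rpow_norm two_ne_zero ENNReal.ofNat_ne_top]
    simp only [ENNReal.toReal_ofNat, Real.rpow_two, Real.norm_eq_abs, sq_abs]
    rw [ENNReal.ofReal_eq_one, ← one_div, ← Real.sqrt_eq_rpow, Real.sqrt_eq_one]
  constructor
  · rintro ⟨⟨hg, hG⟩, h1⟩
    exact ⟨hg, hG, (key hg).1 h1⟩
  · rintro ⟨hg, hG, h1⟩
    exact ⟨⟨hg, hG⟩, (key hg).2 h1⟩

/-! ### The entropy on `H¹` -/

theorem aestronglyMeasurable_entropyIntegrand (ρ : ℝ) {g : E d → ℝ}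
    (hg : AEStronglyMeasurable g volume) :
    AEStronglyMeasurable (entropyIntegrand ρ g) volume := by
  have h : Measurable fun t : ℝ => ρ * (t ^ 2 * Real.log (t ^ 2)) := by fun_prop
  exact (h.comp_aemeasurable hg.aemeasurable).aestronglyMeasurable

/-- The positive part of the entropy is finite on `H¹`. -/
theorem lintegral_entropyIntegrand_ne_top {ρ : ℝ} (hρ : 0 < ρ) {g : E d → ℝ} (hg : MemH1 g) :
    (∫⁻ x, ENNReal.ofReal (entropyIntegrand ρ g x)) ≠ ⊤ := by
  obtain ⟨hg, G, hG⟩ := hg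
  have hf := integrable_sq' hg
  have hnn : 0 ≤ ∫ x, g x ^ 2 := integral_nonneg fun x => sq_nonneg _
  -- The heat flow argument needs positive mass; for g = 0 almost everywhere the integrand vanishes.
  rcases hnn.eq_or_lt with h | h
  · have h0 := (integral_eq_zero_iff_of_nonneg (μ := volume) (f := fun x => g x ^ 2)
      (by intro x; exact sq_nonneg (g x)) hf).1 h.symm
    rw [lintegral_congr_ae (g := fun _ => 0)]
    · simp
    · filter_upwards [h0] with x hx
      have hx : g x ^ 2 = 0 := hx
      simp [entropyIntegrand, hx]
  · have hi := (integrable_sq_mul_log_one_add hg hG h).const_mul ρ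
    refine ne_top_of_le_ne_top hi.lintegral_lt_top.ne (lintegral_mono fun x => ?_)
    apply ENNReal.ofReal_le_ofReal
    rw [entropyIntegrand, phi]
    refine mul_le_mul_of_nonneg_left ?_ hρ.le
    rcases (sq_nonneg (g x)).eq_or_lt with h0 | h0
    · rw [← h0]; simp
    · exact mul_le_mul_of_nonneg_left (Real.log_le_log h0 (by linarith)) h0.le

theorem integrable_entropyIntegrand_iff {ρ : ℝ} (hρ : 0 < ρ) {g : E d → ℝ} :
    Integrable (entropyIntegrand ρ g) ↔ Integrable fun x => g x ^ 2 * Real.log (g x ^ 2) :=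
  integrable_const_mul_iff hρ.ne'.isUnit _

theorem entropy_of_integrable {ρ : ℝ} (hρ : 0 < ρ) {g : E d → ℝ}
    (h : Integrable fun x => g x ^ 2 * Real.log (g x ^ 2)) :
    entropy ρ g = ((ρ * ∫ x, g x ^ 2 * Real.log (g x ^ 2) : ℝ) : EReal) := by
  rw [entropy, extIntegral_of_integrable ((integrable_entropyIntegrand_iff hρ).2 h)]
  congr 1
  exact integral_const_mul _ _

theorem entropy_eq_bot {ρ : ℝ} (hρ : 0 < ρ) {g : E d → ℝ} (hg : MemH1 g)
    (h : ¬Integrable fun x => g x ^ 2 * Real.log (g x ^ 2)) : entropy ρ g = ⊥ := by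
  refine extIntegral_eq_bot ?_
  by_contra hne
  exact h ((integrable_entropyIntegrand_iff hρ).1 (integrable_of_lintegral_ne_top
    (aestronglyMeasurable_entropyIntegrand ρ hg.1.1) (lintegral_entropyIntegrand_ne_top hρ hg) hne))

/-- The value of the variational problem. -/
def chiValue (d : ℕ) (ρ : ℝ) : ℝ := ρ * d * (1 - 1 / 2 * Real.log (ρ / Real.pi))

/-- At τ = 1/(2ρ) the coefficient 2τ of D equals 1/ρ, so ρ times the logarithmic Sobolev inequality
is exactly the lower bound for the energy. -/
theorem mul_sharpBound {ρ : ℝ} (hρ : 0 < ρ) (D : ℝ) :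
    ρ * sharpBound d D (1 / (2 * ρ)) = D - chiValue d ρ := by
  have hpi := Real.pi_pos
  have h : 2 * Real.pi * (1 / (2 * ρ)) = (ρ / Real.pi)⁻¹ := by field_simp
  rw [sharpBound, chiValue, h, Real.log_inv]
  field_simp
  ring

theorem energy_of_integrable {ρ : ℝ} (hρ : 0 < ρ) {g : E d → ℝ} {G : E d → E d}
    (hG : IsWeakGradient g G) (h : Integrable fun x => g x ^ 2 * Real.log (g x ^ 2)) :
    energy ρ g = ((∫ x, ‖G x‖ ^ 2) - ρ * ∫ x, g x ^ 2 * Real.log (g x ^ 2) : ℝ) := by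
  rw [energy, entropy_of_integrable hρ h, gradNormSq_eq hG, EReal.coe_sub]

theorem energy_eq_top {ρ : ℝ} (hρ : 0 < ρ) {g : E d → ℝ} (hg : MemH1 g)
    (h : ¬Integrable fun x => g x ^ 2 * Real.log (g x ^ 2)) : energy ρ g = ⊤ := by
  rw [energy, entropy_eq_bot hρ hg h, EReal.coe_sub_bot]

theorem chiValue_le_energy (hd : 1 ≤ d) {ρ : ℝ} (hρ : 0 < ρ) {g : E d → ℝ} (hg : g ∈ unitH1 d) :
    (chiValue d ρ : EReal) ≤ energy ρ g := by
  obtain ⟨hg2, ⟨G, hG⟩, h1⟩ := mem_unitH1_iff.1 hg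
  by_cases h : Integrable fun x => g x ^ 2 * Real.log (g x ^ 2)
  · rw [energy_of_integrable hρ hG h, EReal.coe_le_coe_iff]
    have h2 := logSobolev hd hg2 hG h1 h (τ := 1 / (2 * ρ)) (by positivity)
    have h3 := mul_le_mul_of_nonneg_left h2 hρ.le
    rw [mul_sharpBound hρ] at h3
    linarith
  · rw [energy_eq_top hρ hg.1 h]
    exact le_top

/-! ### The Gaussian -/

theorem gaussian_pos {ρ : ℝ} (hρ : 0 < ρ) (x : E d) : 0 < gaussian d ρ x := by
  have := Real.pi_pos
  unfold gaussian; positivity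

theorem contDiff_gaussian (ρ : ℝ) : ContDiff ℝ (⊤ : ℕ∞) (gaussian d ρ) := by
  unfold gaussian
  exact contDiff_const.mul ((contDiff_const.mul (contDiff_norm_sq ℝ)).exp)

theorem gaussian_sq {ρ : ℝ} (hρ : 0 < ρ) (x : E d) :
    gaussian d ρ x ^ 2 = heatKernel d (1 / (2 * ρ)) x := by
  have hpi := Real.pi_pos
  rw [gaussian, heatKernel, mul_pow, ← Real.exp_nat_mul, ← Real.rpow_mul_natCast (by positivity)]
  have h : 2 * Real.pi * (1 / (2 * ρ)) = (ρ / Real.pi)⁻¹ := by field_simp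
  rw [h, Real.inv_rpow (by positivity), ← Real.rpow_neg (by positivity)]
  congr 2
  · push_cast; ring
  · push_cast; field_simp

theorem hasLineDerivAt_gaussian (ρ : ℝ) (x v : E d) :
    HasLineDerivAt ℝ (gaussian d ρ) (-ρ * gaussian d ρ x * inner ℝ x v) x v := by
  rw [HasLineDerivAt]
  have h1 : HasDerivAt (fun t : ℝ => ‖x + t • v‖ ^ 2) (2 * inner ℝ (x + (0 : ℝ) • v) v) 0 := by
    have h : HasDerivAt (fun t : ℝ => x + t • v) v 0 := by
      simpa using ((hasDerivAt_id (0 : ℝ)).smul_const v).const_add x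
    exact h.norm_sq
  have h2 := ((h1.const_mul (-(ρ / 2))).exp).const_mul ((ρ / Real.pi) ^ ((d : ℝ) / 4))
  convert! h2 using 1
  simp only [gaussian, zero_smul, add_zero]
  ring

theorem continuous_gaussian (ρ : ℝ) : Continuous (gaussian d ρ) := (contDiff_gaussian ρ).continuous

/-- The gradient of the translated Gaussian. -/
def gaussianGradient (ρ : ℝ) (a x : E d) : E d := (-ρ * gaussian d ρ (x - a)) • (x - a)

section

variable {ρ : ℝ}

theorem integral_shifted_gaussian_sq (hρ : 0 < ρ) (a : E d) :
    ∫ x, gaussian d ρ (x - a) ^ 2 = 1 := by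
  simp only [gaussian_sq hρ]
  rw [integral_sub_right_eq_self (fun x => heatKernel d (1 / (2 * ρ)) x),
    integral_heatKernel (by positivity)]

theorem memLp_shifted_gaussian (hρ : 0 < ρ) (a : E d) :
    MemLp (fun x => gaussian d ρ (x - a)) 2 volume := by
  have hc := continuous_gaussian (d := d) ρ
  rw [memLp_two_iff_integrable_sq (Continuous.aestronglyMeasurable (by fun_prop))]
  simp only [gaussian_sq hρ]
  exact (integrable_heatKernel (by positivity)).comp_sub_right a

theorem norm_gaussianGradient_sq (hρ : 0 < ρ) (a x : E d) : ‖gaussianGradient ρ a x‖ ^ 2 =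
    ρ ^ 2 * ∑ i, heatKernel₂ (1 / (2 * ρ)) (EuclideanSpace.basisFun (Fin d) ℝ i) (x - a) := by
  simp only [heatKernel₂, ← Finset.sum_mul, sum_inner_sq, ← gaussian_sq hρ, gaussianGradient,
    norm_smul, mul_pow, Real.norm_eq_abs, sq_abs]
  ring

theorem integrable_norm_gaussianGradient_sq (hρ : 0 < ρ) (a : E d) :
    Integrable fun x => ‖gaussianGradient ρ a x‖ ^ 2 := by
  simp only [norm_gaussianGradient_sq hρ]
  exact (integrable_finsetSum _ fun i _ =>
    (integrable_heatKernel₂ (by positivity) _).comp_sub_right a).const_mul _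

theorem integral_norm_gaussianGradient_sq (hρ : 0 < ρ) (a : E d) :
    ∫ x, ‖gaussianGradient ρ a x‖ ^ 2 = ρ * d / 2 := by
  simp only [norm_gaussianGradient_sq hρ]
  rw [integral_const_mul, integral_finsetSum _ fun i _ =>
    (integrable_heatKernel₂ (by positivity) _).comp_sub_right a]
  have h : ∀ i, ∫ x, heatKernel₂ (1 / (2 * ρ)) (EuclideanSpace.basisFun (Fin d) ℝ i) (x - a) =
      1 / (2 * ρ) := fun i => by
    rw [integral_sub_right_eq_self (fun x => heatKernel₂ (1 / (2 * ρ))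
      (EuclideanSpace.basisFun (Fin d) ℝ i) x), integral_heatKernel₂ (by positivity)]
    simp
  simp only [h, Finset.sum_const, Finset.card_univ, Fintype.card_fin, nsmul_eq_mul]
  field_simp

theorem isWeakGradient_gaussian (hρ : 0 < ρ) (a : E d) :
    IsWeakGradient (fun x => gaussian d ρ (x - a)) (gaussianGradient ρ a) := by
  have hc := continuous_gaussian (d := d) ρ
  have hcG : Continuous (gaussianGradient ρ a) := by unfold gaussianGradient; fun_prop
  refine isWeakGradient_of_hasLineDerivAt (by fun_prop) hcG ?_ fun x v => ?_
  · rw [memLp_two_iff_integrable_sq_norm hcG.aestronglyMeasurable]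
    exact integrable_norm_gaussianGradient_sq hρ a
  · have h := hasLineDerivAt_gaussian ρ (x - a) v
    rw [HasLineDerivAt] at h ⊢
    rw [gaussianGradient, inner_smul_left, conj_trivial]
    simpa only [sub_add_eq_add_sub] using h

theorem shifted_gaussian_entropy (hρ : 0 < ρ) (a : E d) :
    Integrable (fun x => gaussian d ρ (x - a) ^ 2 * Real.log (gaussian d ρ (x - a) ^ 2)) ∧
    ∫ x, gaussian d ρ (x - a) ^ 2 * Real.log (gaussian d ρ (x - a) ^ 2) =
      -(d / 2) * Real.log (2 * Real.pi * (1 / (2 * ρ))) - d / 2 := by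
  simp only [gaussian_sq hρ]
  have h := integral_heatKernel_mul_log (d := d) (r := 1 / (2 * ρ)) (by positivity)
  refine ⟨h.1.comp_sub_right a, ?_⟩
  rw [integral_sub_right_eq_self (fun x => heatKernel d (1 / (2 * ρ)) x *
    Real.log (heatKernel d (1 / (2 * ρ)) x)), h.2]

theorem gaussian_energy_value (hρ : 0 < ρ) :
    ρ * d / 2 - ρ * (-(d / 2) * Real.log (2 * Real.pi * (1 / (2 * ρ))) - d / 2) =
      chiValue d ρ := by
  have hpi := Real.pi_pos
  have h : 2 * Real.pi * (1 / (2 * ρ)) = (ρ / Real.pi)⁻¹ := by field_simp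
  rw [chiValue, h, Real.log_inv]
  ring

/-- Translates of the Gaussian, up to sign, have the minimal energy. -/
theorem energy_of_ae_eq_gaussian (hρ : 0 < ρ) {g : E d → ℝ} {a : E d}
    (h : (∀ᵐ x, g x = gaussian d ρ (x - a)) ∨ ∀ᵐ x, g x = -gaussian d ρ (x - a)) :
    g ∈ unitH1 d ∧ energy ρ g = (chiValue d ρ : EReal) := by
  have hsq : ∀ᵐ x, g x ^ 2 = gaussian d ρ (x - a) ^ 2 := by
    rcases h with h | h <;> filter_upwards [h] with x hx <;> rw [hx]
    ring
  have hex : MemLp g 2 volume ∧ ∃ G, IsWeakGradient g G ∧ ∫ x, ‖G x‖ ^ 2 = ρ * d / 2 := by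
    rcases h with h | h
    · exact ⟨(memLp_congr_ae h).2 (memLp_shifted_gaussian hρ a), _,
        (isWeakGradient_gaussian hρ a).congr h, integral_norm_gaussianGradient_sq hρ a⟩
    · refine ⟨(memLp_congr_ae h).2 (memLp_shifted_gaussian hρ a).neg, _,
        (isWeakGradient_gaussian hρ a).neg.congr h, ?_⟩
      simp only [norm_neg]
      exact integral_norm_gaussianGradient_sq hρ a
  obtain ⟨hg, G, hG, hD⟩ := hex
  have hlog : (fun x => gaussian d ρ (x - a) ^ 2 * Real.log (gaussian d ρ (x - a) ^ 2))
      =ᵐ[volume] fun x => g x ^ 2 * Real.log (g x ^ 2) := by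
    filter_upwards [hsq] with x hx
    rw [hx]
  refine ⟨mem_unitH1_iff.2 ⟨hg, ⟨G, hG⟩, ?_⟩, ?_⟩
  · rw [integral_congr_ae hsq, integral_shifted_gaussian_sq hρ]
  · rw [energy_of_integrable hρ hG ((shifted_gaussian_entropy hρ a).1.congr hlog), hD,
      ← integral_congr_ae hlog, (shifted_gaussian_entropy hρ a).2, gaussian_energy_value hρ]

theorem chi_eq (hd : 1 ≤ d) (hρ : 0 < ρ) : chi d ρ = (chiValue d ρ : EReal) := by
  refine le_antisymm ?_ (le_iInf₂ fun g hg => chiValue_le_energy hd hρ hg)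
  have h := energy_of_ae_eq_gaussian (d := d) hρ (g := gaussian d ρ) (a := 0)
    (Or.inl (Eventually.of_forall fun x => by rw [sub_zero]))
  exact h.2 ▸ iInf₂_le (gaussian d ρ) h.1

end

/-! ### Weakly constant functions -/

/-- The mollifications have zero derivative along every line, hence are constant, and they converge
to the function almost everywhere by Lebesgue differentiation. -/
theorem ae_eq_const_of_weak_gradient_eq_zero {s : E d → ℝ} (hs : LocallyIntegrable s)
    (h : ∀ φ : E d → ℝ, ContDiff ℝ (⊤ : ℕ∞) φ → HasCompactSupport φ → ∀ v : E d,
      ∫ x, s x * fderiv ℝ φ x v = 0) : ∃ c, ∀ᵐ x, s x = c := by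
  have hder : ∀ n x v, conv s (fun y => fderiv ℝ (mollifier d n) y v) x = 0 := by
    intro n x v
    have hd : ∀ z, fderiv ℝ (fun z => mollifier d n (x - z)) z v =
        -fderiv ℝ (mollifier d n) (x - z) v := fderiv_mollifier_sub n x v
    have h1 := h (fun z => mollifier d n (x - z)) ((contDiff_mollifier n).comp (by fun_prop))
      ((hasCompactSupport_mollifier n).comp_homeomorph (Homeomorph.subLeft x)) v
    simp only [hd, mul_neg, integral_neg, neg_eq_zero] at h1
    exact h1
  have hconst : ∀ n x, conv s (mollifier d n) x = conv s (mollifier d n) 0 := by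
    intro n x
    have hd : ∀ t : ℝ, HasDerivAt (fun t : ℝ => conv s (mollifier d n) (t • x)) 0 t := fun t => by
      have := hasDerivAt_of_hasLineDerivAt
        (fun y => hasLineDerivAt_conv_mollifier hs n y x) 0 t
      simpa only [zero_add, hder] using this
    have := is_const_of_deriv_eq_zero (fun t => (hd t).differentiableAt) (fun t => (hd t).deriv) 1 0
    simpa using this
  have hae : ∀ᵐ x, Tendsto (fun n => conv s (mollifier d n) x) atTop (𝓝 (s x)) := by
    -- K = 2 is the fixed ratio of the outer to the inner radius of the mollifiers.
    have := ContDiffBump.ae_convolution_tendsto_right_of_locallyIntegrable (μ := volume)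
      (φ := fun n => bump d n) (l := atTop) (K := 2) tendsto_one_div_add_atTop_nhds_zero_nat
      (Eventually.of_forall fun n => le_of_eq (by
        simp only [bump]
        field_simp)) hs
    filter_upwards [this] with x hx
    refine hx.congr fun n => ?_
    rw [convolution_eq_swap]
    simp only [ContinuousLinearMap.lsmul_apply, smul_eq_mul, conv, mollifier, mul_comm]
  obtain ⟨x₀, hx₀⟩ := hae.exists
  refine ⟨s x₀, ?_⟩
  filter_upwards [hae] with x hx
  refine tendsto_nhds_unique hx (hx₀.congr fun n => ?_)
  rw [hconst n x, hconst n x₀]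

/-- A function in `H¹` whose square is a Gaussian density has constant sign. -/
theorem ae_eq_gaussian_of_sq {ρ : ℝ} (hρ : 0 < ρ) {g : E d → ℝ} {G : E d → E d}
    (hg : MemLp g 2 volume) (hG : IsWeakGradient g G) {a : E d}
    (hsq : ∀ᵐ x, g x ^ 2 = gaussian d ρ (x - a) ^ 2) :
    (∀ᵐ x, g x = gaussian d ρ (x - a)) ∨ ∀ᵐ x, g x = -gaussian d ρ (x - a) := by
  have hpos : ∀ x, 0 < gaussian d ρ (x - a) := fun x => gaussian_pos hρ _
  have hsmooth : ContDiff ℝ (⊤ : ℕ∞) fun x => gaussian d ρ (x - a) :=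
    (contDiff_gaussian ρ).comp (by fun_prop)
  have hcont := hsmooth.continuous
  have hga := isWeakGradient_gaussian hρ a
  have hline : ∀ φ : E d → ℝ, ContDiff ℝ (⊤ : ℕ∞) φ → ∀ x v,
      HasLineDerivAt ℝ φ (fderiv ℝ φ x v) x v := fun φ hφ x v =>
    (hφ.differentiable (by simp) x).hasFDerivAt.hasLineDerivAt v
  -- identification of the gradient
  have hgrad : ∀ v, ∀ᵐ x, inner ℝ (G x) v = -ρ * inner ℝ (x - a) v * g x := by
    intro v
    have hGv := memLp_inner hG.1 v
    have hgv := memLp_inner hga.1 v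
    have i1 : Integrable fun x => 2 * g x * inner ℝ (G x) v := by
      have := (hg.integrable_mul hGv).const_mul 2
      refine this.congr (Eventually.of_forall fun x => ?_)
      simp only [Pi.mul_apply]; ring
    have i2 : Integrable fun x => 2 * gaussian d ρ (x - a) *
        inner ℝ (gaussianGradient ρ a x) v := by
      have := ((memLp_shifted_gaussian hρ a).integrable_mul hgv).const_mul 2
      refine this.congr (Eventually.of_forall fun x => ?_)
      simp only [Pi.mul_apply]; ring
    -- Equal squares have equal weak gradients, and the weak product rule identifies these as twice
    -- function times gradient.
    have h0 : ∀ᵐ x, 2 * g x * inner ℝ (G x) v -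
        2 * gaussian d ρ (x - a) * inner ℝ (gaussianGradient ρ a x) v = 0 := by
      refine ae_eq_zero_of_integral_contDiff_smul_eq_zero
        (i1.sub i2).locallyIntegrable fun φ hφ hc => ?_
      obtain ⟨C, hC⟩ := hφ.continuous.bounded_above_of_compact_support hc
      have hφ' : Continuous fun x => fderiv ℝ φ x v :=
        ((hφ.of_le (m := 1) (by simp)).continuous_fderiv (by simp)).clm_apply continuous_const
      obtain ⟨C', hC'⟩ := hφ'.bounded_above_of_compact_support (hc.fderiv_apply ℝ v)
      have e1 := integral_sq_mul_lineDeriv hg hG hφ.continuous hφ' hC hC' fun x => hline φ hφ x v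
      have e2 := integral_sq_mul_lineDeriv (memLp_shifted_gaussian hρ a) hga hφ.continuous hφ' hC
        hC' fun x => hline φ hφ x v
      have e3 : ∫ x, g x ^ 2 * fderiv ℝ φ x v =
          ∫ x, gaussian d ρ (x - a) ^ 2 * fderiv ℝ φ x v := by
        refine integral_congr_ae ?_
        filter_upwards [hsq] with x hx
        rw [hx]
      simp only [smul_eq_mul, mul_comm (φ _), sub_mul]
      rw [integral_sub (i1.mul_bdd hφ.continuous.aestronglyMeasurable (Eventually.of_forall hC))
        (i2.mul_bdd hφ.continuous.aestronglyMeasurable (Eventually.of_forall hC))]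
      linarith
    filter_upwards [h0, hsq] with x hx hs
    have hne : g x ≠ 0 := fun h => by
      rw [h] at hs
      have := hpos x
      nlinarith
    rw [gaussianGradient, inner_smul_left, conj_trivial] at hx
    have : 2 * g x * (inner ℝ (G x) v - -ρ * inner ℝ (x - a) v * g x) = 0 := by
      have e : 2 * g x * (-ρ * inner ℝ (x - a) v * g x) =
        2 * (-ρ * inner ℝ (x - a) v) * g x ^ 2 := by ring
      rw [mul_sub, e, hs]
      linarith
    rcases mul_eq_zero.1 this with h | h
    · exact absurd h (mul_ne_zero two_ne_zero hne)
    · linarith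
  -- the quotient by the Gaussian is weakly constant
  have hloc : LocallyIntegrable fun x => g x * (gaussian d ρ (x - a))⁻¹ := by
    have hl := hg.locallyIntegrable one_le_two
    have := (hl.locallyIntegrableOn univ).mul_continuousOn
      (g := fun x => (gaussian d ρ (x - a))⁻¹)
      ((hcont.inv₀ fun x => (hpos x).ne').continuousOn) isClosed_univ.isLocallyClosed
    rwa [locallyIntegrableOn_univ] at this
  obtain ⟨c, hc⟩ := ae_eq_const_of_weak_gradient_eq_zero hloc fun φ hφ hcs v => by
    -- Testing the gradient of g with φ divided by the Gaussian: the term from differentiating the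
    -- reciprocal cancels the identified gradient.
    set w : E d → ℝ := fun x => φ x * (gaussian d ρ (x - a))⁻¹ with hw
    have hwc : ContDiff ℝ (⊤ : ℕ∞) w := hφ.mul (hsmooth.inv fun x => (hpos x).ne')
    have hws : HasCompactSupport w := hcs.mul_right
    have hwd : ∀ x, fderiv ℝ w x v = fderiv ℝ φ x v * (gaussian d ρ (x - a))⁻¹ +
        ρ * inner ℝ (x - a) v * w x := by
      intro x
      have h1 := hline w hwc x v
      have h2 : HasLineDerivAt ℝ (fun x => gaussian d ρ (x - a))
          (-ρ * gaussian d ρ (x - a) * inner ℝ (x - a) v) x v := by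
        have h := hasLineDerivAt_gaussian ρ (x - a) v
        rw [HasLineDerivAt] at h ⊢
        simpa only [sub_add_eq_add_sub] using h
      have h3 := HasDerivAt.mul (hline φ hφ x v)
        (HasDerivAt.fun_inv h2 (by simpa using (hpos x).ne'))
      have h4 : HasLineDerivAt ℝ w _ x v := h3
      rw [h1.lineDeriv.symm.trans h4.lineDeriv]
      simp only [zero_smul, add_zero, hw]
      have := (hpos x).ne'
      field_simp
    have hweak := hG.2 w hwc hws v
    have e : ∫ x, inner ℝ (G x) v * w x = ∫ x, -ρ * inner ℝ (x - a) v * g x * w x := by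
      refine integral_congr_ae ?_
      filter_upwards [hgrad v] with x hx
      rw [hx]
    rw [e, ← integral_neg] at hweak
    have hl := hg.locallyIntegrable one_le_two
    have hφ' : Continuous fun x => fderiv ℝ φ x v :=
      ((hφ.of_le (m := 1) (by simp)).continuous_fderiv (by simp)).clm_apply continuous_const
    have j1 : Integrable fun x => g x * (fderiv ℝ φ x v * (gaussian d ρ (x - a))⁻¹) := by
      have := hl.integrable_smul_right_of_hasCompactSupport
        (g := fun x => fderiv ℝ φ x v * (gaussian d ρ (x - a))⁻¹)
        (hφ'.mul (hcont.inv₀ fun x => (hpos x).ne')) ((hcs.fderiv_apply ℝ v).mul_right)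
      simpa using this
    have j2 : Integrable fun x => g x * (ρ * inner ℝ (x - a) v * w x) := by
      have := hl.integrable_smul_right_of_hasCompactSupport
        (g := fun x => ρ * inner ℝ (x - a) v * w x)
        (by have := hwc.continuous; fun_prop) hws.mul_left
      simpa using this
    simp only [hwd, mul_add] at hweak
    rw [integral_add j1 j2] at hweak
    have e2 : ∫ x, -(-ρ * inner ℝ (x - a) v * g x * w x) =
        ∫ x, g x * (ρ * inner ℝ (x - a) v * w x) := by
      congr 1; ext x; ring
    rw [e2] at hweak
    have e3 : ∫ x, g x * (gaussian d ρ (x - a))⁻¹ * fderiv ℝ φ x v =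
        ∫ x, g x * (fderiv ℝ φ x v * (gaussian d ρ (x - a))⁻¹) := by
      congr 1; ext x; ring
    rw [e3]
    linarith
  have hgc : ∀ᵐ x, g x = c * gaussian d ρ (x - a) := by
    filter_upwards [hc] with x hx
    rw [← hx, mul_assoc, inv_mul_cancel₀ (hpos x).ne', mul_one]
  have hc2 : c ^ 2 = 1 := by
    obtain ⟨x, h1, h2⟩ := (hgc.and hsq).exists
    rw [h1, mul_pow] at h2
    have h3 : gaussian d ρ (x - a) ^ 2 ≠ 0 := pow_ne_zero 2 (hpos x).ne'
    exact mul_right_cancel₀ h3 (h2.trans (one_mul _).symm)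
  rcases sq_eq_one_iff.1 hc2 with h | h
  · left; filter_upwards [hgc] with x hx; rw [hx, h, one_mul]
  · right; filter_upwards [hgc] with x hx; rw [hx, h, neg_one_mul]

/-! ### The Legendre transform -/

/-- The maximiser `s ≥ 0` of `p s² - ρ s² log s²`. -/
def dualProfile (ρ p : ℝ) : ℝ := Real.exp ((p / ρ - 1) / 2)

theorem dualProfile_pos (ρ p : ℝ) : 0 < dualProfile ρ p := Real.exp_pos _

theorem continuous_dualProfile (ρ : ℝ) : Continuous (dualProfile ρ) := by
  unfold dualProfile; fun_prop

theorem log_dualProfile_sq (ρ p : ℝ) : Real.log (dualProfile ρ p ^ 2) = p / ρ - 1 := by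
  rw [Real.log_pow, dualProfile, Real.log_exp]
  push_cast
  ring

theorem mul_dualProfile_sq {ρ : ℝ} (hρ : 0 < ρ) (p : ℝ) : p * dualProfile ρ p ^ 2 =
    ρ * (dualProfile ρ p ^ 2 * Real.log (dualProfile ρ p ^ 2)) + ρ * dualProfile ρ p ^ 2 := by
  rw [log_dualProfile_sq]
  field_simp
  ring

/-- Young's inequality for `s² log s²` with a quadratic remainder. -/
theorem mul_sq_add_le {ρ : ℝ} (hρ : 0 < ρ) (p s : ℝ) :
    p * s ^ 2 + ρ * (|s| - dualProfile ρ p) ^ 2 ≤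
      ρ * (s ^ 2 * Real.log (s ^ 2)) + ρ * dualProfile ρ p ^ 2 := by
  set h := dualProfile ρ p with hh
  have hpos : 0 < h := dualProfile_pos ρ p
  have hp : p = ρ * (1 + 2 * Real.log h) := by
    have := log_dualProfile_sq ρ p
    rw [← hh, Real.log_pow] at this
    push_cast at this
    rw [this]
    field_simp
    ring
  rcases eq_or_ne s 0 with rfl | hs
  · simp
  · have ht : 0 < |s| := abs_pos.2 hs
    rw [← sq_abs s]
    set t := |s|
    -- Multiplied by 2ρt², this bound is equivalent to the claim, quadratic remainder included.
    have h1 := Real.log_le_sub_one_of_pos (div_pos hpos ht)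
    rw [Real.log_div hpos.ne' ht.ne'] at h1
    have h2 := mul_le_mul_of_nonneg_left h1 (show 0 ≤ 2 * ρ * t ^ 2 by positivity)
    have h3 : 2 * ρ * t ^ 2 * (h / t - 1) = 2 * ρ * t * h - 2 * ρ * t ^ 2 := by
      field_simp
    rw [h3] at h2
    rw [hp, Real.log_pow]
    push_cast
    linarith

/-- If `f ≤ f' + k` with `k` integrable and `f'⁺` integrable, then `f` has integral `-∞`, unless
both `f` and `f'` are integrable. -/
theorem extIntegral_eq_bot_or_integrable {f f' k : E d → ℝ} (hf : AEStronglyMeasurable f volume)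
    (hf' : AEStronglyMeasurable f' volume) (hk : Integrable k) (h : ∀ x, f x ≤ f' x + k x)
    (hpos : (∫⁻ x, ENNReal.ofReal (f' x)) ≠ ⊤) :
    extIntegral f = ⊥ ∨ Integrable f ∧ Integrable f' := by
  have hkt := hk.lintegral_lt_top.ne
  have hadd : ∀ {u w : E d → ℝ}, (∫⁻ x, ENNReal.ofReal (w x)) ≠ ⊤ → (∀ x, u x ≤ w x + k x) →
      (∫⁻ x, ENNReal.ofReal (u x)) ≠ ⊤ := by
    intro u w hw hle
    refine ne_top_of_le_ne_top (ENNReal.add_ne_top.2 ⟨hw, hkt⟩) ?_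
    rw [← lintegral_add_right' _ hk.aestronglyMeasurable.aemeasurable.ennreal_ofReal]
    exact lintegral_mono fun x => (ENNReal.ofReal_le_ofReal (hle x)).trans ENNReal.ofReal_add_le
  by_cases hneg : (∫⁻ x, ENNReal.ofReal (-f x)) = ⊤
  · exact Or.inl (extIntegral_eq_bot hneg)
  · exact Or.inr ⟨integrable_of_lintegral_ne_top hf (hadd hpos h) hneg,
      integrable_of_lintegral_ne_top hf' hpos (hadd hneg fun x => by linarith [h x])⟩

theorem extIntegral_sub_le {f f' k : E d → ℝ} (hf : AEStronglyMeasurable f volume)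
    (hf' : AEStronglyMeasurable f' volume) (hk : AEStronglyMeasurable k volume)
    (hk0 : ∀ x, 0 ≤ k x) (h : ∀ x, f x ≤ f' x + k x) (hext : HasExtIntegral f') :
    extIntegral f - extIntegral f' ≤ ((∫⁻ x, ENNReal.ofReal (k x) : ℝ≥0∞) : EReal) := by
  by_cases hkt : (∫⁻ x, ENNReal.ofReal (k x)) = ⊤
  · rw [hkt]; exact le_top
  have hki : Integrable k := integrable_of_lintegral_ne_top hk hkt (by
    have : ∀ x, ENNReal.ofReal (-k x) = 0 := fun x =>
      ENNReal.ofReal_of_nonpos (neg_nonpos.2 (hk0 x))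
    simp [this])
  -- If the positive part of f' is infinite, its integral is +∞ and the difference is ⊥, so the
  -- bound holds trivially.
  by_cases hpos : (∫⁻ x, ENNReal.ofReal (f' x)) = ⊤
  · rw [extIntegral_eq_top hpos (hext.resolve_left fun h => h hpos), EReal.sub_top]
    exact bot_le
  rcases extIntegral_eq_bot_or_integrable hf hf' hki h hpos with hb | ⟨hi, hi'⟩
  · rw [hb, EReal.bot_sub]
    exact bot_le
  · rw [extIntegral_of_integrable hi, extIntegral_of_integrable hi',
      ← ofReal_integral_eq_lintegral_ofReal hki (Eventually.of_forall hk0),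
      EReal.coe_ennreal_ofReal, max_eq_left (integral_nonneg hk0), ← EReal.coe_sub,
      EReal.coe_le_coe_iff, sub_le_iff_le_add', ← integral_add hi' hki]
    exact integral_mono hi (hi'.add hki) h

theorem aestronglyMeasurable_mul_sq {ψ g : E d → ℝ} (hψ : AEMeasurable ψ volume)
    (hg : AEStronglyMeasurable g volume) :
    AEStronglyMeasurable (fun x => ψ x * g x ^ 2) volume :=
  hψ.aestronglyMeasurable.mul (hg.pow 2)

theorem aestronglyMeasurable_dualProfile {ψ : E d → ℝ} (hψ : AEMeasurable ψ volume) (ρ : ℝ) :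
    AEStronglyMeasurable (fun x => ρ * dualProfile ρ (ψ x) ^ 2) volume :=
  (((continuous_dualProfile ρ).comp_aestronglyMeasurable hψ.aestronglyMeasurable).pow 2).const_mul ρ

theorem legendre_le {ρ : ℝ} (hρ : 0 < ρ) {ψ : E d → ℝ} (hψ : AEMeasurable ψ volume) :
    legendre ρ ψ ≤ ((∫⁻ x, ENNReal.ofReal (ρ * dualProfile ρ (ψ x) ^ 2) : ℝ≥0∞) : EReal) := by
  refine iSup₂_le fun g hg => ?_
  refine extIntegral_sub_le (aestronglyMeasurable_mul_sq hψ hg.1.1)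
    (aestronglyMeasurable_entropyIntegrand ρ hg.1.1) (aestronglyMeasurable_dualProfile hψ ρ)
    (fun x => by positivity) (fun x => ?_) hg.2.2
  have h1 := mul_sq_add_le hρ (ψ x) (g x)
  have h2 : 0 ≤ ρ * (|g x| - dualProfile ρ (ψ x)) ^ 2 := by positivity
  rw [entropyIntegrand]
  linarith

/-- The maximiser of the Legendre transform, truncated. -/
def truncatedProfile (ρ : ℝ) (n : ℕ) (z : E d × ℝ) : ℝ :=
  {z : E d × ℝ | ‖z.1‖ ≤ n ∧ |z.2| ≤ n}.indicator (fun z => dualProfile ρ z.2) z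

theorem measurable_truncatedProfile (ρ : ℝ) (n : ℕ) :
    Measurable (truncatedProfile (d := d) ρ n) := by
  refine Measurable.indicator ((continuous_dualProfile ρ).measurable.comp measurable_snd) ?_
  exact (measurableSet_le (measurable_fst.norm) measurable_const).inter
    (measurableSet_le (measurable_snd.abs) measurable_const)

theorem integrable_of_bounded_of_support_ball {f : E d → ℝ} (hf : AEStronglyMeasurable f volume)
    {C R : ℝ} (hC : ∀ x, |f x| ≤ C) (hR : ∀ x, R < ‖x‖ → f x = 0) : Integrable f := by
  have h : IntegrableOn f (Metric.closedBall 0 R) := by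
    refine Measure.integrableOn_of_bounded (M := C)
      (isCompact_closedBall (0 : E d) R).measure_lt_top.ne hf ?_
    exact Eventually.of_forall hC
  rwa [integrableOn_iff_integrable_of_support_subset] at h
  intro x hx
  rw [mem_closedBall_zero_iff]
  by_contra hlt
  exact hx (hR x (not_le.1 hlt))

/-- The pointwise maximiser is cut off where x or ψ(x) is large, which makes both integrals finite.
Monotone convergence then reaches the full value, finite or not. -/
theorem le_legendre {ρ : ℝ} (hρ : 0 < ρ) {ψ : E d → ℝ} (hψ : AEMeasurable ψ volume) :
    ((∫⁻ x, ENNReal.ofReal (ρ * dualProfile ρ (ψ x) ^ 2) : ℝ≥0∞) : EReal) ≤ legendre ρ ψ := by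
  set g : ℕ → E d → ℝ := fun n x => truncatedProfile ρ n (x, ψ x) with hg
  have hgm : ∀ n, AEStronglyMeasurable (g n) volume := fun n =>
    ((measurable_truncatedProfile ρ n).comp_aemeasurable
      (aemeasurable_id.prodMk hψ)).aestronglyMeasurable
  have hin : ∀ (n : ℕ) x, ‖x‖ ≤ n → |ψ x| ≤ n → g n x = dualProfile ρ (ψ x) := fun n x h1 h2 =>
    indicator_of_mem (s := {z : E d × ℝ | ‖z.1‖ ≤ n ∧ |z.2| ≤ n}) (a := (x, ψ x)) ⟨h1, h2⟩ _
  have hout : ∀ (n : ℕ) x, ¬(‖x‖ ≤ n ∧ |ψ x| ≤ n) → g n x = 0 := fun n x h =>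
    indicator_of_notMem (s := {z : E d × ℝ | ‖z.1‖ ≤ n ∧ |z.2| ≤ n}) (a := (x, ψ x)) h _
  have hbound : ∀ (n : ℕ) x, g n x ^ 2 ≤ dualProfile ρ n ^ 2 ∧ |ψ x * g n x ^ 2| ≤
      n * dualProfile ρ n ^ 2 := by
    intro n x
    have hn := dualProfile_pos ρ n
    by_cases h : ‖x‖ ≤ n ∧ |ψ x| ≤ n
    · rw [hin n x h.1 h.2]
      have h0 := dualProfile_pos ρ (ψ x)
      have h1 : dualProfile ρ (ψ x) ≤ dualProfile ρ n := by
        unfold dualProfile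
        have := (le_abs_self _).trans h.2
        gcongr
      have h2 : dualProfile ρ (ψ x) ^ 2 ≤ dualProfile ρ n ^ 2 := by gcongr
      refine ⟨h2, ?_⟩
      rw [abs_mul, abs_of_pos (pow_pos h0 2)]
      exact mul_le_mul h.2 h2 (by positivity) (Nat.cast_nonneg n)
    · rw [hout n x h]
      constructor
      · simp only [ne_eq, OfNat.ofNat_ne_zero, not_false_eq_true, zero_pow]; positivity
      · simp only [ne_eq, OfNat.ofNat_ne_zero, not_false_eq_true, zero_pow, mul_zero, abs_zero]
        positivity
  have hzero : ∀ (n : ℕ) x, (n : ℝ) < ‖x‖ → g n x = 0 := fun n x h =>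
    hout n x fun h' => absurd h'.1 (not_le.2 h)
  have i1 : ∀ n, Integrable fun x => g n x ^ 2 := fun n =>
    integrable_of_bounded_of_support_ball ((hgm n).pow 2)
      (fun x => by rw [abs_of_nonneg (sq_nonneg _)]; exact (hbound n x).1)
      (fun x hx => by rw [hzero n x hx]; simp)
  have i2 : ∀ n, Integrable fun x => ψ x * g n x ^ 2 := fun n =>
    integrable_of_bounded_of_support_ball (aestronglyMeasurable_mul_sq hψ (hgm n))
      (fun x => (hbound n x).2) (fun x hx => by rw [hzero n x hx]; simp)
  -- Equality in Young's inequality at the maximiser; where the cut-off makes g zero, both sides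
  -- vanish.
  have hid : ∀ n x, entropyIntegrand ρ (g n) x = ψ x * g n x ^ 2 - ρ * g n x ^ 2 := by
    intro n x
    rw [entropyIntegrand]
    by_cases h : ‖x‖ ≤ n ∧ |ψ x| ≤ n
    · rw [hin n x h.1 h.2, mul_dualProfile_sq hρ]
      ring
    · rw [hout n x h]
      simp
  have i3 : ∀ n, Integrable (entropyIntegrand ρ (g n)) := fun n => by
    rw [funext (hid n)]
    exact (i2 n).sub ((i1 n).const_mul ρ)
  have hle : ∀ n, ((∫⁻ x, ENNReal.ofReal (ρ * g n x ^ 2) : ℝ≥0∞) : EReal) ≤ legendre ρ ψ := by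
    intro n
    have hmem : g n ∈ {g : E d → ℝ | MemLp g 2 volume ∧ HasExtIntegral (fun x => ψ x * g x ^ 2) ∧
        HasExtIntegral (entropyIntegrand ρ g)} :=
      ⟨(memLp_two_iff_integrable_sq (hgm n)).2 (i1 n), Or.inl (i2 n).lintegral_lt_top.ne,
        Or.inl (i3 n).lintegral_lt_top.ne⟩
    refine le_trans (le_of_eq ?_) (le_iSup₂ (f := fun g _ => pairing ψ g - entropy ρ g) (g n) hmem)
    rw [pairing, entropy, extIntegral_of_integrable (i2 n), extIntegral_of_integrable (i3 n),
      ← ofReal_integral_eq_lintegral_ofReal ((i1 n).const_mul ρ)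
        (Eventually.of_forall fun x => by positivity), EReal.coe_ennreal_ofReal,
      max_eq_left (integral_nonneg fun x => by positivity), ← EReal.coe_sub,
      ← integral_sub (i2 n) (i3 n)]
    simp only [hid, sub_sub_cancel]
  have hlim : Tendsto (fun n => ∫⁻ x, ENNReal.ofReal (ρ * g n x ^ 2)) atTop
      (𝓝 (∫⁻ x, ENNReal.ofReal (ρ * dualProfile ρ (ψ x) ^ 2))) := by
    refine lintegral_tendsto_of_tendsto_of_monotone
      (fun n => (((hgm n).pow 2).const_mul ρ).aemeasurable.ennreal_ofReal)
      (Eventually.of_forall fun x => monotone_nat_of_le_succ fun n => ?_)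
      (Eventually.of_forall fun x => ?_)
    · by_cases h : ‖x‖ ≤ n ∧ |ψ x| ≤ n
      · have hs : (n : ℝ) ≤ (n + 1 : ℕ) := by push_cast; linarith
        rw [hin n x h.1 h.2, hin (n + 1) x (h.1.trans hs) (h.2.trans hs)]
      · rw [hout n x h]
        simp
    · obtain ⟨N, hN⟩ := exists_nat_ge (max ‖x‖ |ψ x|)
      refine tendsto_const_nhds.congr' ?_
      filter_upwards [eventually_ge_atTop N] with n hn
      have h1 : max ‖x‖ |ψ x| ≤ n := hN.trans (by exact_mod_cast hn)
      rw [hin n x ((le_max_left _ _).trans h1) ((le_max_right _ _).trans h1)]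
  exact le_of_tendsto' ((continuous_coe_ennreal_ereal.tendsto _).comp hlim) hle

theorem legendre_eq_lintegral {ρ : ℝ} (hρ : 0 < ρ) {ψ : E d → ℝ} (hψ : AEMeasurable ψ volume) :
    legendre ρ ψ =
      ((∫⁻ x, ENNReal.ofReal (ρ * dualProfile ρ (ψ x) ^ 2) : ℝ≥0∞) : EReal) :=
  le_antisymm (legendre_le hρ hψ) (le_legendre hρ hψ)

theorem legendre_eq {ρ : ℝ} (hρ : 0 < ρ) {ψ : E d → ℝ} (hψ : AEMeasurable ψ volume) :
    legendre ρ ψ = ((ENNReal.ofReal (ρ / Real.exp 1) *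
      ∫⁻ x, ENNReal.ofReal (Real.exp (1 / ρ * ψ x)) : ℝ≥0∞) : EReal) := by
  rw [legendre_eq_lintegral hρ hψ, ← lintegral_const_mul' _ _ ENNReal.ofReal_ne_top]
  congr 2
  ext x
  rw [← ENNReal.ofReal_mul (by positivity), dualProfile, ← Real.exp_nat_mul, div_mul_eq_mul_div,
    mul_div_assoc, ← Real.exp_sub]
  congr 3
  push_cast
  ring

/-! ### The dual problem -/

theorem integrable_dualProfile_sq {ρ : ℝ} (hρ : 0 < ρ) {ψ : E d → ℝ} (hψ : AEMeasurable ψ volume)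
    (h : legendre ρ ψ ≠ ⊤) : Integrable fun x => dualProfile ρ (ψ x) ^ 2 := by
  rw [legendre_eq_lintegral hρ hψ] at h
  have h1 : Integrable fun x => ρ * dualProfile ρ (ψ x) ^ 2 := by
    refine integrable_of_lintegral_ne_top (aestronglyMeasurable_dualProfile hψ ρ)
      (fun h2 => h (by rw [h2]; rfl)) ?_
    have : ∀ x, ENNReal.ofReal (-(ρ * dualProfile ρ (ψ x) ^ 2)) = 0 := fun x =>
      ENNReal.ofReal_of_nonpos (neg_nonpos.2 (by positivity))
    simp [this]
  exact (integrable_const_mul_iff hρ.ne'.isUnit _).1 h1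

theorem legendre_of_integrable {ρ : ℝ} (hρ : 0 < ρ) {ψ : E d → ℝ} (hψ : AEMeasurable ψ volume)
    (h : Integrable fun x => dualProfile ρ (ψ x) ^ 2) :
    legendre ρ ψ = ((ρ * ∫ x, dualProfile ρ (ψ x) ^ 2 : ℝ) : EReal) := by
  rw [legendre_eq_lintegral hρ hψ, ← ofReal_integral_eq_lintegral_ofReal (h.const_mul ρ)
    (Eventually.of_forall fun x => by positivity), EReal.coe_ennreal_ofReal,
    max_eq_left (integral_nonneg fun x => by positivity), integral_const_mul]

/-- The dual gap of a trial function consists of its deficit in the logarithmic Sobolev inequality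
and of its distance to the maximiser of the Legendre transform. -/
theorem pairing_eq_bot_or_le {ρ : ℝ} (hρ : 0 < ρ) {ψ : E d → ℝ} (hψ : AEMeasurable ψ volume)
    (hint : Integrable fun x => dualProfile ρ (ψ x) ^ 2) {g : E d → ℝ} {G : E d → E d}
    (hg : MemLp g 2 volume) (hG : IsWeakGradient g G) :
    pairing ψ g = ⊥ ∨ pairing ψ g = ((∫ x, ψ x * g x ^ 2 : ℝ) : EReal) ∧
      Integrable (fun x => g x ^ 2 * Real.log (g x ^ 2)) ∧
      Integrable (fun x => (|g x| - dualProfile ρ (ψ x)) ^ 2) ∧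
      (∫ x, ψ x * g x ^ 2) - (∫ x, ‖G x‖ ^ 2) + ρ * (∫ x, (|g x| - dualProfile ρ (ψ x)) ^ 2) +
        ρ * (sharpBound d (∫ x, ‖G x‖ ^ 2) (1 / (2 * ρ)) - ∫ x, g x ^ 2 * Real.log (g x ^ 2)) ≤
        ρ * (∫ x, dualProfile ρ (ψ x) ^ 2) - chiValue d ρ := by
  have hy := fun x => mul_sq_add_le hρ (ψ x) (g x)
  rcases extIntegral_eq_bot_or_integrable (aestronglyMeasurable_mul_sq hψ hg.1)
    (aestronglyMeasurable_entropyIntegrand ρ hg.1) (hint.const_mul ρ)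
    (fun x => by
      rw [entropyIntegrand]
      have : 0 ≤ ρ * (|g x| - dualProfile ρ (ψ x)) ^ 2 := by positivity
      linarith [hy x])
    (lintegral_entropyIntegrand_ne_top hρ ⟨hg, G, hG⟩) with hb | ⟨hi, hi'⟩
  · exact Or.inl hb
  have hprof : MemLp (fun x => dualProfile ρ (ψ x)) 2 volume :=
    (memLp_two_iff_integrable_sq ((continuous_dualProfile ρ).comp_aestronglyMeasurable
      hψ.aestronglyMeasurable)).2 hint
  have hd2 : Integrable fun x => (|g x| - dualProfile ρ (ψ x)) ^ 2 :=
    integrable_sq' (hg.abs.sub hprof)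
  refine Or.inr ⟨extIntegral_of_integrable hi, (integrable_entropyIntegrand_iff hρ).1 hi', hd2, ?_⟩
  have h := integral_mono (hi.add (hd2.const_mul ρ)) (hi'.add (hint.const_mul ρ)) hy
  simp only [Pi.add_apply] at h
  rw [integral_add hi (hd2.const_mul ρ), integral_add hi' (hint.const_mul ρ),
    integral_const_mul, integral_const_mul] at h
  have h2 : ∫ x, entropyIntegrand ρ g x = ρ * ∫ x, g x ^ 2 * Real.log (g x ^ 2) :=
    integral_const_mul _ _
  rw [h2] at h
  rw [mul_sub, mul_sharpBound hρ]
  linarith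

/-- Both parts of the dual gap, the logarithmic Sobolev deficit and the distance to the Legendre
maximiser, are nonnegative and are dropped. -/
theorem specTop_le (hd : 1 ≤ d) {ρ : ℝ} (hρ : 0 < ρ) {ψ : E d → ℝ} (hψ : AEMeasurable ψ volume)
    (hint : Integrable fun x => dualProfile ρ (ψ x) ^ 2) :
    specTop ψ ≤ ((ρ * (∫ x, dualProfile ρ (ψ x) ^ 2) - chiValue d ρ : ℝ) : EReal) := by
  refine iSup₂_le fun g hg => ?_
  obtain ⟨hg2, ⟨G, hG⟩, h1⟩ := mem_unitH1_iff.1 hg.1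
  rcases pairing_eq_bot_or_le hρ hψ hint hg2 hG with hb | ⟨hp, hent, -, hle⟩
  · rw [hb, EReal.bot_sub]
    exact bot_le
  · rw [hp, gradNormSq_eq hG, ← EReal.coe_sub, EReal.coe_le_coe_iff]
    have h2 := mul_nonneg hρ.le (sub_nonneg.2
      (logSobolev hd hg2 hG h1 hent (τ := 1 / (2 * ρ)) (by positivity)))
    have h3 : 0 ≤ ρ * ∫ x, (|g x| - dualProfile ρ (ψ x)) ^ 2 :=
      mul_nonneg hρ.le (integral_nonneg fun x => sq_nonneg _)
    linarith

theorem chiValue_le_dualFunctional (hd : 1 ≤ d) {ρ : ℝ} (hρ : 0 < ρ) {ψ : E d → ℝ}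
    (hψ : AEMeasurable ψ volume) : (chiValue d ρ : EReal) ≤ dualFunctional ρ ψ := by
  rw [dualFunctional]
  split_ifs with h
  · exact le_top
  · have hint := integrable_dualProfile_sq hρ hψ h
    rw [legendre_of_integrable hρ hψ hint]
    refine le_trans (le_of_eq ?_) (EReal.sub_le_sub le_rfl (specTop_le hd hρ hψ hint))
    rw [← EReal.coe_sub, sub_sub_cancel]

/-- This explains the form of ψ_ρ: it is the potential whose Legendre maximiser is g_ρ. -/
theorem dualProfile_parabola {ρ : ℝ} (hρ : 0 < ρ) (x : E d) :
    dualProfile ρ (parabola d ρ x) = gaussian d ρ x := by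
  have hpi := Real.pi_pos
  rw [dualProfile, parabola, gaussian, Real.rpow_def_of_pos (by positivity), ← Real.exp_add]
  congr 1
  field_simp
  ring

/-- The shifted Gaussian is the Legendre maximiser and has no logarithmic Sobolev deficit, so as
trial function for λ it closes the gap. Here ℒ = ρ. -/
theorem dualFunctional_parabola (hd : 1 ≤ d) {ρ : ℝ} (hρ : 0 < ρ) (a : E d) :
    dualFunctional ρ (fun x => parabola d ρ (x - a)) = (chiValue d ρ : EReal) := by
  have hc : Continuous fun x : E d => parabola d ρ (x - a) := by unfold parabola; fun_prop
  have hψ := hc.aemeasurable (μ := volume)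
  refine le_antisymm ?_ (chiValue_le_dualFunctional hd hρ hψ)
  have i1 := integrable_sq' (memLp_shifted_gaussian hρ a)
  obtain ⟨i2, h2⟩ := shifted_gaussian_entropy hρ a
  have hL : legendre ρ (fun x => parabola d ρ (x - a)) = (ρ : EReal) := by
    rw [legendre_of_integrable hρ hψ] <;> simp only [dualProfile_parabola hρ]
    · rw [integral_shifted_gaussian_sq hρ, mul_one]
    · exact i1
  have hpt : ∀ x, parabola d ρ (x - a) * gaussian d ρ (x - a) ^ 2 =
      ρ * (gaussian d ρ (x - a) ^ 2 * Real.log (gaussian d ρ (x - a) ^ 2)) +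
        ρ * gaussian d ρ (x - a) ^ 2 := fun x => by
    have := mul_dualProfile_sq hρ (parabola d ρ (x - a))
    rwa [dualProfile_parabola hρ] at this
  have i3 : Integrable fun x => parabola d ρ (x - a) * gaussian d ρ (x - a) ^ 2 := by
    simp only [hpt]
    exact (i2.const_mul ρ).add (i1.const_mul ρ)
  have hS : ((ρ - chiValue d ρ : ℝ) : EReal) ≤ specTop fun x => parabola d ρ (x - a) := by
    have hG := isWeakGradient_gaussian hρ a
    refine le_trans (le_of_eq ?_) (le_iSup₂ (f := fun g _ =>
      pairing (fun x => parabola d ρ (x - a)) g - (gradNormSq g : EReal))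
      (fun x => gaussian d ρ (x - a)) ⟨mem_unitH1_iff.2 ⟨memLp_shifted_gaussian hρ a, ⟨_, hG⟩,
        integral_shifted_gaussian_sq hρ a⟩, Or.inl i3.lintegral_lt_top.ne⟩)
    rw [pairing, extIntegral_of_integrable i3, gradNormSq_eq hG,
      integral_norm_gaussianGradient_sq hρ, ← EReal.coe_sub, EReal.coe_eq_coe_iff]
    simp only [hpt]
    rw [integral_add (i2.const_mul ρ) (i1.const_mul ρ), integral_const_mul, integral_const_mul, h2,
      integral_shifted_gaussian_sq hρ]
    have := gaussian_energy_value (d := d) hρ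
    linarith
  rw [dualFunctional, hL, if_neg (EReal.coe_ne_top ρ)]
  refine (EReal.sub_le_sub le_rfl hS).trans (le_of_eq ?_)
  rw [← EReal.coe_sub, sub_sub_cancel]

/-- The difference factorises as (|u| - h)(|u| + h), and a weighted product inequality separates the
factors. It turns L² closeness of |u| and h into L¹ closeness of their squares. -/
theorem integral_abs_sq_sub_sq_le {u h : E d → ℝ} (hu : Integrable fun x => u x ^ 2)
    (hh : Integrable fun x => h x ^ 2) (hh0 : ∀ x, 0 ≤ h x)
    (hdiff : Integrable fun x => (|u x| - h x) ^ 2)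
    {ε : ℝ} (hε : 0 < ε) : ∫ x, |u x ^ 2 - h x ^ 2| ≤
      (∫ x, (|u x| - h x) ^ 2) / (2 * ε) + ε * ((∫ x, u x ^ 2) + ∫ x, h x ^ 2) := by
  rw [← integral_add hu hh, ← integral_const_mul, ← integral_div,
    ← integral_add (hdiff.div_const _) (g := fun x => ε * (u x ^ 2 + h x ^ 2))
      ((hu.add hh).const_mul ε)]
  refine integral_mono (hu.sub hh).abs ((hdiff.div_const _).add ((hu.add hh).const_mul ε))
    fun x => ?_
  have h0 := hh0 x
  have h1 : |u x ^ 2 - h x ^ 2| = |(|u x| - h x)| * (|u x| + h x) := by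
    rw [← sq_abs (u x), sq_sub_sq, abs_mul, abs_of_nonneg (by positivity : 0 ≤ |u x| + h x),
      mul_comm]
  beta_reduce
  rw [h1, ← sq_abs (|u x| - h x), ← sq_abs (u x), ← sub_nonneg]
  set p := |(|u x| - h x)| with hp
  have hpp : p ^ 2 = (|u x| - h x) ^ 2 := sq_abs _
  have e : p ^ 2 / (2 * ε) + ε * (|u x| ^ 2 + h x ^ 2) - p * (|u x| + h x) =
      (p - ε * (|u x| + h x)) ^ 2 / (2 * ε) + ε / 2 * (|u x| - h x) ^ 2 := by
    field_simp
    ring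
  rw [e]
  positivity

/-- The minimisers of the dual problem are translates of the parabola. -/
theorem eq_parabola_of_dualFunctional_eq (hd : 1 ≤ d) {ρ : ℝ} (hρ : 0 < ρ) {ψ : E d → ℝ}
    (hψ : Continuous ψ) (h : dualFunctional ρ ψ = (chiValue d ρ : EReal)) :
    ∃ a : E d, ∀ x, ψ x = parabola d ρ (x - a) := by
  have hψm := hψ.aemeasurable (μ := volume)
  have hL : legendre ρ ψ ≠ ⊤ := fun hL => by
    rw [dualFunctional, if_pos hL] at h
    exact EReal.coe_ne_top _ h.symm
  have hint := integrable_dualProfile_sq hρ hψm hL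
  set H := ∫ x, dualProfile ρ (ψ x) ^ 2 with hH
  rw [dualFunctional, if_neg hL, legendre_of_integrable hρ hψm hint, ← hH] at h
  have hS : specTop ψ = ((ρ * H - chiValue d ρ : ℝ) : EReal) := by
    induction hs : specTop ψ with
    | bot => rw [hs, EReal.coe_sub_bot] at h; exact absurd h.symm (EReal.coe_ne_top _)
    | top => rw [hs, EReal.sub_top] at h; exact absurd h.symm (EReal.coe_ne_bot _)
    | coe s =>
      rw [hs, ← EReal.coe_sub, EReal.coe_eq_coe_iff] at h
      rw [← h, sub_sub_cancel]
  have hseq : ∀ n : ℕ, ∃ g : E d → ℝ, ∃ G : E d → E d, MemLp g 2 volume ∧ IsWeakGradient g G ∧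
      ∫ x, g x ^ 2 = 1 ∧ Integrable (fun x => g x ^ 2 * Real.log (g x ^ 2)) ∧
      Integrable (fun x => (|g x| - dualProfile ρ (ψ x)) ^ 2) ∧
      (∫ x, (|g x| - dualProfile ρ (ψ x)) ^ 2) ≤ (1 / ((n : ℝ) + 1)) ^ 2 ∧
      sharpBound d (∫ x, ‖G x‖ ^ 2) (1 / (2 * ρ)) - ∫ x, g x ^ 2 * Real.log (g x ^ 2) ≤
        (1 / ((n : ℝ) + 1)) ^ 2 := by
    intro n
    -- A trial function within ρ/(n + 1)² of the supremum has both parts of its gap below that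
    -- amount, since both are nonnegative. The square survives the later division by the weight 1/(n
    -- + 1).
    have hlt : ((ρ * H - chiValue d ρ - ρ * (1 / ((n : ℝ) + 1)) ^ 2 : ℝ) : EReal) < specTop ψ := by
      rw [hS, EReal.coe_lt_coe_iff]
      have : 0 < ρ * (1 / ((n : ℝ) + 1)) ^ 2 := by positivity
      linarith
    obtain ⟨g, hg⟩ := lt_iSup_iff.1 hlt
    obtain ⟨hgm, hg⟩ := lt_iSup_iff.1 hg
    obtain ⟨hg2, ⟨G, hG⟩, h1⟩ := mem_unitH1_iff.1 hgm.1
    rcases pairing_eq_bot_or_le hρ hψm hint hg2 hG with hb | ⟨hp, hent, hdiff, hle⟩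
    · rw [hb, EReal.bot_sub] at hg
      exact absurd hg not_lt_bot
    rw [hp, gradNormSq_eq hG, ← EReal.coe_sub, EReal.coe_lt_coe_iff] at hg
    have h2 := mul_nonneg hρ.le (sub_nonneg.2
      (logSobolev hd hg2 hG h1 hent (τ := 1 / (2 * ρ)) (by positivity)))
    have h3 : 0 ≤ ρ * ∫ x, (|g x| - dualProfile ρ (ψ x)) ^ 2 :=
      mul_nonneg hρ.le (integral_nonneg fun x => sq_nonneg _)
    refine ⟨g, G, hg2, hG, h1, hent, hdiff, le_of_mul_le_mul_left ?_ hρ,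
      le_of_mul_le_mul_left ?_ hρ⟩ <;> linarith
  choose g G hg hG h1 hent hdiff hsmall hdef using hseq
  have hε : Tendsto (fun n : ℕ => 1 / ((n : ℝ) + 1)) atTop (𝓝 0) :=
    tendsto_one_div_add_atTop_nhds_zero_nat
  have hlim : Tendsto (fun n => ∫ x, |g n x ^ 2 - dualProfile ρ (ψ x) ^ 2|) atTop (𝓝 0) := by
    have ht : Tendsto (fun n : ℕ => 1 / ((n : ℝ) + 1) * (1 / 2 + (1 + H))) atTop (𝓝 0) := by
      simpa using hε.mul_const (1 / 2 + (1 + H))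
    refine squeeze_zero (fun n => integral_nonneg fun x => abs_nonneg _) (fun n => ?_) ht
    have hpos : 0 < 1 / ((n : ℝ) + 1) := by positivity
    have h2 := integral_abs_sq_sub_sq_le (integrable_sq' (hg n)) hint
      (fun x => (dualProfile_pos ρ _).le) (hdiff n) hpos
    rw [h1 n, ← hH] at h2
    refine h2.trans ?_
    have h3 : (∫ x, (|g n x| - dualProfile ρ (ψ x)) ^ 2) / (2 * (1 / ((n : ℝ) + 1))) ≤
        1 / ((n : ℝ) + 1) * (1 / 2) := by
      rw [div_le_iff₀ (by positivity)]
      refine (hsmall n).trans (le_of_eq ?_)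
      ring
    linarith
  -- Normalisation passes to the L¹ limit, which fixes the additive constant in ψ.
  have hH1 : H = 1 := by
    have hle : ∀ n, |1 - H| ≤ ∫ x, |g n x ^ 2 - dualProfile ρ (ψ x) ^ 2| := fun n => by
      rw [← h1 n, hH, ← integral_sub (integrable_sq' (hg n)) hint]
      exact abs_integral_le_integral_abs
    have h0 : |1 - H| ≤ 0 := ge_of_tendsto' hlim hle
    linarith [abs_nonpos_iff.1 h0]
  have hdef0 : Tendsto (fun n => sharpBound d (∫ x, ‖G n x‖ ^ 2) (1 / (2 * ρ)) -
      ∫ x, g n x ^ 2 * Real.log (g n x ^ 2)) atTop (𝓝 0) := by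
    have ht : Tendsto (fun n : ℕ => (1 / ((n : ℝ) + 1)) ^ 2) atTop (𝓝 0) := by
      simpa using hε.pow 2
    exact squeeze_zero (fun n => sub_nonneg.2
      (logSobolev hd (hg n) (hG n) (h1 n) (hent n) (τ := 1 / (2 * ρ)) (by positivity))) hdef ht
  obtain ⟨a, ha⟩ := ae_eq_heatKernel_of_deficit_tendsto_zero hd (τ := 1 / (2 * ρ)) (by positivity)
    hg hG h1 hent hdef0 hint (fun x => sq_nonneg _) hH1 hlim
  -- Continuity of ψ upgrades the identity of densities from almost every to every point; the
  -- logarithm then recovers ψ.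
  refine ⟨a, fun x => ?_⟩
  have hcont : Continuous fun x => dualProfile ρ (ψ x) ^ 2 :=
    ((continuous_dualProfile ρ).comp hψ).pow 2
  have hcont' : Continuous fun x => gaussian d ρ (x - a) ^ 2 := by
    have := continuous_gaussian (d := d) ρ
    fun_prop
  simp only [← gaussian_sq hρ] at ha
  have hx := congrFun ((hcont.ae_eq_iff_eq volume hcont').1 ha) x
  simp only [← dualProfile_parabola hρ] at hx
  have hlog := congrArg Real.log hx
  rw [log_dualProfile_sq, log_dualProfile_sq] at hlog
  field_simp at hlog
  linarith

/-- The minimisers of the energy are translates of the Gaussian. -/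
theorem ae_eq_gaussian_of_energy_eq (hd : 1 ≤ d) {ρ : ℝ} (hρ : 0 < ρ) {g : E d → ℝ}
    (hg : g ∈ unitH1 d) (h : energy ρ g = (chiValue d ρ : EReal)) :
    ∃ a : E d, (∀ᵐ x, g x = gaussian d ρ (x - a)) ∨ ∀ᵐ x, g x = -gaussian d ρ (x - a) := by
  obtain ⟨hg2, ⟨G, hG⟩, h1⟩ := mem_unitH1_iff.1 hg
  have hent : Integrable fun x => g x ^ 2 * Real.log (g x ^ 2) := by
    by_contra hni
    rw [energy_eq_top hρ hg.1 hni] at h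
    exact EReal.coe_ne_top _ h.symm
  rw [energy_of_integrable hρ hG hent, EReal.coe_eq_coe_iff] at h
  have hdef : sharpBound d (∫ x, ‖G x‖ ^ 2) (1 / (2 * ρ)) -
      ∫ x, g x ^ 2 * Real.log (g x ^ 2) = 0 := by
    have h2 := mul_sharpBound (d := d) hρ (∫ x, ‖G x‖ ^ 2)
    have h3 : ρ * (sharpBound d (∫ x, ‖G x‖ ^ 2) (1 / (2 * ρ)) -
        ∫ x, g x ^ 2 * Real.log (g x ^ 2)) = 0 := by
      rw [mul_sub]
      linarith
    exact (mul_eq_zero.1 h3).resolve_left hρ.ne'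
  -- Stability applied to the constant sequence g gives the equality case.
  obtain ⟨a, ha⟩ := ae_eq_heatKernel_of_deficit_tendsto_zero hd (τ := 1 / (2 * ρ)) (by positivity)
    (g := fun _ => g) (G := fun _ => G) (fun _ => hg2) (fun _ => hG) (fun _ => h1) (fun _ => hent)
    (by simp only [hdef]; exact tendsto_const_nhds) (integrable_sq' hg2) (fun x => sq_nonneg _) h1
    (by simp)
  refine ⟨a, ae_eq_gaussian_of_sq hρ hg2 hG ?_⟩
  filter_upwards [ha] with x hx
  rw [hx, gaussian_sq hρ]

end LogSobolevVar

end

/-! ### Assembly of the assertions. -/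

theorem proposition1p8 (d : ℕ) (hd : 1 ≤ d) (ρ : ℝ) (hρ : 0 < ρ) :
    -- `ℋ(g²) ∈ [-∞, ∞)` is well defined on `H¹(ℝ^d)`
    (∀ g : LogSobolevVar.E d → ℝ, LogSobolevVar.MemH1 g →
      (∫⁻ x, ENNReal.ofReal (LogSobolevVar.entropyIntegrand ρ g x)) ≠ ⊤) ∧
    -- the minimisers of the energy are exactly the shifts of `g_ρ`, up to the sign
    (∀ g : LogSobolevVar.E d → ℝ,
      (g ∈ LogSobolevVar.unitH1 d ∧ LogSobolevVar.energy ρ g = LogSobolevVar.chi d ρ) ↔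
        ∃ a : LogSobolevVar.E d,
          (∀ᵐ x, g x = LogSobolevVar.gaussian d ρ (x - a)) ∨
          (∀ᵐ x, g x = -LogSobolevVar.gaussian d ρ (x - a))) ∧
    -- the value of the infimum
    LogSobolevVar.chi d ρ =
      ((ρ * d * (1 - 1 / 2 * Real.log (ρ / Real.pi)) : ℝ) : EReal) ∧
    -- the Legendre transform
    (∀ ψ : LogSobolevVar.E d → ℝ, AEMeasurable ψ volume →
      LogSobolevVar.legendre ρ ψ =
        ((ENNReal.ofReal (ρ / Real.exp 1) *
          ∫⁻ x, ENNReal.ofReal (Real.exp (1 / ρ * ψ x)) : ℝ≥0∞) : EReal)) ∧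
    -- the dual representation
    LogSobolevVar.chi d ρ =
      (⨅ ψ : C(LogSobolevVar.E d, ℝ), LogSobolevVar.dualFunctional ρ ψ) ∧
    -- the minimisers of the dual problem are exactly the shifts of `ψ_ρ`
    (∀ ψ : C(LogSobolevVar.E d, ℝ),
      LogSobolevVar.dualFunctional ρ ψ = LogSobolevVar.chi d ρ ↔
        ∃ a : LogSobolevVar.E d, ∀ x, ψ x = LogSobolevVar.parabola d ρ (x - a)) := by
  -- The equivalence contains attainment, since its right side holds for g_ρ itself; the same
  -- applies to the dual problem.
  have hmin : ∀ g : LogSobolevVar.E d → ℝ,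
      (g ∈ LogSobolevVar.unitH1 d ∧ LogSobolevVar.energy ρ g = LogSobolevVar.chi d ρ) ↔
        ∃ a : LogSobolevVar.E d,
          (∀ᵐ x, g x = LogSobolevVar.gaussian d ρ (x - a)) ∨
          (∀ᵐ x, g x = -LogSobolevVar.gaussian d ρ (x - a)) := by
    intro g
    rw [LogSobolevVar.chi_eq hd hρ]
    exact ⟨fun h => LogSobolevVar.ae_eq_gaussian_of_energy_eq hd hρ h.1 h.2,
      fun ⟨_, h⟩ => LogSobolevVar.energy_of_ae_eq_gaussian hρ h⟩
  refine ⟨fun g hg => LogSobolevVar.lintegral_entropyIntegrand_ne_top hρ hg, hmin,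
    LogSobolevVar.chi_eq hd hρ, fun ψ hψ => LogSobolevVar.legendre_eq hρ hψ, ?_, fun ψ => ?_⟩
  · rw [LogSobolevVar.chi_eq hd hρ]
    refine le_antisymm (le_iInf fun ψ =>
      LogSobolevVar.chiValue_le_dualFunctional hd hρ ψ.continuous.aemeasurable) ?_
    refine iInf_le_of_le (⟨LogSobolevVar.parabola d ρ, by
      unfold LogSobolevVar.parabola; fun_prop⟩ : C(LogSobolevVar.E d, ℝ)) (le_of_eq ?_)
    have h := LogSobolevVar.dualFunctional_parabola hd hρ 0
    simp only [sub_zero] at h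
    exact h
  · rw [LogSobolevVar.chi_eq hd hρ]
    refine ⟨LogSobolevVar.eq_parabola_of_dualFunctional_eq hd hρ ψ.continuous, ?_⟩
    rintro ⟨a, ha⟩
    rw [funext ha]
    exact LogSobolevVar.dualFunctional_parabola hd hρ a
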